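/- **Conventions.** Let $\mathbb{E}$ be a field or a complete discrete valuation ring with uniformizer $\varpi$. Let $\mathcal{T}$ be an $\mathbb{E}$-linear triangulated category with a Tate twist, i.e. an $\mathbb{E}$-linear triangulated autoequivalence $\langle 1\rangle$ with powers $\langle k\rangle$, $k\in\mathbb{Z}$. Assume that $\mathcal{T}$ is graded $\mathrm{Hom}$-finite: $\bigoplus_{k}\mathrm{Hom}(X,Y\langle k\rangle)$ is a finitely generated $\mathbb{E}$-module for all $X,Y$. Let $I$ be an ordered set isomorphic to a subset of $(\mathbb{Z}_{\ge 0},\le)$. A *graded exceptional sequence* is a family $(\nabla_i)_{i\in I}$ of objects such that $\mathrm{Hom}(\nabla_i,\nabla_j[n]\langle k\rangle)=0$ for $i<j$ and all $n,k$; $\mathrm{Hom}(\nabla_i,\nabla_i[n]\langle k\rangle)=0$ unless $n=k=0$; $\mathrm{End}(\nabla_i)\cong\mathbb{E}$; and the $\nabla_i\langle k\rangle$ generate $\mathcal{T}$ as a triangulated category. Let $\mathcal{T}_{<i}$, resp. $\mathcal{T}_{\le i}$, be the full triangulated subcategory generated by the $\nabla_j\langle k\rangle$ with $j<i$, resp.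 $j\le i$, and let $\Pi_i:\mathcal{T}_{\le i}\to\mathcal{T}_{\le i}/\mathcal{T}_{<i}$ be the Verdier quotient functor. A family $(\Delta_i)_{i\in I}$ is a *dual sequence* if $\mathrm{Hom}(\Delta_j,\nabla_i[n]\langle k\rangle)=0$ for $i<j$ and all $n,k$, and if $\Delta_i\in\mathcal{T}_{\le i}$ and $\Pi_i(\Delta_i)\cong\Pi_i(\nabla_i)$ for all $i$. Given both, let $\mathcal{T}^{\le 0}$ be generated under extensions by the $\Delta_j[n]\langle k\rangle$ with $n\ge 0$, and $\mathcal{T}^{\ge 0}$ by the $\nabla_j[n]\langle k\rangle$ and, if $\mathbb{E}$ is not a field, the $\bar\nabla_j[n]\langle k\rangle$, with $n\le 0$, where $\bar\nabla_j$ is the cone of $\varpi\cdot\mathrm{id}:\nabla_j\to\nabla_j$. When this is a t-structure, let $\mathscr{A}$ be its heart and $H^0:\mathcal{T}\to\mathscr{A}$ the cohomology functor. A *canonical map* $\Delta_i\to\nabla_i$ is one that $\Pi_i$ sends to an isomorphism, and $L_i:=\mathrm{im}(H^0(\Delta_i)\to H^0(\nabla_i))$ is the image in $\mathscr{A}$ of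 $H^0$ of such a map. If $\mathbb{E}$ is a discrete valuation ring, an object $X$ of $\mathscr{A}$ is *torsion* if $\varpi^n\cdot\mathrm{id}_X=0$ for some $n\ge 1$, and $L_i^+$ denotes the largest subobject of $H^0(\nabla_i)$ that contains $L_i$ and is such that $L_i^+/L_i$ is torsion. The *head* (resp. *socle*) of an object is its largest semisimple quotient (resp. subobject). **Setting.** Let $\mathbb{O}$ be a complete discrete valuation ring with fraction field $\mathbb{K}$ and residue field $\mathbb{F}$. Let $\mathcal{T}_{\mathbb{O}}$, $\mathcal{T}_{\mathbb{K}}$, $\mathcal{T}_{\mathbb{F}}$ be graded $\mathrm{Hom}$-finite triangulated categories with Tate twists, linear over $\mathbb{O}$, $\mathbb{K}$, $\mathbb{F}$ respectively. Let $(\nabla_i)_{i\in I}$ be a graded exceptional sequence in $\mathcal{T}_{\mathbb{O}}$ with a dual sequence $(\Delta_i)_{i\in I}$. Let $\mathbb{K}(-):\mathcal{T}_{\mathbb{O}}\to\mathcal{T}_{\mathbb{K}}$ and $\mathbb{F}(-):\mathcal{T}_{\mathbb{O}}\to\mathcal{T}_{\mathbb{F}}$ be $\mathbb{O}$-linear triangulated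 functors commuting with the Tate twists up to natural isomorphism, such that for all $X,Y\in\mathcal{T}_{\mathbb{O}}$ * $\mathbb{K}(-)$ induces an isomorphism $\mathbb{K}\otimes_{\mathbb{O}}\mathrm{Hom}(X,Y)\cong\mathrm{Hom}(\mathbb{K}(X),\mathbb{K}(Y))$; * there is a short exact sequence, natural in $X$ and $Y$, $$0\to\mathbb{F}\otimes_{\mathbb{O}}\mathrm{Hom}(X,Y)\to\mathrm{Hom}(\mathbb{F}(X),\mathbb{F}(Y))\to\mathrm{Tor}_1^{\mathbb{O}}(\mathbb{F},\mathrm{Hom}(X,Y[1]))\to 0$$ whose first map is induced by $\mathbb{F}(-)$. Assume moreover that $(\mathbb{K}(\nabla_i))_{i\in I}$ and $(\mathbb{F}(\nabla_i))_{i\in I}$ are graded exceptional sequences in $\mathcal{T}_{\mathbb{K}}$ and $\mathcal{T}_{\mathbb{F}}$. **Statement.** The construction above, applied to $(\nabla_i),(\Delta_i)$ over $\mathbb{O}$ and to $(\Bbbk(\nabla_i)),(\Bbbk(\Delta_i))$ over $\Bbbk\in\{\mathbb{K},\mathbb{F}\}$, gives t-structures on $\mathcal{T}_{\mathbb{O}}$,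 $\mathcal{T}_{\mathbb{K}}$, $\mathcal{T}_{\mathbb{F}}$, with hearts $\mathscr{A}_{\mathbb{O}}$, $\mathscr{A}_{\mathbb{K}}$, $\mathscr{A}_{\mathbb{F}}$; in all three cases canonical maps exist for every $i\in I$, and $L_i^+(\mathbb{O})$ exists. Write $L_i(\mathbb{O}),L_i^+(\mathbb{O})\in\mathscr{A}_{\mathbb{O}}$, $L_i(\mathbb{K})\in\mathscr{A}_{\mathbb{K}}$ and $L_i(\mathbb{F})\in\mathscr{A}_{\mathbb{F}}$ for the resulting objects (for any choice of the canonical maps). Then for all $i\in I$: 1. $\mathbb{K}(L_i(\mathbb{O}))\cong\mathbb{K}(L_i^+(\mathbb{O}))\cong L_i(\mathbb{K})$. 2. The objects $\mathbb{F}(L_i(\mathbb{O}))$ and $\mathbb{F}(L_i^+(\mathbb{O}))$ lie in $\mathscr{A}_{\mathbb{F}}$. Moreover, $\mathbb{F}(L_i(\mathbb{O}))$ has a simple head, and $\mathbb{F}(L_i^+(\mathbb{O}))$ has a simple socle, both isomorphic to $L_i(\mathbb{F})$. -/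

import Mathlib

open CategoryTheory CategoryTheory.Limits CategoryTheory.Pretriangulated CategoryTheory.Triangulated
open scoped TensorProduct ZeroObject

universe u u' v v' v'' w w' w'' x

noncomputable section

namespace ExcSeq

/-! ### The heart of a t-structure as an abelian category -/

section Heart

variable {C : Type w} [Category.{v} C] [Preadditive C] [HasZeroObject C] [HasShift C ℤ]
  [∀ n : ℤ, (shiftFunctor C n).Additive] [Pretriangulated C] (t : TStructure C)

/-- The heart of a t-structure, as a full subcategory. -/
abbrev HeartCat : Type w := t.heart.FullSubcategory

theorem heart_hom_shift_neg ⦃X Y : HeartCat t⦄ ⦃n : ℤ⦄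
    (f : t.heart.ι.obj X ⟶ (t.heart.ι.obj Y)⟦n⟧) (hn : n < 0) : f = 0 := by
  have h₁ : t.IsLE X.obj 0 := ((t.mem_heart_iff _).1 X.property).1
  have h₂ : t.IsGE Y.obj 0 := ((t.mem_heart_iff _).1 Y.property).2
  exact t.zero_of_isLE_of_isGE f 0 (-n) (by lia) h₁ (t.isGE_shift Y.obj 0 n (-n) (by lia))

instance heart_containsZero : t.heart.ContainsZero where
  exists_zero := ⟨0, isZero_zero C, (t.mem_heart_iff _).2 ⟨inferInstance, inferInstance⟩⟩

instance heart_closedUnderBinaryProducts : t.heart.IsClosedUnderBinaryProducts where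
  limitsOfShape_le := by
    rintro X ⟨p⟩
    have h₁ := (t.mem_heart_iff _).1 (p.prop_diag_obj (.mk .left))
    have h₂ := (t.mem_heart_iff _).1 (p.prop_diag_obj (.mk .right))
    refine t.heart.prop_of_iso
      (IsLimit.conePointUniqueUpToIso (prodIsProd _ _)
        ((IsLimit.postcomposeHomEquiv (diagramIsoPair p.diag) _).2 p.isLimit))
      ((t.mem_heart_iff _).2
        ⟨t.isLE₂ _ (binaryProductTriangle_distinguished _ _) 0 h₁.1 h₂.1,
          t.isGE₂ _ (binaryProductTriangle_distinguished _ _) 0 h₁.2 h₂.2⟩)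

instance heart_closedUnderFiniteProducts : t.heart.IsClosedUnderFiniteProducts := .mk'

variable [IsTriangulated C]

theorem heart_admissible :
    AbelianSubcategory.admissibleMorphism t.heart.ι = ⊤ := by
  rw [eq_top_iff]
  rintro X₁ X₂ f₁ - X₃ f₂ f₃ hT
  obtain ⟨h₁LE, h₁GE⟩ := (t.mem_heart_iff _).1 X₁.property
  obtain ⟨h₂LE, h₂GE⟩ := (t.mem_heart_iff _).1 X₂.property
  have hs₁ : t.IsLE (X₁.obj⟦(1 : ℤ)⟧) (-1) := t.isLE_shift X₁.obj 0 1 (-1) (by lia)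
  have hs₂ : t.IsGE (X₁.obj⟦(1 : ℤ)⟧) (-1) := t.isGE_shift X₁.obj 0 1 (-1) (by lia)
  have hLE : t.IsLE X₃ 0 := t.isLE₂ _ (rot_of_distTriang _ hT) 0 h₂LE
      (t.isLE_of_le (X₁.obj⟦(1 : ℤ)⟧) (-1) 0 (by lia))
  have hGE : t.IsGE X₃ (-1) := t.isGE₂ _ (rot_of_distTriang _ hT) (-1)
      (t.isGE_of_ge X₂.obj (-1) 0 (by lia)) hs₂
  have hA : t.IsGE ((t.truncLE (-1)).obj X₃) (-1) := inferInstance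
  have hQ : t.heart ((t.truncGE 0).obj X₃) :=
    (t.mem_heart_iff _).2 ⟨inferInstance, inferInstance⟩
  have hK : t.heart (((t.truncLE (-1)).obj X₃)⟦(-1 : ℤ)⟧) :=
    (t.mem_heart_iff _).2 ⟨t.isLE_shift _ (-1) (-1) 0 (by lia), t.isGE_shift _ (-1) (-1) 0 (by lia)⟩
  let e : (((t.truncLE (-1)).obj X₃)⟦(-1 : ℤ)⟧)⟦(1 : ℤ)⟧ ≅ (t.truncLE (-1)).obj X₃ :=
    (shiftEquiv C (1 : ℤ)).counitIso.app _
  refine ⟨⟨_, hK⟩, ⟨_, hQ⟩, e.hom ≫ (t.truncLEι (-1)).app X₃, (t.truncGEπ 0).app X₃,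
    (t.truncGEδLE (-1) 0 (by lia)).app X₃ ≫ e.inv⟦(1 : ℤ)⟧', ?_⟩
  refine isomorphic_distinguished _ (t.triangleLEGE_distinguished (-1) 0 (by lia) X₃) _ ?_
  refine Triangle.isoMk _ _ e (Iso.refl _) (Iso.refl _) ?_ ?_ ?_
  · exact Category.comp_id _
  · exact (Category.comp_id _).trans (Category.id_comp _).symm
  · refine Eq.trans ?_ (Category.id_comp _).symm
    refine (Category.assoc _ _ _).trans ?_
    refine (congrArg (_ ≫ ·) ?_).trans (Category.comp_id _)
    exact ((shiftFunctor C (1 : ℤ)).mapIso e).inv_hom_id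

instance heartAbelian : Abelian (HeartCat t) :=
  AbelianSubcategory.abelian t.heart.ι (heart_hom_shift_neg t) (heart_admissible t)

/-- The zeroth cohomology functor `H⁰ = τ^{≥ 0} τ^{≤ 0}`, with values in the heart. -/
def H0 : C ⥤ HeartCat t :=
  t.heart.lift (t.truncGELE 0 0) fun _ => (t.mem_heart_iff _).2 ⟨inferInstance, inferInstance⟩

end Heart

/-! ### Heads and socles in an abelian category -/

section Abelian

variable {A : Type w} [Category.{v} A] [Abelian A]

attribute [local instance] Abelian.hasFiniteBiproducts

/-- A semisimple object: a finite direct sum of simple objects. -/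
def IsSemisimpleObj (X : A) : Prop :=
  ∃ (n : ℕ) (S : Fin n → A), (∀ j, Simple (S j)) ∧ Nonempty (X ≅ ⨁ S)

/-- `q` exhibits `Q` as the head of `X`, i.e. as the largest semisimple quotient of `X`. -/
structure IsHead {X Q : A} (q : X ⟶ Q) : Prop where
  epi : Epi q
  semisimple : IsSemisimpleObj Q
  factors : ∀ (Q' : A) (q' : X ⟶ Q'), Epi q' → IsSemisimpleObj Q' → ∃ r : Q ⟶ Q', q ≫ r = q'

/-- `s` exhibits `S` as the socle of `X`, i.e. as the largest semisimple subobject of `X`. -/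
structure IsSocle {S X : A} (s : S ⟶ X) : Prop where
  mono : Mono s
  semisimple : IsSemisimpleObj S
  factors : ∀ (S' : A) (s' : S' ⟶ X), Mono s' → IsSemisimpleObj S' → ∃ r : S' ⟶ S, r ≫ s = s'

/-- `X` has a simple head, and it is isomorphic to `S`. -/
def HasSimpleHead (X S : A) : Prop := Simple S ∧ ∃ q : X ⟶ S, IsHead q

/-- `X` has a simple socle, and it is isomorphic to `S`. -/
def HasSimpleSocle (X S : A) : Prop := Simple S ∧ ∃ s : S ⟶ X, IsSocle s

/-- An object killed by a positive power of a uniformizer of the discrete valuation ring `E`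
(whose uniformizers are its irreducible elements). -/
def IsTorsionObj (E : Type u) [CommRing E] [Linear E A] (X : A) : Prop :=
  ∃ ϖ : E, Irreducible ϖ ∧ ∃ n : ℕ, 1 ≤ n ∧ (ϖ ^ n) • 𝟙 X = 0

end Abelian

/-! ### Subcategories generated by objects of a triangulated category -/

section Generation

variable {C : Type w} [Category.{v} C] [Preadditive C] [HasZeroObject C] [HasShift C ℤ]
  [∀ n : ℤ, (shiftFunctor C n).Additive] [Pretriangulated C]

/-- The smallest strictly full triangulated subcategory containing `P`. -/
def triangulatedHull (P : ObjectProperty C) : ObjectProperty C := fun X =>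
  ∀ Q : ObjectProperty C, Q.IsTriangulated → Q.IsClosedUnderIsomorphisms → P ≤ Q → Q X

theorem le_triangulatedHull (P : ObjectProperty C) : P ≤ triangulatedHull P :=
  fun X hX _ _ _ h => h X hX

instance triangulatedHull_closedUnderIso (P : ObjectProperty C) :
    (triangulatedHull P).IsClosedUnderIsomorphisms where
  of_iso e hX Q hQ hQ' h := Q.prop_of_iso e (hX Q hQ hQ' h)

instance triangulatedHull_isTriangulated (P : ObjectProperty C) :
    (triangulatedHull P).IsTriangulated where
  exists_zero := ⟨0, isZero_zero C, fun Q _ _ _ => Q.prop_zero⟩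
  isStableUnderShiftBy a := ⟨fun X hX Q hQ hQ' h => Q.le_shift a X (hX Q hQ hQ' h)⟩
  toIsTriangulatedClosed₂ := .mk' fun T hT h₁ h₃ Q hQ hQ' h =>
    Q.ext_of_isTriangulatedClosed₂ T hT (h₁ Q hQ hQ' h) (h₃ Q hQ hQ' h)

/-- The full subcategory generated by `P` under extensions (it contains the zero objects,
and hence is closed under isomorphisms). -/
inductive extensionHull (P : ObjectProperty C) : C → Prop
  | of_mem (X : C) : P X → extensionHull P X
  | of_isZero (X : C) : IsZero X → extensionHull P X
  | ext (T : Triangle C) : T ∈ distTriang C → extensionHull P T.obj₁ → extensionHull P T.obj₃ →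
      extensionHull P T.obj₂

end Generation

/-! ### Tate twists, graded exceptional sequences, dual sequences -/

section Exceptional

variable (E : Type u) [CommRing E]
variable (C : Type w) [Category.{v} C] [Preadditive C] [Linear E C] [HasZeroObject C]
  [HasShift C ℤ] [∀ n : ℤ, (shiftFunctor C n).Additive] [Pretriangulated C]

/-- A Tate twist: an autoequivalence of `E`-linear triangulated categories. -/
structure TateTwist where
  /-- the functor `⟨1⟩` and its quasi-inverse `⟨-1⟩` -/
  equiv : C ≌ C
  commShift : equiv.functor.CommShift ℤ
  isTriangulated : equiv.functor.IsTriangulated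
  linear : equiv.functor.Linear E

variable {C}

/-- The functor `⟨k⟩`. -/
def TateTwist.twist {E : Type u} [CommRing E] [Linear E C] (τ : TateTwist E C) (k : ℤ) : C ⥤ C :=
  (τ.equiv ^ k).functor

variable {E}

/-- `⨁_k Hom(X, Y⟨k⟩)` is a finitely generated `E`-module for all `X`, `Y`. -/
def IsGradedHomFinite (τ : TateTwist E C) : Prop :=
  ∀ X Y : C, Module.Finite E (DirectSum ℤ fun k => X ⟶ (τ.twist k).obj Y)

variable {I : Type x} [LinearOrder I] (τ : TateTwist E C) (nab del : I → C)

/-- The objects `∇_j⟨k⟩`, for `j` in a subset `J` of `I` and `k ∈ ℤ`. -/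
def twists (J : Set I) : ObjectProperty C := fun X =>
  ∃ j ∈ J, ∃ k : ℤ, X = (τ.twist k).obj (nab j)

/-- `(∇_i)_{i ∈ I}` is an `E`-linear graded exceptional sequence. -/
structure IsGradedExceptional : Prop where
  /-- the ordered set `I` is isomorphic to a subset of `ℕ` -/
  order : Nonempty (I ↪o ℕ)
  hom_lt : ∀ i j : I, i < j → ∀ (n k : ℤ) (f : nab i ⟶ (τ.twist k).obj ((nab j)⟦n⟧)), f = 0
  hom_self : ∀ (i : I) (n k : ℤ), ¬ (n = 0 ∧ k = 0) →
    ∀ f : nab i ⟶ (τ.twist k).obj ((nab i)⟦n⟧), f = 0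
  end_self : ∀ i : I, Nonempty ((nab i ⟶ nab i) ≃ₗ[E] E)
  generates : ∀ X : C, triangulatedHull (twists τ nab Set.univ) X

/-- The triangulated subcategory `T_{< i}`. -/
def Tlt (i : I) : ObjectProperty C := triangulatedHull (twists τ nab (Set.Iio i))

/-- The triangulated subcategory `T_{≤ i}`. -/
def Tle (i : I) : ObjectProperty C := triangulatedHull (twists τ nab (Set.Iic i))

instance Tle_isTriangulated (i : I) : (Tle τ nab i).IsTriangulated :=
  triangulatedHull_isTriangulated _

theorem nab_mem_Tle (i : I) : Tle τ nab i (nab i) :=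
  le_triangulatedHull _ _ ⟨i, le_refl i, 0, rfl⟩

/-- The morphisms of `T_{≤ i}` whose cone lies in `T_{< i}`. -/
def verdierW (i : I) : MorphismProperty (Tle τ nab i).FullSubcategory :=
  ((Tlt τ nab i).inverseImage (Tle τ nab i).ι).trW

/-- The Verdier quotient functor `Π_i : T_{≤ i} ⥤ T_{≤ i} / T_{< i}`. -/
def Pi (i : I) : (Tle τ nab i).FullSubcategory ⥤ (verdierW τ nab i).Localization :=
  (verdierW τ nab i).Q

/-- `(Δ_i)_{i ∈ I}` is a dual sequence to `(∇_i)_{i ∈ I}`. -/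
structure IsDualSequence : Prop where
  hom_lt : ∀ i j : I, i < j → ∀ (n k : ℤ) (f : del j ⟶ (τ.twist k).obj ((nab i)⟦n⟧)), f = 0
  quotient : ∀ i : I, ∃ h : Tle τ nab i (del i),
    Nonempty ((Pi τ nab i).obj ⟨del i, h⟩ ≅ (Pi τ nab i).obj ⟨nab i, nab_mem_Tle τ nab i⟩)

/-- `c : Δ_i ⟶ ∇_i` is a canonical map, i.e. it corresponds under adjunction to an isomorphism
`Π_i(Δ_i) ≅ Π_i(∇_i)`: its image under `Π_i` is an isomorphism. -/
def IsCanonicalMap {i : I} (c : del i ⟶ nab i) : Prop :=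
  ∃ h : Tle τ nab i (del i), IsIso ((Pi τ nab i).map
    (ObjectProperty.homMk c : (⟨del i, h⟩ : (Tle τ nab i).FullSubcategory) ⟶
      ⟨nab i, nab_mem_Tle τ nab i⟩))

/-! ### The t-structure attached to an exceptional sequence, and the objects `L_i`, `L_i⁺` -/

/-- The objects `Δ_j[n]⟨k⟩` with `n ≥ 0`. -/
def genLE : ObjectProperty C := fun X =>
  ∃ (j : I) (n k : ℤ), 0 ≤ n ∧ X = (τ.twist k).obj ((del j)⟦n⟧)

/-- The objects `∇_j[n]⟨k⟩` and `∇̄_j[n]⟨k⟩` with `n ≤ 0`, where `∇̄_j` is any cone of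
multiplication by a uniformizer on `∇_j`. If `E` is a field, there is no irreducible element and
the objects `∇̄_j` are omitted (they are zero by convention). -/
def genGE : ObjectProperty C := fun X =>
  (∃ (j : I) (n k : ℤ), n ≤ 0 ∧ X = (τ.twist k).obj ((nab j)⟦n⟧)) ∨
  (∃ (j : I) (ϖ : E) (Z : C) (g : nab j ⟶ Z) (h : Z ⟶ (nab j)⟦(1 : ℤ)⟧), Irreducible ϖ ∧
    Triangle.mk (ϖ • 𝟙 (nab j)) g h ∈ distTriang C ∧
    ∃ (n k : ℤ), n ≤ 0 ∧ X = (τ.twist k).obj (Z⟦n⟧))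

/-- `t` is the t-structure attached to `(∇_i)` and `(Δ_i)`: `T^{≤ 0}` and `T^{≥ 0}` are generated
under extensions by the objects above. (These two subcategories determine `t`.) -/
structure IsExcTStructure (t : TStructure C) : Prop where
  le_zero : t.le 0 = extensionHull (genLE τ del)
  ge_zero : t.ge 0 = extensionHull (genGE τ nab)

variable {nab del} [IsTriangulated C]

/-- `L_i = im(H⁰(Δ_i) ⟶ H⁰(∇_i))`, as a subobject of `H⁰(∇_i)` in the heart. -/
def Lsub (t : TStructure C) {i : I} (c : del i ⟶ nab i) : Subobject ((H0 t).obj (nab i)) :=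
  imageSubobject ((H0 t).map c)

/-- `L_i`, as an object of the heart. -/
def Lobj (t : TStructure C) {i : I} (c : del i ⟶ nab i) : HeartCat t := (Lsub t c : HeartCat t)

variable (E)

/-- `M` is the largest subobject `L_i⁺` of `H⁰(∇_i)` that contains `L_i` and is such that
`L_i⁺ / L_i` is torsion. -/
def IsLplus (t : TStructure C) {i : I} (c : del i ⟶ nab i)
    (M : Subobject ((H0 t).obj (nab i))) : Prop :=
  IsGreatest {M | ∃ h : Lsub t c ≤ M, IsTorsionObj E (cokernel (Subobject.ofLE _ M h))} M

end Exceptional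

/-! ### Change of scalars -/

section Scalars

variable (O : Type u) [CommRing O]
variable {C : Type w} [Category.{v} C] [Preadditive C] [Linear O C]
variable (k : Type u') [CommRing k] [Algebra O k]
variable {D : Type w'} [Category.{v'} D] [Preadditive D] [Linear k D]

/-- The functor `F` is linear along `O → k`. -/
def IsSemilinear (F : C ⥤ D) : Prop :=
  ∀ (X Y : C) (a : O) (f : X ⟶ Y), F.map (a • f) = algebraMap O k a • F.map f

/-- The map `k ⊗_O Hom(X, Y) → Hom(F(X), F(Y))`, `x ⊗ f ↦ x • F(f)`, induced by `F`. -/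
def baseChangeHom (F : C ⥤ D) [F.Additive] (hF : IsSemilinear O k F) (X Y : C) :
    k ⊗[O] (X ⟶ Y) →+ (F.obj X ⟶ F.obj Y) :=
  TensorProduct.liftAddHom
    (AddMonoidHom.mk' (fun x => AddMonoidHom.mk' (fun f => x • F.map f)
      (by intro f g; simp)) (by intro x y; ext f; simp [add_smul]))
    (by
      intro a x f
      change (a • x) • F.map f = x • F.map (a • f)
      rw [hF X Y a f, smul_smul, Algebra.smul_def, mul_comm])

/-- `F` induces isomorphisms `k ⊗_O Hom(X, Y) ≅ Hom(F(X), F(Y))`. -/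
structure IsGenericFunctor (F : C ⥤ D) [F.Additive] : Prop where
  semilinear : IsSemilinear O k F
  bijective : ∀ X Y : C, Function.Bijective (baseChangeHom O k F semilinear X Y)

end Scalars

section Residue

variable (O : Type u) [CommRing O]
variable {C : Type w} [Category.{u} C] [Preadditive C] [Linear O C] [HasShift C ℤ]
variable (k : Type u) [CommRing k] [Algebra O k]
variable {D : Type w'} [Category.{v'} D] [Preadditive D] [Linear k D]

/-- `Tor_1^O(k, -)`. -/
abbrev Tor1 : ModuleCat.{u} O ⥤ ModuleCat.{u} O := (Tor (ModuleCat.{u} O) 1).obj (ModuleCat.of O k)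

/-- A natural short exact sequence
`k ⊗_O Hom(X, Y) ↪ Hom(F(X), F(Y)) ↠ Tor_1^O(k, Hom(X, Y[1]))`
whose first map is induced by `F`. -/
structure ResidueFunctorData (F : C ⥤ D) [F.Additive] where
  semilinear : IsSemilinear O k F
  δ (X Y : C) : (F.obj X ⟶ F.obj Y) →+ (Tor1 O k).obj (ModuleCat.of O (X ⟶ Y⟦(1 : ℤ)⟧))
  δ_smul (X Y : C) (a : O) (φ : F.obj X ⟶ F.obj Y) :
    δ X Y (algebraMap O k a • φ) = a • δ X Y φ
  injective (X Y : C) : Function.Injective (baseChangeHom O k F semilinear X Y)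
  exact (X Y : C) : Function.Exact (baseChangeHom O k F semilinear X Y) (δ X Y)
  surjective (X Y : C) : Function.Surjective (δ X Y)
  naturality_left {X' X : C} (Y : C) (f : X' ⟶ X) (φ : F.obj X ⟶ F.obj Y) :
    δ X' Y (F.map f ≫ φ) =
      (Tor1 O k).map (ModuleCat.ofHom (Linear.leftComp O (Y⟦(1 : ℤ)⟧) f)) (δ X Y φ)
  naturality_right (X : C) {Y Y' : C} (g : Y ⟶ Y') (φ : F.obj X ⟶ F.obj Y) :
    δ X Y' (φ ≫ F.map g) =
      (Tor1 O k).map (ModuleCat.ofHom (Linear.rightComp O X (g⟦(1 : ℤ)⟧'))) (δ X Y φ)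

end Residue

end ExcSeq

end

/-!
Let `c : Δ_i ⟶ ∇_i` be a canonical map over a field. Every nonzero subobject of `H⁰(∇_i)` contains
`L_i = im H⁰(c)`, and every proper subobject of `H⁰(Δ_i)` is killed by `H⁰(c)`. Hence if `c`
factors through an object `Z` of the heart, then `Z` has simple head `L_i` when `Δ_i ⟶ Z` induces an
epimorphism on `H⁰`, it has simple socle `L_i` when `Z ⟶ ∇_i` induces a monomorphism, and `Z ≅ L_i`
when both hold.

A triangulated functor `G` from `O`-coefficients to a field that carries `∇` and `Δ` to an
exceptional sequence and its dual sequence is right t-exact and preserves canonical maps. For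
`L_i ≤ M ≤ H⁰(∇_i)`, it therefore turns `Δ_i ⟶ H⁰(Δ_i) ⟶ M ⟶ H⁰(∇_i) ⟶ ∇_i` into such a
factorization through `G(M)`. Its first half is epic for `M = L_i`, and its second half is monic as
soon as `G(H⁰(∇_i) / M)` lies in degrees `≥ 0`.

If `O` embeds in the field, `G` kills the cones `∇̄_j` and so is t-exact. For the residue field, the
`Tor` sequence shows that `G(X)` lies in degrees `≥ 0` if `X` does and if `Hom(S, X)` is
torsion-free for all `S` in degrees `≤ 0`. This applies to the subobjects of `H⁰(∇_i)` because
`∇̄_i` lies in degrees `≥ 0`, and to `H⁰(∇_i) / L_i⁺` because `L_i⁺` is maximal.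
-/

namespace ExcSeq

open ObjectProperty

/-! ### Generation and extension products -/

section ExtensionHull

variable {C : Type w} [Category.{v} C] [Preadditive C] [HasZeroObject C] [HasShift C ℤ]
  [∀ n : ℤ, (shiftFunctor C n).Additive] [Pretriangulated C]

theorem eq_zero_of_comp_mor₁_eq_zero {W X Y Z : C} {f : X ⟶ Y} {g : Y ⟶ Z} {h : Z ⟶ X⟦(1 : ℤ)⟧}
    (hT : Triangle.mk f g h ∈ distTriang C) (hW : ∀ b : W ⟶ Z⟦(-1 : ℤ)⟧, b = 0) (a : W ⟶ X)
    (ha : a ≫ f = 0) : a = 0 := by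
  obtain ⟨b, rfl⟩ := Triangle.coyoneda_exact₂ _ (inv_rot_of_distTriang _ hT) a ha
  exact (congrArg (· ≫ _) (hW b)).trans zero_comp

theorem eq_zero_of_mor₂_comp_eq_zero {W X Y Z : C} {f : X ⟶ Y} {g : Y ⟶ Z} {h : Z ⟶ X⟦(1 : ℤ)⟧}
    (hT : Triangle.mk f g h ∈ distTriang C) (hW : ∀ b : X⟦(1 : ℤ)⟧ ⟶ W, b = 0) (a : Z ⟶ W)
    (ha : g ≫ a = 0) : a = 0 := by
  obtain ⟨b, rfl⟩ : ∃ b, a = h ≫ b := Triangle.yoneda_exact₃ _ hT a ha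
  rw [hW b, comp_zero]

omit [HasZeroObject C] [Pretriangulated C] in
theorem hom_shift_eq_zero {X Y : C} (a b : ℤ) (h : ∀ f : X ⟶ Y⟦b - a⟧, f = 0)
    (f : X⟦a⟧ ⟶ Y⟦b⟧) : f = 0 := by
  let e := (shiftFunctorAdd' C (b - a) a b (by lia)).app Y
  obtain ⟨g, hg⟩ := (shiftFunctor C a).map_surjective (f ≫ e.hom)
  rw [h g, Functor.map_zero] at hg
  rw [← cancel_mono e.hom, ← hg, zero_comp]

theorem extensionHull_of_iso {P : ObjectProperty C} {X Y : C} (e : X ≅ Y)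
    (hX : extensionHull P X) : extensionHull P Y := by
  obtain ⟨Z, g, h, hT⟩ := distinguished_cocone_triangle e.hom
  have hZ : IsZero Z := (Triangle.isZero₃_iff_isIso₁ _ hT).2 (inferInstanceAs (IsIso e.hom))
  exact .ext _ hT hX (.of_isZero _ hZ)

instance extensionHull_closedUnderIso (P : ObjectProperty C) :
    IsClosedUnderIsomorphisms (extensionHull P) where
  of_iso e hX := extensionHull_of_iso e hX

instance extensionHull_containsZero (P : ObjectProperty C) :
    ContainsZero (extensionHull P) where
  exists_zero := ⟨0, isZero_zero C, .of_isZero _ (isZero_zero C)⟩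

instance extensionHull_closed₂ (P : ObjectProperty C) :
    IsTriangulatedClosed₂ (extensionHull P) :=
  .mk' fun T hT h₁ h₃ => .ext T hT h₁ h₃

theorem le_extensionHull (P : ObjectProperty C) : P ≤ extensionHull P := fun X hX => .of_mem X hX

theorem extensionHull_le {P Q : ObjectProperty C} [Q.IsClosedUnderIsomorphisms] [Q.ContainsZero]
    [Q.IsTriangulatedClosed₂] (h : P ≤ Q) : extensionHull P ≤ Q := by
  intro X hX
  induction hX with
  | of_mem X hX => exact h X hX
  | of_isZero X hX => exact Q.prop_of_isZero hX
  | ext T hT _ _ h₁ h₃ => exact Q.ext_of_isTriangulatedClosed₂ T hT h₁ h₃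

theorem extensionHull_mono {P Q : ObjectProperty C} (h : P ≤ Q) :
    extensionHull P ≤ extensionHull Q :=
  extensionHull_le (h.trans (le_extensionHull Q))

theorem extensionHull_map {D : Type w'} [Category.{v'} D] [Preadditive D] [HasZeroObject D]
    [HasShift D ℤ] [∀ n : ℤ, (shiftFunctor D n).Additive] [Pretriangulated D]
    (F : C ⥤ D) [F.CommShift ℤ] [F.IsTriangulated] {P : ObjectProperty C} {Q : ObjectProperty D}
    (h : ∀ X, P X → extensionHull Q (F.obj X)) {X : C} (hX : extensionHull P X) :
    extensionHull Q (F.obj X) := by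
  induction hX with
  | of_mem X hX => exact h X hX
  | of_isZero X hX => exact .of_isZero _ (Functor.map_isZero _ hX)
  | ext T hT _ _ h₁ h₃ => exact .ext _ (F.map_distinguished T hT) h₁ h₃

theorem extensionHull_shift {P Q : ObjectProperty C} (a : ℤ)
    (h : ∀ X, P X → extensionHull Q (X⟦a⟧)) {X : C} (hX : extensionHull P X) :
    extensionHull Q (X⟦a⟧) := by
  induction hX with
  | of_mem X hX => exact h X hX
  | of_isZero X hX => exact .of_isZero _ (Functor.map_isZero _ hX)
  | ext T hT _ _ h₁ h₃ => exact .ext _ (Triangle.shift_distinguished T hT a) h₁ h₃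

theorem extensionHull_hom_eq_zero {P Q : ObjectProperty C}
    (h : ∀ X Y, P X → Q Y → ∀ f : X ⟶ Y, f = 0) {X Y : C} (hX : extensionHull P X)
    (hY : extensionHull Q Y) (f : X ⟶ Y) : f = 0 := by
  have hleft : extensionHull P ≤ Q.leftOrthogonal :=
    extensionHull_le fun X hX Y f hY => h X Y hX hY f
  have hright : extensionHull Q ≤ rightOrthogonal (extensionHull P) :=
    extensionHull_le fun Y hY X f hX => hleft X hX f hY
  exact hright Y hY f hX

theorem triangulatedHull_le {P Q : ObjectProperty C} [Q.IsTriangulated]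
    [Q.IsClosedUnderIsomorphisms] (h : P ≤ Q) : triangulatedHull P ≤ Q :=
  fun _ hX => hX Q inferInstance inferInstance h

theorem triangulatedHull_mono {P Q : ObjectProperty C} (h : P ≤ Q) :
    triangulatedHull P ≤ triangulatedHull Q :=
  triangulatedHull_le (h.trans (le_triangulatedHull Q))

theorem triangulatedHull_hom_eq_zero {P Q : ObjectProperty C}
    (h : ∀ X Y, P X → Q Y → ∀ (n : ℤ) (f : X ⟶ Y⟦n⟧), f = 0) {X Y : C}
    (hX : triangulatedHull P X) (hY : triangulatedHull Q Y) (f : X ⟶ Y) : f = 0 := by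
  have hleft : triangulatedHull P ≤ (Q.shiftClosure ℤ).leftOrthogonal :=
    triangulatedHull_le fun X hX Y f ⟨Z, n, e, hZ⟩ => by
      rw [← cancel_mono e.hom, h X Z hX hZ n (f ≫ e.hom), zero_comp]
  have hright : triangulatedHull Q ≤ (triangulatedHull P).rightOrthogonal :=
    triangulatedHull_le fun Y hY X f hX => hleft X hX f (le_shiftClosure Q Y hY)
  exact hright Y hY f hX

theorem extensionProduct_mono {P P' Q Q' : ObjectProperty C} (h : P ≤ P') (h' : Q ≤ Q') :
    extensionProduct P Q ≤ extensionProduct P' Q' :=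
  (monotone_extensionProduct_left Q h).trans (monotone_extensionProduct_right P' h')

theorem extensionProduct_of_mor₃_eq_zero {U V : ObjectProperty C} {T : Triangle C}
    (hT : T ∈ distTriang C) (h : T.mor₃ = 0) (h₁ : V T.obj₁) (h₃ : U T.obj₃) :
    extensionProduct U V T.obj₂ := by
  obtain ⟨e, -, -⟩ := exists_iso_binaryBiproduct_of_distTriang T hT h
  exact ObjectProperty.prop_of_iso _ (e ≪≫ biprod.braiding _ _).symm
    ⟨_, _, _, _, _, binaryBiproductTriangle_distinguished T.obj₃ T.obj₁, h₃, h₁⟩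

theorem extensionProduct_swap {U V : ObjectProperty C}
    (h : ∀ X Y, U X → V Y → ∀ f : X ⟶ Y⟦(1 : ℤ)⟧, f = 0) :
    extensionProduct V U ≤ extensionProduct U V := by
  rintro X ⟨Y, Z, f, g, k, hT, hY, hZ⟩
  exact extensionProduct_of_mor₃_eq_zero hT (h _ _ hZ hY k) hY hZ

theorem extensionProduct_self_le (U : ObjectProperty C) [U.IsTriangulatedClosed₂]
    [U.IsClosedUnderIsomorphisms] : extensionProduct U U ≤ U :=
  extensionProduct_le_of_isTriangulatedClosed₂ le_rfl le_rfl

theorem extensionProduct_le_iff_forall_singleton_left {P Q R : ObjectProperty C} :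
    extensionProduct P Q ≤ R ↔ ∀ X, P X → extensionProduct (singleton X) Q ≤ R := by
  refine ⟨fun h X hX => (monotone_extensionProduct_left Q ((singleton_le_iff).2 hX)).trans h, ?_⟩
  rintro h X ⟨Y, Z, f, g, k, hT, hY, hZ⟩
  exact h Y hY X ⟨Y, Z, f, g, k, hT, ⟨⟨⟩⟩, hZ⟩

theorem extensionProduct_le_iff_forall_singleton_right {P Q R : ObjectProperty C} :
    extensionProduct P Q ≤ R ↔ ∀ X, Q X → extensionProduct P (singleton X) ≤ R := by
  refine ⟨fun h X hX => (monotone_extensionProduct_right P ((singleton_le_iff).2 hX)).trans h, ?_⟩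
  rintro h X ⟨Y, Z, f, g, k, hT, hY, hZ⟩
  exact h Z hZ X ⟨Y, Z, f, g, k, hT, hY, ⟨⟨⟩⟩⟩

theorem singleton_obj₂_le_extensionProduct {T : Triangle C} (hT : T ∈ distTriang C) :
    singleton T.obj₂ ≤ extensionProduct (singleton T.obj₁) (singleton T.obj₃) :=
  singleton_le_iff.2 ⟨_, _, _, _, _, hT, ⟨⟨⟩⟩, ⟨⟨⟩⟩⟩

variable [IsTriangulated C]

theorem extensionProduct_closed₂ {U V : ObjectProperty C} [U.IsTriangulatedClosed₂]
    [U.IsClosedUnderIsomorphisms] [V.IsTriangulatedClosed₂] [V.IsClosedUnderIsomorphisms]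
    (h : extensionProduct V U ≤ extensionProduct U V) :
    (extensionProduct U V).IsTriangulatedClosed₂ := by
  refine .mk' fun T hT h₁ h₃ => ?_
  have h₂ : extensionProduct (extensionProduct U V) (extensionProduct U V) T.obj₂ :=
    ⟨_, _, _, _, _, hT, h₁, h₃⟩
  rw [extensionProduct_assoc, ← extensionProduct_assoc V] at h₂
  have h₄ := extensionProduct_mono (le_refl U) (extensionProduct_mono h (le_refl V)) _ h₂
  rw [extensionProduct_assoc, ← extensionProduct_assoc U] at h₄
  exact extensionProduct_mono (extensionProduct_self_le U) (extensionProduct_self_le V) _ h₄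

theorem extensionProduct_isTriangulated {U V : ObjectProperty C} [U.IsTriangulated]
    [U.IsClosedUnderIsomorphisms] [V.IsTriangulated] [V.IsClosedUnderIsomorphisms]
    (h : extensionProduct V U ≤ extensionProduct U V) :
    (extensionProduct U V).IsTriangulated where
  exists_zero := ⟨0, isZero_zero C, le_extensionProduct_left V _ U.prop_zero⟩
  toIsTriangulatedClosed₂ := extensionProduct_closed₂ h

theorem extensionProduct_extensionHull_left_le {A B V : ObjectProperty C}
    [A.IsClosedUnderIsomorphisms] [V.IsTriangulatedClosed₂] [V.IsClosedUnderIsomorphisms]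
    [V.ContainsZero]
    (h : extensionProduct B A ≤ extensionProduct A V) :
    extensionProduct (extensionHull B) A ≤ extensionProduct A V := by
  refine extensionProduct_le_iff_forall_singleton_left.2 fun X hX => ?_
  induction hX with
  | of_mem X hX => exact extensionProduct_le_iff_forall_singleton_left.1 h X hX
  | of_isZero X hX =>
    rintro Y ⟨X', Z, f, g, k, hT, ⟨⟨⟩⟩, hZ⟩
    have : IsIso g := (Triangle.isZero₁_iff_isIso₂ _ hT).1 hX
    exact le_extensionProduct_left _ _ (A.prop_of_iso (asIso g).symm hZ)
  | ext T hT _ _ h₁ h₃ =>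
    calc extensionProduct (singleton T.obj₂) A
      _ ≤ extensionProduct (extensionProduct (singleton T.obj₁) (singleton T.obj₃)) A :=
        monotone_extensionProduct_left A (singleton_obj₂_le_extensionProduct hT)
      _ ≤ extensionProduct (singleton T.obj₁) (extensionProduct A V) :=
        (extensionProduct_assoc _ _ _).le.trans (monotone_extensionProduct_right _ h₃)
      _ ≤ extensionProduct (extensionProduct A V) V :=
        (extensionProduct_assoc _ _ _).ge.trans (monotone_extensionProduct_left _ h₁)
      _ ≤ extensionProduct A V := (extensionProduct_assoc _ _ _).le.trans
        (monotone_extensionProduct_right _ (extensionProduct_self_le V))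

theorem extensionProduct_extensionHull_right_le {A U V : ObjectProperty C}
    [V.IsClosedUnderIsomorphisms] [U.IsTriangulatedClosed₂]
    [U.IsClosedUnderIsomorphisms] [U.ContainsZero]
    (h : extensionProduct V A ≤ extensionProduct U V) :
    extensionProduct V (extensionHull A) ≤ extensionProduct U V := by
  refine extensionProduct_le_iff_forall_singleton_right.2 fun X hX => ?_
  induction hX with
  | of_mem X hX => exact extensionProduct_le_iff_forall_singleton_right.1 h X hX
  | of_isZero X hX =>
    rintro Y ⟨Z, X', f, g, k, hT, hZ, ⟨⟨⟩⟩⟩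
    have : IsIso f := (Triangle.isZero₃_iff_isIso₁ _ hT).1 hX
    exact le_extensionProduct_right _ _ (V.prop_of_iso (asIso f) hZ)
  | ext T hT _ _ h₁ h₃ =>
    calc extensionProduct V (singleton T.obj₂)
      _ ≤ extensionProduct V (extensionProduct (singleton T.obj₁) (singleton T.obj₃)) :=
        monotone_extensionProduct_right V (singleton_obj₂_le_extensionProduct hT)
      _ ≤ extensionProduct (extensionProduct U V) (singleton T.obj₃) :=
        (extensionProduct_assoc _ _ _).ge.trans (monotone_extensionProduct_left _ h₁)
      _ ≤ extensionProduct U (extensionProduct U V) :=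
        (extensionProduct_assoc _ _ _).le.trans (monotone_extensionProduct_right _ h₃)
      _ ≤ extensionProduct U V := (extensionProduct_assoc _ _ _).ge.trans
        (monotone_extensionProduct_left _ (extensionProduct_self_le U))

theorem extensionProduct_extensionHull_swap {A B : ObjectProperty C} [A.IsClosedUnderIsomorphisms]
    (h : extensionProduct B A ≤ extensionProduct A (extensionHull B)) :
    extensionProduct (extensionHull B) (extensionHull A) ≤
      extensionProduct (extensionHull A) (extensionHull B) :=
  extensionProduct_extensionHull_right_le <|
    (extensionProduct_extensionHull_left_le h).trans
      (monotone_extensionProduct_left _ (le_extensionHull A))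

theorem extensionProduct_extensionHull_swap_of_connecting {A B : ObjectProperty C}
    [A.IsClosedUnderIsomorphisms]
    (h : ∀ {X Y Z : C} {i : X ⟶ Y} {q : Y ⟶ Z} {f : Z ⟶ X⟦(1 : ℤ)⟧},
      Triangle.mk i q f ∈ distTriang C → B X → A Z → f ≠ 0 → A Y ∨ extensionHull B Y) :
    extensionProduct (extensionHull B) (extensionHull A) ≤
      extensionProduct (extensionHull A) (extensionHull B) := by
  let A₀ : ObjectProperty C := fun X => A X ∨ IsZero X
  have : A₀.IsClosedUnderIsomorphisms :=
    ⟨fun e hX => hX.imp (A.prop_of_iso e) (fun h => h.of_iso e.symm)⟩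
  have : A₀.ContainsZero := ⟨0, isZero_zero C, Or.inr (isZero_zero C)⟩
  have hA : extensionHull A₀ = extensionHull A :=
    le_antisymm (extensionHull_le fun X hX => hX.elim (.of_mem X) (.of_isZero X))
      (extensionHull_mono fun _ => Or.inl)
  rw [← hA]
  refine extensionProduct_extensionHull_swap ?_
  rintro Y ⟨X, Z, i, q, f, hT, hX, hZ⟩
  by_cases hf : f = 0
  · exact extensionProduct_mono le_rfl (le_extensionHull B) _
      (extensionProduct_of_mor₃_eq_zero hT hf hX hZ)
  · exact (h hT hX (hZ.resolve_right fun h₀ => hf (h₀.eq_of_src _ _)) hf).elim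
      (fun hY => le_extensionProduct_left _ _ (Or.inl hY))
      (fun hY => le_extensionProduct_right _ _ hY)

end ExtensionHull

/-! ### Exceptional families -/

section Families

variable {C : Type w} [Category.{v} C] [Preadditive C] [HasZeroObject C] [HasShift C ℤ]
  [∀ n : ℤ, (shiftFunctor C n).Additive] [Pretriangulated C]
variable {Λ : Type x} (lev : Λ → ℕ) (N D : Λ → C)

/-- The triangulated subcategory generated by the objects `N l` of level `< m`. -/
def levelLT (m : ℕ) : ObjectProperty C := triangulatedHull fun X => ∃ l, lev l < m ∧ X = N l

/-- The triangulated subcategory generated by the objects `N l` of level `m`. -/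
def levelEq (m : ℕ) : ObjectProperty C := triangulatedHull fun X => ∃ l, lev l = m ∧ X = N l

instance levelLT_isTriangulated (m : ℕ) : (levelLT lev N m).IsTriangulated :=
  triangulatedHull_isTriangulated _

instance levelLT_closedUnderIso (m : ℕ) : (levelLT lev N m).IsClosedUnderIsomorphisms :=
  triangulatedHull_closedUnderIso _

instance levelEq_isTriangulated (m : ℕ) : (levelEq lev N m).IsTriangulated :=
  triangulatedHull_isTriangulated _

instance levelEq_closedUnderIso (m : ℕ) : (levelEq lev N m).IsClosedUnderIsomorphisms :=
  triangulatedHull_closedUnderIso _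

theorem levelLT_mono {m n : ℕ} (h : m ≤ n) : levelLT lev N m ≤ levelLT lev N n :=
  triangulatedHull_mono fun _ ⟨l, hl, e⟩ => ⟨l, hl.trans_le h, e⟩

theorem mem_levelLT {l : Λ} {m : ℕ} (h : lev l < m) : levelLT lev N m (N l) :=
  le_triangulatedHull _ _ ⟨l, h, rfl⟩

theorem mem_levelEq (l : Λ) : levelEq lev N (lev l) (N l) :=
  le_triangulatedHull _ _ ⟨l, rfl, rfl⟩

theorem isZero_of_levelLT_zero {X : C} (h : levelLT lev N 0 X) : IsZero X := by
  have : levelLT lev N 0 ≤ (⊤ : ObjectProperty C).leftOrthogonal :=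
    triangulatedHull_le (by rintro X ⟨l, hl, -⟩; exact absurd hl (Nat.not_lt_zero _))
  rw [IsZero.iff_id_eq_zero]
  exact this X h (𝟙 X) trivial

/-- A graded exceptional sequence with the twists absorbed into the index set `Λ` (in the
application `Λ = I × ℤ`). Only the level of an index is ordered, so that distinct twists of the
same object have the same level and must be orthogonal. -/
structure IsExceptionalFamily (E : Type u) [CommRing E] [Linear E C] : Prop where
  hom_ne : ∀ l m : Λ, lev l ≤ lev m → l ≠ m → ∀ (n : ℤ) (f : N l ⟶ (N m)⟦n⟧), f = 0
  hom_self : ∀ (l : Λ) (n : ℤ), n ≠ 0 → ∀ f : N l ⟶ (N l)⟦n⟧, f = 0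
  bijective_smul_id : ∀ l : Λ, Function.Bijective fun a : E => a • 𝟙 (N l)
  generates : ∀ X : C, triangulatedHull (fun X => ∃ l, X = N l) X

/-- A dual sequence, with the twists absorbed into the index set. The isomorphism in the Verdier
quotient is replaced by a morphism `D l ⟶ N l` whose cone has level `< lev l`. -/
structure IsDualFamily : Prop where
  hom_lt : ∀ l m : Λ, lev m < lev l → ∀ (n : ℤ) (f : D l ⟶ (N m)⟦n⟧), f = 0
  exists_canonical : ∀ l : Λ, ∃ c : D l ⟶ N l, (levelLT lev N (lev l)).trW c

variable {lev N D}

namespace IsDualFamily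

variable (hD : IsDualFamily lev N D)
include hD

theorem hom_eq_zero_of_levelEq_of_levelLT {m : ℕ} {X Y : C} (hX : levelEq lev D m X)
    (hY : levelLT lev N m Y) (f : X ⟶ Y) : f = 0 := by
  refine triangulatedHull_hom_eq_zero ?_ hX hY f
  rintro _ _ ⟨l, rfl, rfl⟩ ⟨p, hp, rfl⟩ n f
  exact hD.hom_lt l p hp n f

theorem del_mem (l : Λ) : levelLT lev N (lev l + 1) (D l) := by
  obtain ⟨c, Z, g, h, hT, hZ⟩ := hD.exists_canonical l
  exact (levelLT lev N (lev l + 1)).ext_of_isTriangulatedClosed₁ _ hT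
    (mem_levelLT lev N (Nat.lt_succ_self _)) (levelLT_mono lev N (Nat.le_succ _) _ hZ)

end IsDualFamily

namespace IsExceptionalFamily

variable {E : Type u} [CommRing E] [Linear E C] (hN : IsExceptionalFamily lev N E)
include hN

theorem levelLT_hom_levelEq {m : ℕ} {X Y : C} (hX : levelLT lev N m X) (hY : levelEq lev N m Y)
    (f : X ⟶ Y) : f = 0 := by
  refine triangulatedHull_hom_eq_zero ?_ hX hY f
  rintro _ _ ⟨l, hl, rfl⟩ ⟨p, hp, rfl⟩ n f
  exact hN.hom_ne l p (by lia) (by rintro rfl; lia) n f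

theorem exists_levelLT (X : C) : ∃ m, levelLT lev N m X := by
  let Q : ObjectProperty C := fun X => ∃ m, levelLT lev N m X
  have : Q.IsClosedUnderIsomorphisms :=
    ⟨fun e ⟨m, hm⟩ => ⟨m, (levelLT lev N m).prop_of_iso e hm⟩⟩
  have : Q.IsTriangulated :=
    { exists_zero := ⟨0, isZero_zero C, 0, (levelLT lev N 0).prop_zero⟩
      isStableUnderShiftBy := fun a =>
        ⟨fun X ⟨m, hm⟩ => ⟨m, (levelLT lev N m).le_shift a X hm⟩⟩
      toIsTriangulatedClosed₂ := .mk' fun T hT ⟨m, hm⟩ ⟨n, hn⟩ => ⟨max m n,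
        (levelLT lev N (max m n)).ext_of_isTriangulatedClosed₂ T hT
          (levelLT_mono lev N (le_max_left m n) _ hm)
          (levelLT_mono lev N (le_max_right m n) _ hn)⟩ }
  refine hN.generates X Q inferInstance inferInstance ?_
  rintro _ ⟨l, rfl⟩
  exact ⟨lev l + 1, mem_levelLT lev N (Nat.lt_succ_self _)⟩

theorem bijective_comp_of_trW {m p : ℕ} (hmp : m ≤ p) {X Y Z : C} {c : X ⟶ Y}
    (hc : (levelLT lev N m).trW c) (hZ : levelEq lev N p Z) :
    Function.Bijective fun f : Y ⟶ Z => c ≫ f := by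
  have hlocal : (levelLT lev N m).trW.isLocal Z := by
    rw [isLocal_trW]
    exact fun W f hW => hN.levelLT_hom_levelEq (levelLT_mono lev N hmp _ hW) hZ f
  exact hlocal c hc

theorem bijective_comp_canonical {l p : Λ} (hp : lev l ≤ lev p) {Y : C} {c : Y ⟶ N l}
    (hc : (levelLT lev N (lev l)).trW c) (n : ℤ) :
    Function.Bijective fun f : N l ⟶ (N p)⟦n⟧ => c ≫ f :=
  hN.bijective_comp_of_trW hp hc ((levelEq lev N _).le_shift n _ (mem_levelEq lev N p))

theorem bijective_smul_canonical {l : Λ} {Y : C} {c : Y ⟶ N l}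
    (hc : (levelLT lev N (lev l)).trW c) : Function.Bijective fun a : E => a • c := by
  convert (hN.bijective_comp_of_trW le_rfl hc (mem_levelEq lev N l)).comp
    (hN.bijective_smul_id l) using 1
  ext a
  simp

theorem del_hom_eq_zero (hD : IsDualFamily lev N D) {l p : Λ} (h : l ≠ p) (n : ℤ)
    (f : D l ⟶ (N p)⟦n⟧) : f = 0 := by
  rcases lt_or_ge (lev p) (lev l) with hlt | hle
  · exact hD.hom_lt l p hlt n f
  · obtain ⟨c, hc⟩ := hD.exists_canonical l
    obtain ⟨g, rfl⟩ := (hN.bijective_comp_canonical hle hc n).2 f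
    simp [hN.hom_ne l p hle h n g]

theorem del_hom_self_eq_zero (hD : IsDualFamily lev N D) (l : Λ) {n : ℤ} (hn : n ≠ 0)
    (f : D l ⟶ (N l)⟦n⟧) : f = 0 := by
  obtain ⟨c, hc⟩ := hD.exists_canonical l
  obtain ⟨g, rfl⟩ := (hN.bijective_comp_canonical le_rfl hc n).2 f
  simp [hN.hom_self l n hn g]

variable [IsTriangulated C]

theorem levelLT_succ_le_extensionProduct (m : ℕ) :
    levelLT lev N (m + 1) ≤ extensionProduct (levelLT lev N m) (levelEq lev N m) := by
  have := extensionProduct_isTriangulated (U := levelLT lev N m) (V := levelEq lev N m)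
    (extensionProduct_swap fun X Y hX hY f =>
      hN.levelLT_hom_levelEq hX ((levelEq lev N m).le_shift 1 Y hY) f)
  refine triangulatedHull_le ?_
  rintro _ ⟨l, hl, rfl⟩
  rcases Nat.lt_succ_iff_lt_or_eq.1 hl with h | rfl
  · exact le_extensionProduct_left _ _ (mem_levelLT lev N h)
  · exact le_extensionProduct_right _ _ (mem_levelEq lev N l)

theorem mem_levelLT_of_hom_nab_eq_zero {m : ℕ} {X : C} (hX : levelLT lev N (m + 1) X)
    (h : ∀ l, lev l = m → ∀ (n : ℤ) (f : X ⟶ (N l)⟦n⟧), f = 0) : levelLT lev N m X := by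
  obtain ⟨V, d, f, g, k, hT, hV, hd⟩ := hN.levelLT_succ_le_extensionProduct m X hX
  have hg : g = 0 := by
    refine triangulatedHull_hom_eq_zero (P := singleton X) ?_ (le_triangulatedHull _ _ ⟨⟨⟩⟩) hd g
    rintro _ _ ⟨⟨⟩⟩ ⟨l, hl, rfl⟩ n f
    exact h l hl n f
  have hd_zero : IsZero d := by
    rw [IsZero.iff_id_eq_zero]
    exact eq_zero_of_mor₂_comp_eq_zero hT (fun b =>
      hN.levelLT_hom_levelEq ((levelLT lev N m).le_shift 1 V hV) hd b) (𝟙 d) (by rw [hg, zero_comp])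
  have : IsIso f := (Triangle.isZero₃_iff_isIso₁ _ hT).1 hd_zero
  exact (levelLT lev N m).prop_of_iso (asIso f) hV

end IsExceptionalFamily

namespace IsDualFamily

variable [IsTriangulated C] (hD : IsDualFamily lev N D)
include hD

theorem levelLT_succ_le_extensionProduct (m : ℕ) :
    levelLT lev N (m + 1) ≤ extensionProduct (levelEq lev D m) (levelLT lev N m) := by
  have := extensionProduct_isTriangulated (U := levelEq lev D m) (V := levelLT lev N m)
    (extensionProduct_swap fun X Y hX hY f =>
      hD.hom_eq_zero_of_levelEq_of_levelLT hX ((levelLT lev N m).le_shift 1 Y hY) f)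
  refine triangulatedHull_le ?_
  rintro _ ⟨l, hl, rfl⟩
  rcases Nat.lt_succ_iff_lt_or_eq.1 hl with h | rfl
  · exact le_extensionProduct_right _ _ (mem_levelLT lev N h)
  · obtain ⟨c, Z, g, h, hT, hZ⟩ := hD.exists_canonical l
    exact ⟨_, _, _, _, _, hT, mem_levelEq lev D l, hZ⟩

theorem mem_levelLT_of_del_hom_eq_zero {m : ℕ} {X : C} (hX : levelLT lev N (m + 1) X)
    (h : ∀ l, lev l = m → ∀ (n : ℤ) (f : D l ⟶ X⟦n⟧), f = 0) : levelLT lev N m X := by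
  obtain ⟨U, V, f, g, k, hT, hU, hV⟩ := hD.levelLT_succ_le_extensionProduct m X hX
  have hf : f = 0 := by
    refine triangulatedHull_hom_eq_zero (Q := singleton X) ?_ hU (le_triangulatedHull _ _ ⟨⟨⟩⟩) f
    rintro _ _ ⟨l, hl, rfl⟩ ⟨⟨⟩⟩ n f
    exact h l hl n f
  have hU_zero : IsZero U := by
    rw [IsZero.iff_id_eq_zero]
    exact eq_zero_of_comp_mor₁_eq_zero hT (fun b =>
      hD.hom_eq_zero_of_levelEq_of_levelLT hU ((levelLT lev N m).le_shift (-1) V hV) b) (𝟙 U)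
      (by rw [hf, comp_zero])
  have : IsIso g := (Triangle.isZero₁_iff_isIso₂ _ hT).1 hU_zero
  exact (levelLT lev N m).prop_of_iso (asIso g).symm hV

end IsDualFamily

end Families

/-! ### Truncation triangles -/

section Truncation

variable {C : Type w} [Category.{v} C] [Preadditive C] [HasZeroObject C] [HasShift C ℤ]
  [∀ n : ℤ, (shiftFunctor C n).Additive] [Pretriangulated C]

theorem triangulatedHull_le_extensionHull_shiftClosure (P : ObjectProperty C) :
    triangulatedHull P ≤ extensionHull (P.shiftClosure ℤ) := by
  have : ObjectProperty.IsTriangulated (extensionHull (P.shiftClosure ℤ)) :=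
    { isStableUnderShiftBy := fun a => ⟨fun X hX => extensionHull_shift a
        (fun X hX => .of_mem _ ((P.shiftClosure ℤ).le_shift a X hX)) hX⟩ }
  exact triangulatedHull_le fun X hX => .of_mem _ (le_shiftClosure P X hX)

theorem distinguished_of_isos {X Y Z X' Y' Z' : C} {f : X ⟶ Y} {g : Y ⟶ Z} {h : Z ⟶ X⟦(1 : ℤ)⟧}
    {f' : X' ⟶ Y'} {g' : Y' ⟶ Z'} {h' : Z' ⟶ X'⟦(1 : ℤ)⟧}
    (hT : Triangle.mk f g h ∈ distTriang C) (e₁ : X' ≅ X) (e₂ : Y' ≅ Y) (e₃ : Z' ≅ Z)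
    (comm₁ : f' ≫ e₂.hom = e₁.hom ≫ f) (comm₂ : g' ≫ e₃.hom = e₂.hom ≫ g)
    (comm₃ : h' ≫ e₁.hom⟦(1 : ℤ)⟧' = e₃.hom ≫ h) : Triangle.mk f' g' h' ∈ distTriang C :=
  isomorphic_distinguished _ hT _ (Triangle.isoMk _ _ e₁ e₂ e₃ comm₁ comm₂ comm₃)

theorem exists_distTriang_of_isos {X Y Z A B : C} {i : X ⟶ Y} {p : Y ⟶ Z} {f : Z ⟶ X⟦(1 : ℤ)⟧}
    (hT : Triangle.mk i p f ∈ distTriang C) (eZ : Z ≅ A) (eX : X⟦(1 : ℤ)⟧ ≅ B) :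
    ∃ (g : B ⟶ Y⟦(1 : ℤ)⟧) (h : Y⟦(1 : ℤ)⟧ ⟶ A⟦(1 : ℤ)⟧),
      Triangle.mk (eZ.inv ≫ f ≫ eX.hom) g h ∈ distTriang C := by
  have hT' : Triangle.mk f (-i⟦(1 : ℤ)⟧') (-p⟦(1 : ℤ)⟧') ∈ distTriang C :=
    rot_of_distTriang _ (rot_of_distTriang _ hT)
  refine ⟨eX.inv ≫ (-i⟦(1 : ℤ)⟧'), (-p⟦(1 : ℤ)⟧') ≫ eZ.hom⟦(1 : ℤ)⟧', distinguished_of_isos hT'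
    eZ.symm eX.symm (Iso.refl _) (by simp) (by simp) (by simp [← Functor.map_comp])⟩

/-- The extension is rotated to a triangle `A ⟶ B ⟶ Y⟦1⟧`: the degrees are opposite, so that the
connecting morphism can only be nonzero for `n = 0` and `k = -1`. -/
theorem exists_distTriang_of_connecting_ne_zero {X Y Z A B : C} {i : X ⟶ Y} {p : Y ⟶ Z}
    {f : Z ⟶ X⟦(1 : ℤ)⟧} (hT : Triangle.mk i p f ∈ distTriang C) (hf : f ≠ 0) {n k : ℤ}
    (hn : 0 ≤ n) (hk : k ≤ -1) (eZ : Z ≅ A⟦n⟧) (eX : X ≅ B⟦k⟧)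
    (hAB : ∀ j : ℤ, j ≠ 0 → ∀ φ : A⟦j⟧ ⟶ B, φ = 0) :
    ∃ (φ : A ⟶ B) (g : B ⟶ Y⟦(1 : ℤ)⟧) (h : Y⟦(1 : ℤ)⟧ ⟶ A⟦(1 : ℤ)⟧),
      φ ≠ 0 ∧ Triangle.mk φ g h ∈ distTriang C := by
  obtain rfl : n = k + 1 := by
    by_contra hnk
    let eZ' : Z ≅ (A⟦n - (k + 1)⟧)⟦k + 1⟧ := eZ ≪≫ (shiftFunctorAdd' C _ _ _ (by lia)).app A
    let eX' : X⟦(1 : ℤ)⟧ ≅ B⟦k + 1⟧ := (shiftFunctor C (1 : ℤ)).mapIso eX ≪≫ (shiftAdd B k 1).symm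
    obtain ⟨φ, hφ⟩ := (shiftFunctor C (k + 1)).map_surjective (eZ'.inv ≫ f ≫ eX'.hom)
    rw [hAB _ (by lia) φ, Functor.map_zero] at hφ
    exact hf (by simpa using hφ.symm)
  obtain rfl : k = -1 := by lia
  let eZ' : Z ≅ A := eZ ≪≫ shiftZero (C := C) ℤ A
  let eX' : X⟦(1 : ℤ)⟧ ≅ B := (shiftFunctor C (1 : ℤ)).mapIso eX ≪≫ shiftNegShift B 1
  obtain ⟨g, h, hT'⟩ := exists_distTriang_of_isos hT eZ' eX'
  exact ⟨_, g, h, fun h₀ => hf (by simpa using h₀), hT'⟩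

variable (E : Type u) [CommRing E] [Linear E C] {Λ : Type x}

/-- `Z` is a cone of the multiplication by an irreducible element on `X`. -/
def IsIrreducibleCone (X Z : C) : Prop :=
  ∃ (ϖ : E) (g : X ⟶ Z) (h : Z ⟶ X⟦(1 : ℤ)⟧), Irreducible ϖ ∧
    Triangle.mk (ϖ • 𝟙 X) g h ∈ distTriang C

/-- The nonnegative shifts of the objects `D l`, `l ∈ J`. -/
def nonnegShifts (D : Λ → C) (J : Set Λ) : ObjectProperty C :=
  fun X => ∃ l ∈ J, ∃ n : ℤ, 0 ≤ n ∧ Nonempty (X ≅ (D l)⟦n⟧)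

/-- The shifts by at most `a` of the objects `N l`, `l ∈ J`, and of the cones of irreducible
elements on them. -/
def coneShifts (N : Λ → C) (J : Set Λ) (a : ℤ) : ObjectProperty C :=
  fun X => ∃ l ∈ J, ∃ (Z : C) (n : ℤ), (Z = N l ∨ IsIrreducibleCone E (N l) Z) ∧ n ≤ a ∧
    Nonempty (X ≅ Z⟦n⟧)

variable {E}

omit [HasZeroObject C] [∀ n : ℤ, (shiftFunctor C n).Additive] [Pretriangulated C] in
instance nonnegShifts_closedUnderIso (D : Λ → C) (J : Set Λ) :
    (nonnegShifts D J).IsClosedUnderIsomorphisms where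
  of_iso e := fun ⟨l, hl, n, hn, ⟨e'⟩⟩ => ⟨l, hl, n, hn, ⟨e.symm ≪≫ e'⟩⟩

omit [Preadditive C] [HasZeroObject C] [∀ n : ℤ, (shiftFunctor C n).Additive]
  [Pretriangulated C] in
theorem nonnegShifts_mono (D : Λ → C) {J J' : Set Λ} (h : J ⊆ J') :
    nonnegShifts D J ≤ nonnegShifts D J' :=
  fun _ ⟨l, hl, n, hn, e⟩ => ⟨l, h hl, n, hn, e⟩

theorem coneShifts_mono (N : Λ → C) {J J' : Set Λ} (h : J ⊆ J') (a : ℤ) :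
    coneShifts E N J a ≤ coneShifts E N J' a :=
  fun _ ⟨l, hl, Z, n, hZ, hn, e⟩ => ⟨l, h hl, Z, n, hZ, hn, e⟩

theorem nonnegShifts_shift {D : Λ → C} {J : Set Λ} {a : ℤ} (ha : 0 ≤ a) {X : C}
    (hX : extensionHull (nonnegShifts D J) X) : extensionHull (nonnegShifts D J) (X⟦a⟧) :=
  extensionHull_shift a (fun _ ⟨l, hl, n, hn, ⟨e⟩⟩ => .of_mem _ ⟨l, hl, n + a, by lia,
    ⟨(shiftFunctor C a).mapIso e ≪≫ (shiftAdd _ _ _).symm⟩⟩) hX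

theorem coneShifts_shift {N : Λ → C} {J : Set Λ} {a b c : ℤ} (h : a + b ≤ c) {X : C}
    (hX : extensionHull (coneShifts E N J a) X) : extensionHull (coneShifts E N J c) (X⟦b⟧) :=
  extensionHull_shift b (fun _ ⟨l, hl, Z, n, hZ, hn, ⟨e⟩⟩ => .of_mem _ ⟨l, hl, Z, n + b, hZ,
    by lia, ⟨(shiftFunctor C b).mapIso e ≪≫ (shiftAdd _ _ _).symm⟩⟩) hX

section Cones

variable {X Z : C} {ϖ : E} {g : X ⟶ Z} {h : Z ⟶ X⟦(1 : ℤ)⟧}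

theorem smul_mor₂_cone_smul (hT : Triangle.mk (ϖ • 𝟙 X) g h ∈ distTriang C) : ϖ • g = 0 := by
  have hzero : (ϖ • 𝟙 X) ≫ g = 0 := comp_distTriang_mor_zero₁₂ _ hT
  simpa using hzero

theorem hom_cone_smul_eq_zero (hT : Triangle.mk (ϖ • 𝟙 X) g h ∈ distTriang C) {A : C}
    (htors : ∀ k : A ⟶ X, ϖ • k = 0 → k = 0) {j : ℤ} (h₀ : ∀ f : A⟦j⟧ ⟶ X, f = 0)
    (h₁ : j ≠ 1 → ∀ f : A⟦j⟧ ⟶ X⟦(1 : ℤ)⟧, f = 0) (f : A⟦j⟧ ⟶ Z) : f = 0 := by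
  have hfh : f ≫ h = 0 := by
    by_cases hj : j = 1
    · subst hj
      obtain ⟨k, hk⟩ := (shiftFunctor C (1 : ℤ)).map_surjective (f ≫ h)
      have hzero : h ≫ (ϖ • 𝟙 X)⟦(1 : ℤ)⟧' = 0 := comp_distTriang_mor_zero₃₁ _ hT
      replace hzero := congrArg (f ≫ ·) hzero
      simp only [← Category.assoc, ← hk, ← Functor.map_comp, comp_zero] at hzero
      have hϖk := (shiftFunctor C (1 : ℤ)).map_injective (hzero.trans (Functor.map_zero _ _ _).symm)
      rw [← hk, htors k (by simpa using hϖk), Functor.map_zero]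
    · exact h₁ hj _
  obtain ⟨e, rfl⟩ : ∃ e, f = e ≫ g := Triangle.coyoneda_exact₃ _ hT f hfh
  rw [h₀ e, zero_comp]

variable [∀ n : ℤ, (shiftFunctor C n).Linear E]

theorem sq_smul_id_cone_smul (hT : Triangle.mk (ϖ • 𝟙 X) g h ∈ distTriang C) :
    (ϖ ^ 2) • 𝟙 Z = 0 := by
  have hg : g ≫ (ϖ • 𝟙 Z) = 0 := by simpa using smul_mor₂_cone_smul hT
  have hh : h ≫ (ϖ • 𝟙 X)⟦(1 : ℤ)⟧' = 0 := comp_distTriang_mor_zero₃₁ _ hT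
  replace hh : ϖ • h = 0 := by simpa using hh
  obtain ⟨k, hk⟩ : ∃ k, ϖ • 𝟙 Z = h ≫ k := Triangle.yoneda_exact₃ _ hT _ hg
  rw [pow_two, mul_smul, hk, ← Linear.smul_comp, hh, zero_comp]

theorem exists_iso_hom_eq_smul_id [IsPrincipalIdealRing E] (hϖ : Irreducible ϖ)
    (hT : Triangle.mk (ϖ • 𝟙 X) g h ∈ distTriang C) {s : E} (hs : ¬ ϖ ∣ s) :
    ∃ σ : Z ≅ Z, σ.hom = s • 𝟙 Z := by
  obtain ⟨x, y, hxy⟩ := (hϖ.coprime_iff_not_dvd.2 hs).pow_left (m := 2)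
  have hys : (y * s) • 𝟙 Z = 𝟙 Z := by
    simpa [add_smul, mul_smul x, sq_smul_id_cone_smul hT] using congrArg (· • 𝟙 Z) hxy
  exact ⟨⟨s • 𝟙 Z, y • 𝟙 Z, by simpa [smul_smul] using hys,
    by simpa [smul_smul, mul_comm] using hys⟩, rfl⟩

/-- A nonzero morphism to the cone is a multiple `s • g` with `s` prime to `ϖ`, and such an `s` acts
invertibly on the cone. Hence it has the same cone as `g`. -/
theorem distTriang_third_iso_of_ne_zero [IsPrincipalIdealRing E]
    (hX : Function.Surjective fun a : E => a • 𝟙 X) (hX₁ : ∀ f : X ⟶ X⟦(1 : ℤ)⟧, f = 0)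
    (hϖ : Irreducible ϖ) (hT : Triangle.mk (ϖ • 𝟙 X) g h ∈ distTriang C) {f : X ⟶ Z} (hf : f ≠ 0)
    {W : C} {g' : Z ⟶ W} {h' : W ⟶ X⟦(1 : ℤ)⟧} (hT' : Triangle.mk f g' h' ∈ distTriang C) :
    Nonempty (W ≅ X⟦(1 : ℤ)⟧) := by
  obtain ⟨e, he⟩ : ∃ e : X ⟶ X, f = e ≫ g := Triangle.coyoneda_exact₃ _ hT f (hX₁ _)
  obtain ⟨s, rfl⟩ := hX e
  have hs : ¬ ϖ ∣ s := by
    rintro ⟨t, rfl⟩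
    rw [Linear.smul_comp, Category.id_comp, mul_comm, mul_smul, smul_mor₂_cone_smul hT,
      smul_zero] at he
    exact hf he
  obtain ⟨σ, hσ⟩ := exists_iso_hom_eq_smul_id hϖ hT hs
  obtain ⟨ε, -⟩ := exists_iso_of_arrow_iso _ _ hT' (rot_of_distTriang _ hT)
    (Arrow.isoMk' f g (Iso.refl X) σ.symm
      (by rw [Iso.symm_hom, Iso.eq_comp_inv, hσ, he]; simp))
  exact ⟨Triangle.π₃.mapIso ε⟩

end Cones

theorem extensionHull_irreducibleCone [IsTriangulated C] [IsDomain E] [IsPrincipalIdealRing E]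
    {X : C} {r : E} (hr : r ≠ 0) : ∀ {Z : C} {g : X ⟶ Z} {h : Z ⟶ X⟦(1 : ℤ)⟧},
    Triangle.mk (r • 𝟙 X) g h ∈ distTriang C → extensionHull (IsIrreducibleCone E X) Z := by
  induction r using WfDvdMonoid.induction_on_irreducible with
  | zero => exact absurd rfl hr
  | unit r hu =>
    intro Z g h hT
    obtain ⟨s, hs⟩ := hu.exists_right_inv
    have : IsIso (r • 𝟙 X) := ⟨s • 𝟙 X, by simp [smul_smul, mul_comm s, hs],
      by simp [smul_smul, hs]⟩
    exact .of_isZero _ ((Triangle.isZero₃_iff_isIso₁ _ hT).2 this)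
  | mul a i ha hi ih =>
    intro Z g h hT
    obtain ⟨Z₁, g₁, h₁, hT₁⟩ := distinguished_cocone_triangle (a • 𝟙 X)
    obtain ⟨Z₂, g₂, h₂, hT₂⟩ := distinguished_cocone_triangle (i • 𝟙 X)
    have hcomp : (a • 𝟙 X) ≫ (i • 𝟙 X) = (i * a) • 𝟙 X := by simp [smul_smul]
    exact .ext _ (someOctahedron hcomp hT₁ hT₂ hT).mem (ih ha hT₁)
      (.of_mem _ ⟨i, g₂, h₂, hi, hT₂⟩)

variable {lev : Λ → ℕ} {N D : Λ → C}

namespace IsExceptionalFamily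

variable (hN : IsExceptionalFamily lev N E)
include hN

theorem hom_nab_eq_zero {l p : Λ} (h : lev l = lev p) {a b : ℤ} (hab : l = p → a ≠ b)
    (f : (N l)⟦a⟧ ⟶ (N p)⟦b⟧) : f = 0 := by
  refine hom_shift_eq_zero a b (fun f => ?_) f
  by_cases hlp : l = p
  · subst hlp
    exact hN.hom_self l _ (sub_ne_zero.2 (hab rfl).symm) f
  · exact hN.hom_ne l p h.le hlp _ f

theorem hom_nab_shift_zero_eq_zero {l p : Λ} (h : lev l = lev p) {j : ℤ} (hlj : l = p → j ≠ 0)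
    (f : (N l)⟦j⟧ ⟶ N p) : f = 0 := by
  rw [← cancel_mono (shiftZero ℤ (N p)).inv, zero_comp]
  exact hN.hom_nab_eq_zero h hlj _

theorem extensionHull_coneShifts_of_connecting_ne_zero [IsTriangulated C] [IsDomain E]
    [IsPrincipalIdealRing E] {m : ℕ} {l p : Λ} (hl : lev l = m) (hp : lev p = m) {X Y Z : C}
    {i : X ⟶ Y} {q : Y ⟶ Z}
    {f : Z ⟶ X⟦(1 : ℤ)⟧} (hT : Triangle.mk i q f ∈ distTriang C) (hf : f ≠ 0) {n k : ℤ}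
    (hn : 0 ≤ n) (hk : k ≤ -1) (eZ : Z ≅ (N l)⟦n⟧) (eX : X ≅ (N p)⟦k⟧) :
    extensionHull (coneShifts E N {l | lev l = m} (-1)) Y := by
  obtain ⟨φ, g, h, hφ, hT'⟩ := exists_distTriang_of_connecting_ne_zero hT hf hn hk eZ eX
    fun j hj => hN.hom_nab_shift_zero_eq_zero (hl.trans hp.symm) fun _ => hj
  obtain rfl : l = p := by
    by_contra hlp
    have := hN.hom_nab_shift_zero_eq_zero (hl.trans hp.symm) (fun h => absurd h hlp)
      ((shiftZero ℤ (N l)).hom ≫ φ)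
    exact hφ (by rwa [← cancel_epi (shiftZero ℤ (N l)).hom, comp_zero])
  obtain ⟨r, rfl⟩ := (hN.bijective_smul_id l).2 φ
  have hr : r ≠ 0 := by
    rintro rfl
    exact hφ (zero_smul E _)
  refine extensionHull_of_iso (shiftShiftNeg Y 1) (extensionHull_shift (-1) (fun W hW => ?_)
    (extensionHull_irreducibleCone hr hT'))
  exact .of_mem _ ⟨l, hl, W, -1, Or.inr hW, le_rfl, ⟨Iso.refl _⟩⟩

theorem eq_zero_of_smul_eq_zero [IsDomain E] {l p : Λ} (hlp : lev l = lev p) {ϖ : E} (hϖ : ϖ ≠ 0)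
    (k : N l ⟶ N p) (hk : ϖ • k = 0) : k = 0 := by
  by_cases h : l = p
  · subst h
    obtain ⟨a, rfl⟩ := (hN.bijective_smul_id l).2 k
    have hϖa : ϖ * a = 0 := (hN.bijective_smul_id l).1 (by simpa [smul_smul] using hk)
    simp [(mul_eq_zero.1 hϖa).resolve_left hϖ]
  · rw [← cancel_epi (shiftZero ℤ (N l)).hom, comp_zero]
    exact hN.hom_nab_shift_zero_eq_zero hlp (fun h' => absurd h' h) _

theorem hom_cone_eq_zero [IsDomain E] {l p : Λ} (hlp : lev l = lev p) {ϖ : E} (hϖ : ϖ ≠ 0) {Z : C}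
    {g : N p ⟶ Z} {h : Z ⟶ (N p)⟦(1 : ℤ)⟧} (hT : Triangle.mk (ϖ • 𝟙 (N p)) g h ∈ distTriang C)
    {j : ℤ} (hlj : l = p → j ≠ 0) (f : (N l)⟦j⟧ ⟶ Z) : f = 0 :=
  hom_cone_smul_eq_zero hT (hN.eq_zero_of_smul_eq_zero hlp hϖ)
    (hN.hom_nab_shift_zero_eq_zero hlp hlj) (fun hj => hN.hom_nab_eq_zero hlp fun _ => hj) f

variable [∀ n : ℤ, (shiftFunctor C n).Linear E]

theorem nonnegShifts_of_connecting_ne_zero [IsDomain E] [IsPrincipalIdealRing E]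
    {m : ℕ} {l p : Λ} (hl : lev l = m) (hp : lev p = m) {X Y Z : C} {i : X ⟶ Y} {q : Y ⟶ Z}
    {f : Z ⟶ X⟦(1 : ℤ)⟧} (hT : Triangle.mk i q f ∈ distTriang C) (hf : f ≠ 0) {n k : ℤ}
    (hn : 0 ≤ n) (hk : k ≤ -1) {W : C} (hW : IsIrreducibleCone E (N p) W) (eZ : Z ≅ (N l)⟦n⟧)
    (eX : X ≅ W⟦k⟧) : nonnegShifts N {l | lev l = m} Y := by
  obtain ⟨ϖ, _, _, hϖ, hTW⟩ := hW
  obtain ⟨φ, g, h, hφ, hT'⟩ := exists_distTriang_of_connecting_ne_zero hT hf hn hk eZ eX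
    fun j hj => hN.hom_cone_eq_zero (hl.trans hp.symm) hϖ.ne_zero hTW fun _ => hj
  obtain rfl : l = p := by
    by_contra hlp
    have := hN.hom_cone_eq_zero (hl.trans hp.symm) hϖ.ne_zero hTW (fun h => absurd h hlp)
      ((shiftZero ℤ (N l)).hom ≫ φ)
    exact hφ (by rwa [← cancel_epi (shiftZero ℤ (N l)).hom, comp_zero])
  obtain ⟨ε⟩ := distTriang_third_iso_of_ne_zero (hN.bijective_smul_id l).2
    (hN.hom_self l 1 one_ne_zero) hϖ hTW hφ hT'
  exact ⟨l, hl, 0, le_rfl, ⟨(shiftFunctor C (1 : ℤ)).preimageIso ε ≪≫ (shiftZero ℤ (N l)).symm⟩⟩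

theorem levelEq_le_extensionProduct [IsTriangulated C] [IsDomain E]
    [IsPrincipalIdealRing E] (m : ℕ) :
    levelEq lev N m ≤ extensionProduct (extensionHull (nonnegShifts N {l | lev l = m}))
      (extensionHull (coneShifts E N {l | lev l = m} (-1))) := by
  have hswap := extensionProduct_extensionHull_swap_of_connecting
    (A := nonnegShifts N {l | lev l = m}) (B := coneShifts E N {l | lev l = m} (-1)) <| by
      rintro X Y Z i q f hT ⟨p, hp, W, k, hW, hk, ⟨eX⟩⟩ ⟨l, hl, n, hn, ⟨eZ⟩⟩ hf
      rcases hW with rfl | hW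
      · exact Or.inr (hN.extensionHull_coneShifts_of_connecting_ne_zero hl hp hT hf hn hk eZ eX)
      · exact Or.inl (hN.nonnegShifts_of_connecting_ne_zero hl hp hT hf hn hk hW eZ eX)
  have := extensionProduct_closed₂ hswap
  have : ContainsZero (extensionProduct (extensionHull (nonnegShifts N {l | lev l = m}))
      (extensionHull (coneShifts E N {l | lev l = m} (-1)))) :=
    ⟨0, isZero_zero C, le_extensionProduct_left _ _ (.of_isZero _ (isZero_zero C))⟩
  refine (triangulatedHull_le_extensionHull_shiftClosure _).trans (extensionHull_le ?_)
  rintro X ⟨_, n, e, ⟨l, hl, rfl⟩⟩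
  rcases lt_or_ge n 0 with hn | hn
  · exact le_extensionProduct_right _ _ (.of_mem _ ⟨l, hl, N l, n, Or.inl rfl, by lia, ⟨e⟩⟩)
  · exact le_extensionProduct_left _ _ (.of_mem _ ⟨l, hl, n, hn, ⟨e⟩⟩)

end IsExceptionalFamily

theorem IsDualFamily.extensionProduct_levelLT_nonnegShifts_le (hD : IsDualFamily lev N D) (m : ℕ) :
    extensionProduct (levelLT lev N m) (extensionHull (nonnegShifts D {l | lev l = m})) ≤
      extensionProduct (extensionHull (nonnegShifts D {l | lev l = m})) (levelLT lev N m) := by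
  refine extensionProduct_swap fun X Y hX hY f => ?_
  have hle : extensionHull (nonnegShifts D {l | lev l = m}) ≤ levelEq lev D m := by
    refine extensionHull_le ?_
    rintro X ⟨l, rfl, n, -, ⟨e⟩⟩
    exact prop_of_iso _ e.symm ((levelEq lev D _).le_shift n _ (mem_levelEq lev D l))
  exact hD.hom_eq_zero_of_levelEq_of_levelLT (hle X hX) ((levelLT lev N m).le_shift 1 Y hY) f

theorem IsDualFamily.nonnegShifts_nab_le_extensionProduct [IsTriangulated C]
    (hD : IsDualFamily lev N D) (m : ℕ) :
    extensionHull (nonnegShifts N {l | lev l = m}) ≤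
      extensionProduct (extensionHull (nonnegShifts D {l | lev l = m})) (levelLT lev N m) := by
  have := extensionProduct_closed₂ (hD.extensionProduct_levelLT_nonnegShifts_le m)
  have : ContainsZero (extensionProduct (extensionHull (nonnegShifts D {l | lev l = m}))
      (levelLT lev N m)) :=
    ⟨0, isZero_zero C, le_extensionProduct_left _ _ (.of_isZero _ (isZero_zero C))⟩
  refine extensionHull_le ?_
  rintro X ⟨l, rfl, n, hn, ⟨e⟩⟩
  obtain ⟨c, Z, g, h, hT, hZ⟩ := hD.exists_canonical l
  exact prop_of_iso _ e.symm ⟨_, _, _, _, _, Triangle.shift_distinguished _ hT n,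
    .of_mem _ ⟨l, rfl, n, hn, ⟨Iso.refl _⟩⟩, (levelLT lev N (lev l)).le_shift n Z hZ⟩

theorem IsDualFamily.extensionProduct_levelLT_nonnegShifts_nab_le [IsTriangulated C]
    (hD : IsDualFamily lev N D) (m : ℕ) :
    extensionProduct (levelLT lev N m) (extensionHull (nonnegShifts N {l | lev l = m})) ≤
      extensionProduct (extensionHull (nonnegShifts D {l | lev l = m})) (levelLT lev N m) := by
  let L := levelLT lev N m
  let N₀ := extensionHull (nonnegShifts N {l | lev l = m})
  let D₀ := extensionHull (nonnegShifts D {l | lev l = m})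
  calc extensionProduct L N₀
    _ ≤ extensionProduct (extensionProduct L D₀) L :=
      (monotone_extensionProduct_right _ (hD.nonnegShifts_nab_le_extensionProduct m)).trans
        (extensionProduct_assoc _ _ _).ge
    _ ≤ extensionProduct D₀ (extensionProduct L L) :=
      (monotone_extensionProduct_left _ (hD.extensionProduct_levelLT_nonnegShifts_le m)).trans
        (extensionProduct_assoc _ _ _).le
    _ ≤ extensionProduct D₀ L := monotone_extensionProduct_right _ (extensionProduct_self_le _)

end Truncation

/-! ### The t-structure of an exceptional family -/

section ExistenceTStructure

variable {C : Type w} [Category.{v} C] [Preadditive C] [HasZeroObject C] [HasShift C ℤ]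
  [∀ n : ℤ, (shiftFunctor C n).Additive] [Pretriangulated C]
variable {E : Type u} [CommRing E] [Linear E C] {Λ : Type x} {lev : Λ → ℕ} {N D : Λ → C}

/-- `t` is the t-structure attached to the families `N` and `D`. As in the paper, the objects of
`N` contribute to `t.ge 0` along with the cones of the irreducible elements of `E` on them. -/
structure IsFamilyTStructure (E : Type u) [CommRing E] [Linear E C] (N D : Λ → C)
    (t : TStructure C) : Prop where
  le_zero : t.le 0 = extensionHull (nonnegShifts D Set.univ)
  ge_zero : t.ge 0 = extensionHull (coneShifts E N Set.univ 0)

namespace IsFamilyTStructure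

variable {t : TStructure C} (ht : IsFamilyTStructure E N D t)
include ht

theorem isLE_iff (X : C) : t.IsLE X 0 ↔ extensionHull (nonnegShifts D Set.univ) X := by
  rw [← t.le_iff_isLE, ht.le_zero]

theorem isGE_iff (X : C) : t.IsGE X 0 ↔ extensionHull (coneShifts E N Set.univ 0) X := by
  rw [← t.ge_iff_isGE, ht.ge_zero]

theorem del_isLE (l : Λ) : t.IsLE (D l) 0 :=
  (ht.isLE_iff _).2 (.of_mem _ ⟨l, trivial, 0, le_rfl, ⟨(shiftZero ℤ _).symm⟩⟩)

theorem nab_isGE (l : Λ) : t.IsGE (N l) 0 :=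
  (ht.isGE_iff _).2 (.of_mem _ ⟨l, trivial, N l, 0, Or.inl rfl, le_rfl, ⟨(shiftZero ℤ _).symm⟩⟩)

theorem isGE_iff_del_hom_eq_zero (X : C) :
    t.IsGE X 0 ↔ ∀ (l : Λ) (n : ℤ), 1 ≤ n → ∀ f : (D l)⟦n⟧ ⟶ X, f = 0 := by
  refine ⟨fun hX l n hn f => ?_, fun h => ?_⟩
  · have := ht.del_isLE l
    have := t.isLE_shift (D l) 0 n (-n)
    exact t.zero f (-n) 0
  · let P : ObjectProperty C := fun Z => ∃ l, ∃ n : ℤ, 1 ≤ n ∧ Nonempty (Z ≅ (D l)⟦n⟧)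
    have hPX : extensionHull P ≤ (singleton X).leftOrthogonal := fun Z hZ _ f hX =>
      extensionHull_hom_eq_zero (by
        rintro Z _ ⟨l, n, hn, ⟨e⟩⟩ ⟨⟨⟩⟩ f
        rw [← cancel_epi e.inv, h l n hn (e.inv ≫ f), comp_zero]) hZ (le_extensionHull _ _ hX) f
    rw [t.isGE_iff_orthogonal (-1) 0 (by lia)]
    intro Y f hY
    have hY' : extensionHull P ((Y⟦(-1 : ℤ)⟧)⟦(1 : ℤ)⟧) :=
      extensionHull_shift 1 (fun Z ⟨l, _, n, hn, ⟨e⟩⟩ => .of_mem _ ⟨l, n + 1, by lia,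
        ⟨(shiftFunctor C (1 : ℤ)).mapIso e ≪≫ (shiftAdd _ _ _).symm⟩⟩)
        ((ht.isLE_iff _).1 (t.isLE_shift Y (-1) (-1) 0))
    exact hPX Y (extensionHull_of_iso (shiftNegShift Y 1) hY') f ⟨⟨⟩⟩

end IsFamilyTStructure

namespace IsExceptionalFamily

variable (hN : IsExceptionalFamily lev N E) (hD : IsDualFamily lev N D)
include hN hD

theorem del_hom_nab_eq_zero {l p : Λ} {a b : ℤ} (hab : l = p → a ≠ b)
    (f : (D l)⟦a⟧ ⟶ (N p)⟦b⟧) : f = 0 := by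
  refine hom_shift_eq_zero a b (fun f => ?_) f
  by_cases hlp : l = p
  · subst hlp
    exact hN.del_hom_self_eq_zero hD l (sub_ne_zero.2 (hab rfl).symm) f
  · exact hN.del_hom_eq_zero hD hlp _ f

theorem del_hom_nab_shift_zero_eq_zero {l p : Λ} {j : ℤ} (hlj : l = p → j ≠ 0)
    (f : (D l)⟦j⟧ ⟶ N p) : f = 0 := by
  rw [← cancel_mono (shiftZero ℤ (N p)).inv, zero_comp]
  exact hN.del_hom_nab_eq_zero hD hlj _

theorem del_eq_zero_of_smul_eq_zero [IsDomain E] {l p : Λ} {ϖ : E} (hϖ : ϖ ≠ 0) (k : D l ⟶ N p)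
    (hk : ϖ • k = 0) : k = 0 := by
  by_cases h : l = p
  · subst h
    obtain ⟨c, hc⟩ := hD.exists_canonical l
    obtain ⟨a, rfl⟩ := (hN.bijective_smul_canonical hc).2 k
    have hϖa : ϖ * a = 0 := (hN.bijective_smul_canonical hc).1 (by simpa [smul_smul] using hk)
    simp [(mul_eq_zero.1 hϖa).resolve_left hϖ]
  · rw [← cancel_epi (shiftZero ℤ (D l)).hom, comp_zero]
    exact hN.del_hom_nab_shift_zero_eq_zero hD (fun h' => absurd h' h) _

theorem del_hom_cone_eq_zero [IsDomain E] {l p : Λ} {ϖ : E} (hϖ : ϖ ≠ 0) {Z : C} {g : N p ⟶ Z}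
    {h : Z ⟶ (N p)⟦(1 : ℤ)⟧} (hT : Triangle.mk (ϖ • 𝟙 (N p)) g h ∈ distTriang C) {j : ℤ}
    (hlj : l = p → j ≠ 0) (f : (D l)⟦j⟧ ⟶ Z) : f = 0 :=
  hom_cone_smul_eq_zero hT (hN.del_eq_zero_of_smul_eq_zero hD hϖ)
    (hN.del_hom_nab_shift_zero_eq_zero hD hlj)
    (fun hj => hN.del_hom_nab_eq_zero hD fun _ => hj) f

theorem nonnegShifts_hom_coneShifts_eq_zero [IsDomain E] {X Y : C}
    (hX : extensionHull (nonnegShifts D Set.univ) X)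
    (hY : extensionHull (coneShifts E N Set.univ (-1)) Y) (f : X ⟶ Y) : f = 0 := by
  refine extensionHull_hom_eq_zero ?_ hX hY f
  rintro X Y ⟨l, -, n, hn, ⟨e⟩⟩ ⟨p, -, Z, k, hZ, hk, ⟨e'⟩⟩ f
  rw [← cancel_epi e.inv, ← cancel_mono e'.hom, comp_zero, zero_comp]
  rcases hZ with rfl | ⟨ϖ, g, h, hϖ, hT⟩
  · exact hN.del_hom_nab_eq_zero hD (fun _ => by lia) _
  · let e'' := (shiftFunctorAdd' C (n - k) k n (by lia)).app (D l)
    obtain ⟨φ, hφ⟩ := (shiftFunctor C k).map_surjective (e''.inv ≫ (e.inv ≫ f) ≫ e'.hom)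
    rw [hN.del_hom_cone_eq_zero hD hϖ.ne_zero hT (fun _ => by lia) φ, Functor.map_zero] at hφ
    rw [← cancel_epi e''.inv, ← hφ, comp_zero]

variable [∀ n : ℤ, (shiftFunctor C n).Linear E]

theorem levelLT_le_extensionProduct_shifts [IsTriangulated C] [IsDomain E]
    [IsPrincipalIdealRing E] (m : ℕ) :
    levelLT lev N m ≤ extensionProduct (extensionHull (nonnegShifts D {l | lev l < m}))
      (extensionHull (coneShifts E N {l | lev l < m} (-1))) := by
  induction m with
  | zero =>
    intro X hX
    exact le_extensionProduct_left _ _ (.of_isZero _ (isZero_of_levelLT_zero lev N hX))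
  | succ m ih =>
    let L := levelLT lev N m
    let N₀ := extensionHull (nonnegShifts N {l | lev l = m})
    let N₁ := extensionHull (coneShifts E N {l | lev l = m} (-1))
    let D₀ := extensionHull (nonnegShifts D {l | lev l = m})
    let D₀' := extensionHull (nonnegShifts D {l | lev l < m})
    let N₁' := extensionHull (coneShifts E N {l | lev l < m} (-1))
    have hlt : {l | lev l < m} ⊆ {l | lev l < m + 1} := fun l hl => Nat.lt_succ_of_lt hl
    have heq : {l | lev l = m} ⊆ {l | lev l < m + 1} := fun l hl => hl.le.trans_lt m.lt_succ_self
    calc levelLT lev N (m + 1)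
      _ ≤ extensionProduct L (extensionProduct N₀ N₁) :=
        (hN.levelLT_succ_le_extensionProduct m).trans
          (monotone_extensionProduct_right _ (hN.levelEq_le_extensionProduct m))
      _ ≤ extensionProduct (extensionProduct D₀ L) N₁ :=
        (extensionProduct_assoc _ _ _).ge.trans (monotone_extensionProduct_left _
          (hD.extensionProduct_levelLT_nonnegShifts_nab_le m))
      _ ≤ extensionProduct (extensionProduct D₀ (extensionProduct D₀' N₁')) N₁ :=
        monotone_extensionProduct_left _ (monotone_extensionProduct_right _ ih)
      _ = extensionProduct (extensionProduct D₀ D₀') (extensionProduct N₁' N₁) := by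
        simp only [extensionProduct_assoc]
      _ ≤ _ := extensionProduct_mono
        (extensionProduct_le_of_isTriangulatedClosed₂
          (extensionHull_mono (nonnegShifts_mono D heq))
          (extensionHull_mono (nonnegShifts_mono D hlt)))
        (extensionProduct_le_of_isTriangulatedClosed₂
          (extensionHull_mono (coneShifts_mono N hlt _))
          (extensionHull_mono (coneShifts_mono N heq _)))

theorem exists_isFamilyTStructure [IsTriangulated C] [IsDomain E] [IsPrincipalIdealRing E] :
    ∃ t : TStructure C, IsFamilyTStructure E N D t := by
  let t : TStructure C :=
    { le := fun n X => extensionHull (nonnegShifts D Set.univ) (X⟦n⟧)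
      ge := fun n X => extensionHull (coneShifts E N Set.univ 0) (X⟦n⟧)
      le_isClosedUnderIsomorphisms := fun n =>
        ⟨fun e h => extensionHull_of_iso ((shiftFunctor C n).mapIso e) h⟩
      ge_isClosedUnderIsomorphisms := fun n =>
        ⟨fun e h => extensionHull_of_iso ((shiftFunctor C n).mapIso e) h⟩
      le_shift := fun n a n' h X hX =>
        extensionHull_of_iso ((shiftFunctorAdd' C a n' n h).app X) hX
      ge_shift := fun n a n' h X hX =>
        extensionHull_of_iso ((shiftFunctorAdd' C a n' n h).app X) hX
      zero' := fun X Y f hX hY => hN.nonnegShifts_hom_coneShifts_eq_zero hD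
        (extensionHull_of_iso (shiftZero ℤ X) hX)
        (extensionHull_of_iso (shiftShiftNeg Y 1) (coneShifts_shift (b := -1) (by lia) hY)) f
      le_zero_le := fun X hX => nonnegShifts_shift zero_le_one
        (extensionHull_of_iso (shiftZero ℤ X) hX)
      ge_one_le := fun X hX => extensionHull_of_iso
        (shiftShiftNeg X 1 ≪≫ (shiftZero ℤ X).symm) (coneShifts_shift (b := -1) (by lia) hX)
      exists_triangle_zero_one := fun X => by
        obtain ⟨m, hm⟩ := hN.exists_levelLT X
        obtain ⟨A, B, f, g, h, hT, hA, hB⟩ := hN.levelLT_le_extensionProduct_shifts hD m X hm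
        exact ⟨A, B, extensionHull_of_iso (shiftZero ℤ A).symm
            (extensionHull_mono (nonnegShifts_mono D (Set.subset_univ _)) _ hA),
          coneShifts_shift (by lia)
            (extensionHull_mono (coneShifts_mono N (Set.subset_univ _) _) _ hB), f, g, h, hT⟩ }
  refine ⟨t, ⟨?_, ?_⟩⟩ <;> ext X <;>
    exact ⟨extensionHull_of_iso (shiftZero ℤ X), extensionHull_of_iso (shiftZero ℤ X).symm⟩

end IsExceptionalFamily

end ExistenceTStructure

/-! ### Monomorphisms and epimorphisms in the heart -/

section Heart

variable {C : Type w} [Category.{v} C] [Preadditive C] [HasZeroObject C] [HasShift C ℤ]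
  [∀ n : ℤ, (shiftFunctor C n).Additive] [Pretriangulated C] (t : TStructure C)

instance heart_isLE (X : HeartCat t) : t.IsLE X.obj 0 := ((t.mem_heart_iff _).1 X.property).1

instance heart_isGE (X : HeartCat t) : t.IsGE X.obj 0 := ((t.mem_heart_iff _).1 X.property).2

/-- Left cancellability by morphisms from `t.le 0`. In the heart this means being a monomorphism,
but unlike `Mono` it makes sense for morphisms between objects outside the heart. -/
def IsTMono {X Y : C} (f : X ⟶ Y) : Prop :=
  ∀ ⦃W : C⦄, t.IsLE W 0 → ∀ g : W ⟶ X, g ≫ f = 0 → g = 0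

/-- Right cancellability by morphisms to `t.ge 0`. In the heart this means being an epimorphism,
but unlike `Epi` it makes sense for morphisms between objects outside the heart. -/
def IsTEpi {X Y : C} (f : X ⟶ Y) : Prop :=
  ∀ ⦃W : C⦄, t.IsGE W 0 → ∀ g : Y ⟶ W, f ≫ g = 0 → g = 0

variable {t}

theorem IsTMono.comp {X Y Z : C} {f : X ⟶ Y} {g : Y ⟶ Z} (hf : IsTMono t f) (hg : IsTMono t g) :
    IsTMono t (f ≫ g) :=
  fun _ hW a ha => hf hW a (hg hW _ (by rw [Category.assoc, ha]))

theorem IsTEpi.comp {X Y Z : C} {f : X ⟶ Y} {g : Y ⟶ Z} (hf : IsTEpi t f) (hg : IsTEpi t g) :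
    IsTEpi t (f ≫ g) :=
  fun _ hW a ha => hg hW a (hf hW _ (by rw [← Category.assoc, ha]))

theorem IsTEpi.of_comp {X Y Z : C} {f : X ⟶ Y} {g : Y ⟶ Z} (h : IsTEpi t (f ≫ g)) : IsTEpi t g :=
  fun _ hW a ha => h hW a (by rw [Category.assoc, ha, comp_zero])

theorem IsTMono.of_comp {X Y Z : C} {f : X ⟶ Y} {g : Y ⟶ Z} (h : IsTMono t (f ≫ g)) :
    IsTMono t f :=
  fun _ hW a ha => h hW a (by rw [← Category.assoc, ha, zero_comp])

theorem IsTMono.eq_of_comp_eq {X Y W : C} {f : X ⟶ Y} (hf : IsTMono t f) [hW : t.IsLE W 0]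
    {a b : W ⟶ X} (h : a ≫ f = b ≫ f) : a = b :=
  sub_eq_zero.1 (hf hW _ (by rw [Preadditive.sub_comp, h, sub_self]))

theorem IsTEpi.eq_of_comp_eq {X Y W : C} {f : X ⟶ Y} (hf : IsTEpi t f) [hW : t.IsGE W 0]
    {a b : Y ⟶ W} (h : f ≫ a = f ≫ b) : a = b :=
  sub_eq_zero.1 (hf hW _ (by rw [Preadditive.comp_sub, h, sub_self]))

theorem IsTMono.of_mono {X Y : C} (f : X ⟶ Y) [Mono f] : IsTMono t f :=
  fun _ _ _ hg => zero_of_comp_mono f hg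

theorem IsTEpi.of_epi {X Y : C} (f : X ⟶ Y) [Epi f] : IsTEpi t f :=
  fun _ _ _ hg => zero_of_epi_comp f hg

theorem IsTMono.of_distTriang {X Y Z : C} {f : X ⟶ Y} {g : Y ⟶ Z} {h : Z ⟶ X⟦(1 : ℤ)⟧}
    (hT : Triangle.mk f g h ∈ distTriang C) [t.IsGE Z 0] : IsTMono t f := by
  intro W hW a ha
  have := t.isGE_shift Z 0 (-1) 1
  exact eq_zero_of_comp_mor₁_eq_zero hT (fun b => t.zero b 0 1) a ha

theorem IsTEpi.of_distTriang {X Y Z : C} {f : X ⟶ Y} {g : Y ⟶ Z} {h : Z ⟶ X⟦(1 : ℤ)⟧}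
    (hT : Triangle.mk f g h ∈ distTriang C) [t.IsLE X 0] : IsTEpi t g := by
  intro W hW a ha
  have := t.isLE_shift X 0 1 (-1)
  exact eq_zero_of_mor₂_comp_eq_zero hT (fun b => t.zero b (-1) 0) a ha

theorem IsTMono.mono {X Y : HeartCat t} {f : X ⟶ Y} (hf : IsTMono t f.hom) : Mono f :=
  Preadditive.mono_of_cancel_zero f fun g hg =>
    ObjectProperty.hom_ext _ (hf inferInstance g.hom (congrArg (·.hom) hg))

theorem IsTEpi.epi {X Y : HeartCat t} {f : X ⟶ Y} (hf : IsTEpi t f.hom) : Epi f :=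
  Preadditive.epi_of_cancel_zero f fun g hg =>
    ObjectProperty.hom_ext _ (hf inferInstance g.hom (congrArg (·.hom) hg))

variable [IsTriangulated C]

theorem exists_distTriang_of_epi {X Y : HeartCat t} (f : X ⟶ Y) [Epi f] :
    ∃ (K : HeartCat t) (i : K ⟶ X) (δ : Y.obj ⟶ K.obj⟦(1 : ℤ)⟧),
      Triangle.mk i.hom f.hom δ ∈ distTriang C :=
  AbelianSubcategory.exists_distinguished_triangle_of_epi (heart_hom_shift_neg t)
    (heart_admissible t) f

theorem exists_distTriang_of_mono {X Y : HeartCat t} (f : X ⟶ Y) [Mono f] :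
    ∃ δ : (cokernel f).obj ⟶ X.obj⟦(1 : ℤ)⟧,
      Triangle.mk f.hom (cokernel.π f).hom δ ∈ distTriang C := by
  obtain ⟨K, i, δ, hT⟩ := exists_distTriang_of_epi (cokernel.π f)
  have hi := AbelianSubcategory.isLimitKernelForkOfDistTriang (heart_hom_shift_neg t) i
    (cokernel.π f) δ hT
  have hf := Abelian.monoIsKernelOfCokernel _ (cokernelIsCokernel f)
  let e : K ≅ X := IsLimit.conePointUniqueUpToIso hi hf
  have he : e.hom ≫ f = i := IsLimit.conePointUniqueUpToIso_hom_comp hi hf .zero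
  let e' : K.obj ≅ X.obj := t.heart.ι.mapIso e
  have he' : e'.hom ≫ f.hom = i.hom := congrArg (·.hom) he
  exact ⟨δ ≫ e'.hom⟦(1 : ℤ)⟧', distinguished_of_isos hT e'.symm (Iso.refl _) (Iso.refl _)
    (by simp [← he']) (by simp) (by simp [← Functor.map_comp])⟩

theorem isTMono_of_mono {X Y : HeartCat t} (f : X ⟶ Y) [Mono f] : IsTMono t f.hom := by
  obtain ⟨δ, hT⟩ := exists_distTriang_of_mono f
  exact .of_distTriang hT

end Heart

section CohomologyComparison

variable {C : Type w} [Category.{v} C] [Preadditive C] [HasZeroObject C] [HasShift C ℤ]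
  [∀ n : ℤ, (shiftFunctor C n).Additive] [Pretriangulated C] [IsTriangulated C] (t : TStructure C)

instance isGE_truncLE_obj (X : C) [t.IsGE X 0] : t.IsGE ((t.truncLE 0).obj X) 0 := by
  unfold TStructure.truncLE
  infer_instance

/-- The morphism `τ^{≤ 0} X ⟶ H⁰(X)`. -/
noncomputable def leToH0 (X : C) : (t.truncLE 0).obj X ⟶ ((H0 t).obj X).obj :=
  (t.truncGEπ 0).app ((t.truncLE 0).obj X)

instance isIso_truncLEι_app (X : C) [t.IsLE X 0] : IsIso ((t.truncLEι 0).app X) :=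
  (t.isLE_iff_isIso_truncLEι_app 0 X).1 inferInstance

instance isIso_leToH0 (X : C) [t.IsGE X 0] : IsIso (leToH0 t X) :=
  (t.isGE_iff_isIso_truncGEπ_app 0 ((t.truncLE 0).obj X)).1 inferInstance

theorem leToH0_naturality {X Y : C} (c : X ⟶ Y) :
    leToH0 t X ≫ ((H0 t).map c).hom = (t.truncLE 0).map c ≫ leToH0 t Y :=
  ((t.truncGEπ 0).naturality _).symm

/-- The morphism `X ⟶ H⁰(X)` for `X` in `t.le 0`. -/
noncomputable def toH0 (X : C) [t.IsLE X 0] : X ⟶ ((H0 t).obj X).obj :=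
  inv ((t.truncLEι 0).app X) ≫ leToH0 t X

/-- The morphism `H⁰(X) ⟶ X` for `X` in `t.ge 0`. -/
noncomputable def fromH0 (X : C) [t.IsGE X 0] : ((H0 t).obj X).obj ⟶ X :=
  inv (leToH0 t X) ≫ (t.truncLEι 0).app X

theorem toH0_H0_map_fromH0 {X Y : C} [t.IsLE X 0] [t.IsGE Y 0] (c : X ⟶ Y) :
    toH0 t X ≫ ((H0 t).map c).hom ≫ fromH0 t Y = c := by
  rw [toH0, fromH0, Category.assoc, reassoc_of% (leToH0_naturality t c), IsIso.hom_inv_id_assoc,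
    NatTrans.naturality, IsIso.inv_hom_id_assoc, Functor.id_map]

theorem exists_distTriang_toH0 (X : C) [t.IsLE X 0] :
    ∃ (A : C) (_ : t.IsLE A (-1)) (f : A ⟶ X) (h : _ ⟶ A⟦(1 : ℤ)⟧),
      Triangle.mk f (toH0 t X) h ∈ distTriang C := by
  obtain ⟨A, hA, f, h, hT⟩ : ∃ (A : C) (_ : t.IsLE A (-1)) (f : A ⟶ _) (h : _ ⟶ A⟦(1 : ℤ)⟧),
      Triangle.mk f (leToH0 t X) h ∈ distTriang C :=
    ⟨_, inferInstance, _, _, t.triangleLEGE_distinguished (-1) 0 (by lia) ((t.truncLE 0).obj X)⟩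
  exact ⟨A, hA, f ≫ (t.truncLEι 0).app X, h, distinguished_of_isos hT (Iso.refl _)
    (asIso ((t.truncLEι 0).app X)).symm (Iso.refl _) (by simp) (by simp [toH0]) (by simp)⟩

theorem exists_distTriang_fromH0 (X : C) [t.IsGE X 0] :
    ∃ (B : C) (_ : t.IsGE B 1) (g : X ⟶ B) (h : B ⟶ _),
      Triangle.mk (fromH0 t X) g h ∈ distTriang C := by
  obtain ⟨B, hB, g, h, hT⟩ : ∃ (B : C) (_ : t.IsGE B 1) (g : X ⟶ B) (h : B ⟶ _),
      Triangle.mk ((t.truncLEι 0).app X) g h ∈ distTriang C :=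
    ⟨_, inferInstance, _, _, t.triangleLEGE_distinguished 0 1 (by lia) X⟩
  exact ⟨B, hB, g, h ≫ (leToH0 t X)⟦(1 : ℤ)⟧', distinguished_of_isos hT
    (asIso (leToH0 t X)).symm (Iso.refl _) (Iso.refl _) (by simp [fromH0]) (by simp)
    (by simp)⟩

theorem isTEpi_toH0 (X : C) [t.IsLE X 0] : IsTEpi t (toH0 t X) := by
  obtain ⟨A, hA, f, h, hT⟩ := exists_distTriang_toH0 t X
  have := t.isLE_of_le A (-1) 0
  exact .of_distTriang hT

theorem isTMono_fromH0 (X : C) [t.IsGE X 0] : IsTMono t (fromH0 t X) := by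
  obtain ⟨B, hB, g, h, hT⟩ := exists_distTriang_fromH0 t X
  have := t.isGE_of_ge B 0 1
  exact .of_distTriang hT

theorem exists_toH0_comp (X : C) [t.IsLE X 0] {W : C} [t.IsGE W 0] (f : X ⟶ W) :
    ∃ g : ((H0 t).obj X).obj ⟶ W, toH0 t X ≫ g = f := by
  obtain ⟨A, hA, a, h, hT⟩ := exists_distTriang_toH0 t X
  have haf : a ≫ f = 0 := t.zero _ (-1) 0
  obtain ⟨g, rfl⟩ := Triangle.yoneda_exact₂ _ hT f haf
  exact ⟨g, rfl⟩

theorem exists_comp_fromH0 (X : C) [t.IsGE X 0] {W : C} [t.IsLE W 0] (f : W ⟶ X) :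
    ∃ g : W ⟶ ((H0 t).obj X).obj, g ≫ fromH0 t X = f := by
  obtain ⟨B, hB, b, h, hT⟩ := exists_distTriang_fromH0 t X
  have hfb : f ≫ b = 0 := t.zero _ 0 1
  obtain ⟨g, rfl⟩ := Triangle.coyoneda_exact₂ _ hT f hfb
  exact ⟨g, rfl⟩

end CohomologyComparison

/-! ### Levels in the heart -/

section FamilyTStructure

variable {C : Type w} [Category.{v} C] [Preadditive C] [HasZeroObject C] [HasShift C ℤ]
  [∀ n : ℤ, (shiftFunctor C n).Additive] [Pretriangulated C]
variable {Λ : Type x} {lev : Λ → ℕ} {N D : Λ → C}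

theorem IsDualFamily.extensionHull_nonnegShifts_le (hD : IsDualFamily lev N D) (m : ℕ) :
    extensionHull (nonnegShifts D {l | lev l < m}) ≤ levelLT lev N m := by
  refine extensionHull_le ?_
  rintro X ⟨l, hl, n, -, ⟨e⟩⟩
  exact (levelLT lev N m).prop_of_iso e.symm
    ((levelLT lev N m).le_shift n _ (levelLT_mono lev N hl _ (hD.del_mem l)))

theorem IsDualFamily.bijective_comp_of_trW (hD : IsDualFamily lev N D) {m : ℕ} {l : Λ}
    (h : m ≤ lev l) {X Y : C} {c : X ⟶ Y} (hc : (levelLT lev N m).trW c) :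
    Function.Bijective fun f : D l ⟶ X => f ≫ c := by
  have hcolocal : (levelLT lev N m).trW.isColocal (D l) := by
    rw [isColocal_trW]
    exact fun Z g hZ =>
      hD.hom_eq_zero_of_levelEq_of_levelLT (mem_levelEq lev D l) (levelLT_mono lev N h _ hZ) g
  exact hcolocal c hc

variable [IsTriangulated C] {E : Type u} [CommRing E] [IsDomain E] [IsPrincipalIdealRing E]
  [Linear E C] [∀ n : ℤ, (shiftFunctor C n).Linear E] {t : TStructure C}

namespace IsFamilyTStructure

variable (ht : IsFamilyTStructure E N D t) (hN : IsExceptionalFamily lev N E)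
  (hD : IsDualFamily lev N D)
include ht hN hD

theorem exists_truncation {m : ℕ} {X : C} (hX : levelLT lev N m X) :
    ∃ (A B : C) (f : A ⟶ X) (g : X ⟶ B) (h : B ⟶ A⟦(1 : ℤ)⟧),
      Triangle.mk f g h ∈ distTriang C ∧ extensionHull (nonnegShifts D {l | lev l < m}) A ∧
      levelLT lev N m B ∧ t.IsLE A 0 ∧ t.IsGE B 1 := by
  obtain ⟨A, B, f, g, h, hT, hA, hB⟩ := hN.levelLT_le_extensionProduct_shifts hD m X hX
  refine ⟨A, B, f, g, h, hT, hA, (levelLT lev N m).ext_of_isTriangulatedClosed₃ _ hT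
    (hD.extensionHull_nonnegShifts_le m A hA) hX, ?_, ?_⟩
  · exact (ht.isLE_iff A).2 (extensionHull_mono (nonnegShifts_mono D (Set.subset_univ _)) _ hA)
  · have : t.IsGE (B⟦(1 : ℤ)⟧) 0 := (ht.isGE_iff _).2 (coneShifts_shift (by lia)
      (extensionHull_mono (coneShifts_mono N (Set.subset_univ _) _) _ hB))
    exact t.isGE_of_shift B 1 1 0

theorem levelLT_of_distTriang {m : ℕ} {A X B : C} {f : A ⟶ X} {g : X ⟶ B} {h : B ⟶ A⟦(1 : ℤ)⟧}
    (hT : Triangle.mk f g h ∈ distTriang C) (hX : levelLT lev N m X) (n : ℤ) [t.IsLE A n]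
    [t.IsGE B (n + 1)] : levelLT lev N m A ∧ levelLT lev N m B := by
  obtain ⟨A', B', f', g', h', hT', -, hB, hA', hB'⟩ :=
    ht.exists_truncation hN hD ((levelLT lev N m).le_shift n X hX)
  obtain ⟨e, -⟩ := t.triangle_iso_exists hT' (Triangle.shift_distinguished _ hT n)
    (Iso.refl _) 0 1 hA' hB' (t.isLE_shift A n n 0) (t.isGE_shift B (n + 1) n 1)
  have hBn := (levelLT lev N m).prop_of_iso (Triangle.π₃.mapIso e) hB
  have hB₀ := ((levelLT lev N m).prop_shift_iff_of_isStableUnderShift B n).1 hBn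
  exact ⟨(levelLT lev N m).ext_of_isTriangulatedClosed₁ _ hT hX hB₀, hB₀⟩

theorem levelLT_H0_of_isLE {m : ℕ} {X : C} (hX : levelLT lev N m X) [t.IsLE X 0] :
    levelLT lev N m ((H0 t).obj X).obj := by
  obtain ⟨A, hA, f, h, hT⟩ := exists_distTriang_toH0 t X
  have : t.IsGE ((H0 t).obj X).obj (-1 + 1) := heart_isGE t _
  exact (ht.levelLT_of_distTriang hN hD hT hX (-1)).2

theorem levelLT_H0_of_isGE {m : ℕ} {X : C} (hX : levelLT lev N m X) [t.IsGE X 0] :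
    levelLT lev N m ((H0 t).obj X).obj := by
  obtain ⟨B, hB, f, h, hT⟩ := exists_distTriang_fromH0 t X
  have : t.IsGE B (0 + 1) := hB
  exact (ht.levelLT_of_distTriang hN hD hT hX 0).1

theorem extensionHull_of_isLE {m : ℕ} {X : C} (hX : levelLT lev N m X) [t.IsLE X 0] :
    extensionHull (nonnegShifts D {l | lev l < m}) X := by
  obtain ⟨A, B, f, g, h, hT, hA, -, hA', hB⟩ := ht.exists_truncation hN hD hX
  have hA₁ : t.IsLE (A⟦(1 : ℤ)⟧) 0 := by
    have := t.isLE_shift A 0 1 (-1)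
    exact t.isLE_of_le _ (-1) 0
  have hB' : t.IsLE B 0 := t.isLE₂ _ (rot_of_distTriang _ hT) 0 ‹_› hA₁
  have : IsIso f := (Triangle.isZero₃_iff_isIso₁ _ hT).1 (t.isZero B 0 1)
  exact extensionHull_of_iso (asIso f) hA

theorem del_hom_shift_eq_zero {l : Λ} {X : C} (hX : levelLT lev N (lev l + 1) X) [t.IsLE X 0]
    {n : ℤ} (hn : 1 ≤ n) (f : D l ⟶ X⟦n⟧) : f = 0 := by
  have hXn := extensionHull_shift (Q := fun Y => ∀ f : D l ⟶ Y, f = 0) n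
    (P := nonnegShifts D {p | lev p < lev l + 1}) ?_ (ht.extensionHull_of_isLE hN hD hX)
  · exact extensionHull_hom_eq_zero (P := singleton (D l)) (by rintro _ Y ⟨⟨⟩⟩ hY f; exact hY f)
      (le_extensionHull _ _ ⟨⟨⟩⟩) hXn f
  · rintro Y ⟨p, hp, k, hk, ⟨e⟩⟩
    refine .of_mem _ fun f => ?_
    let e' := (shiftFunctor C n).mapIso e ≪≫ (shiftAdd (D p) k n).symm
    rw [← cancel_mono e'.hom, zero_comp]
    obtain ⟨c, hc⟩ := hD.exists_canonical p
    refine (hD.bijective_comp_of_trW (Nat.lt_succ_iff.1 hp) (trW.shift hc (k + n))).1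
      (Eq.trans ?_ zero_comp.symm)
    rw [← cancel_epi (shiftZero ℤ (D l)).hom, comp_zero]
    exact hN.del_hom_nab_eq_zero hD (fun _ => by lia) _

theorem levelLT_of_del_hom_eq_zero {m : ℕ} {X : C} (hX : levelLT lev N (m + 1) X) [t.IsLE X 0]
    [t.IsGE X 0] (h : ∀ l, lev l = m → ∀ f : D l ⟶ X, f = 0) : levelLT lev N m X := by
  refine hD.mem_levelLT_of_del_hom_eq_zero hX fun l hl n f => ?_
  have := ht.del_isLE l
  rcases lt_trichotomy n 0 with hn | rfl | hn
  · have := t.isGE_shift X 0 n (-n)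
    exact t.zero f 0 (-n)
  · rw [← cancel_mono (shiftZero ℤ X).hom, zero_comp]
    exact h l hl _
  · exact ht.del_hom_shift_eq_zero hN hD (by rwa [hl]) hn f

theorem levelLT_of_isTMono {m : ℕ} {M X : C} [t.IsLE M 0] [t.IsGE M 0] {f : M ⟶ X}
    (hf : IsTMono t f) (hX : levelLT lev N m X) : levelLT lev N m M := by
  suffices ∀ k, levelLT lev N (m + k) M → levelLT lev N m M by
    obtain ⟨b, hb⟩ := hN.exists_levelLT M
    exact this b (levelLT_mono lev N (Nat.le_add_left b m) _ hb)
  intro k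
  induction k with
  | zero => exact id
  | succ k ih =>
    refine fun hM => ih (ht.levelLT_of_del_hom_eq_zero hN hD hM fun l hl a => ?_)
    exact hf (ht.del_isLE l) a
      (hD.hom_eq_zero_of_levelEq_of_levelLT (mem_levelEq lev D l)
        (levelLT_mono lev N (by lia) _ hX) _)

end IsFamilyTStructure

end FamilyTStructure

/-! ### Simple heads and socles -/

section HeadSocle

variable {A : Type w} [Category.{v} A] [Abelian A]

attribute [local instance] Abelian.hasFiniteBiproducts

theorem isSemisimpleObj_of_simple (S : A) [h : Simple S] : IsSemisimpleObj S :=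
  ⟨1, fun _ => S, fun _ => h, ⟨(biproductUniqueIso fun _ : Fin 1 => S).symm⟩⟩

theorem isSocle_of_simple {S X : A} (s : S ⟶ X) [Mono s] [Simple S]
    (h : ∀ (S' : A) (s' : S' ⟶ X), Simple S' → ∃ r : S' ⟶ S, r ≫ s = s') : IsSocle s where
  mono := inferInstance
  semisimple := isSemisimpleObj_of_simple S
  factors := by
    rintro S' s' - ⟨n, T, hT, ⟨e⟩⟩
    choose r hr using fun j => h (T j) (biproduct.ι T j ≫ e.inv ≫ s') (hT j)
    refine ⟨e.hom ≫ biproduct.desc r, ?_⟩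
    rw [← cancel_epi e.inv]
    refine biproduct.hom_ext' _ _ fun j => ?_
    simp [hr]

theorem isHead_of_simple {X Q : A} (q : X ⟶ Q) [Epi q] [Simple Q]
    (h : ∀ (Q' : A) (q' : X ⟶ Q'), Simple Q' → ∃ r : Q ⟶ Q', q ≫ r = q') : IsHead q where
  epi := inferInstance
  semisimple := isSemisimpleObj_of_simple Q
  factors := by
    rintro Q' q' - ⟨n, T, hT, ⟨e⟩⟩
    choose r hr using fun j => h (T j) (q' ≫ e.hom ≫ biproduct.π T j) (hT j)
    refine ⟨biproduct.lift r ≫ e.inv, ?_⟩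
    rw [← cancel_mono e.hom]
    refine biproduct.hom_ext _ _ fun j => ?_
    simp [hr]

variable {I X Y Z : A}

theorem simple_of_least_subobject {i : I ⟶ Y} [Mono i] (hi : i ≠ 0)
    (hleast : ∀ (S : A) (s : S ⟶ Y), Mono s → s ≠ 0 → ∃ τ : I ⟶ S, τ ≫ s = i) : Simple I where
  mono_isIso_iff_nonzero {S} s _ := by
    refine ⟨?_, fun hs => ?_⟩
    · rintro hiso rfl
      exact hi (by rw [← cancel_epi (0 : S ⟶ I), zero_comp, zero_comp])
    · obtain ⟨τ, hτ⟩ := hleast S (s ≫ i) inferInstance fun h => hs (zero_of_comp_mono i h)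
      have hτs : τ ≫ s = 𝟙 I := by rw [← cancel_mono i, Category.assoc, hτ, Category.id_comp]
      have : IsSplitEpi s := ⟨⟨⟨τ, hτs⟩⟩⟩
      exact isIso_of_mono_of_isSplitEpi s

theorem simple_of_least_quotient {e : X ⟶ I} [Epi e] (he : e ≠ 0)
    (hleast : ∀ (Q : A) (q : X ⟶ Q), Epi q → q ≠ 0 → ∃ τ : Q ⟶ I, q ≫ τ = e) : Simple I := by
  refine simple_of_cosimple I fun {Q} q _ => ⟨?_, fun hq => ?_⟩
  · rintro hiso rfl
    exact he (by rw [← cancel_mono (0 : I ⟶ Q), comp_zero, comp_zero])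
  · obtain ⟨τ, hτ⟩ := hleast Q (e ≫ q) inferInstance fun h => hq (zero_of_epi_comp e h)
    have hqτ : q ≫ τ = 𝟙 I := by rw [← cancel_epi e, ← Category.assoc, hτ, Category.comp_id]
    have : IsSplitMono q := ⟨⟨⟨τ, hqτ⟩⟩⟩
    exact isIso_of_epi_of_isSplitMono q

theorem hasSimpleSocle_of_least_subobject {i : I ⟶ Y} [Mono i] (hi : i ≠ 0)
    (hleast : ∀ (S : A) (s : S ⟶ Y), Mono s → s ≠ 0 → ∃ τ : I ⟶ S, τ ≫ s = i)
    {r : Z ⟶ Y} [Mono r] (hr : r ≠ 0) : HasSimpleSocle Z I := by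
  have hI := simple_of_least_subobject hi hleast
  obtain ⟨σ, rfl⟩ := hleast Z r inferInstance hr
  have : Mono σ := mono_of_mono σ r
  refine ⟨hI, σ, isSocle_of_simple σ fun S s hS => ?_⟩
  by_cases hs : s = 0
  · exact ⟨0, by rw [hs, zero_comp]⟩
  have : Mono s := mono_of_nonzero_from_simple hs
  obtain ⟨τ, hτ⟩ := hleast S (s ≫ r) inferInstance fun h => hs (zero_of_comp_mono r h)
  have : IsIso τ := isIso_of_hom_simple fun h => hi (by rw [← hτ, h, zero_comp])
  refine ⟨inv τ, ?_⟩
  rw [← cancel_mono r, Category.assoc, ← hτ, IsIso.inv_hom_id_assoc]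

theorem hasSimpleHead_of_least_quotient {e : X ⟶ I} [Epi e] (he : e ≠ 0)
    (hleast : ∀ (Q : A) (q : X ⟶ Q), Epi q → q ≠ 0 → ∃ τ : Q ⟶ I, q ≫ τ = e)
    {q : X ⟶ Z} [Epi q] (hq : q ≠ 0) : HasSimpleHead Z I := by
  have hI := simple_of_least_quotient he hleast
  obtain ⟨ρ, rfl⟩ := hleast Z q inferInstance hq
  have : Epi ρ := epi_of_epi q ρ
  refine ⟨hI, ρ, isHead_of_simple ρ fun S s hS => ?_⟩
  by_cases hs : s = 0
  · exact ⟨0, by rw [hs, comp_zero]⟩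
  have : Epi s := epi_of_nonzero_to_simple hs
  obtain ⟨τ, hτ⟩ := hleast S (q ≫ s) inferInstance fun h => hs (zero_of_epi_comp q h)
  have : IsIso τ := isIso_of_hom_simple fun h => he (by rw [← hτ, h, comp_zero])
  refine ⟨inv τ, ?_⟩
  rw [← cancel_epi q, ← Category.assoc, ← hτ, Category.assoc, Category.assoc, IsIso.hom_inv_id,
    Category.comp_id]

end HeadSocle

/-! ### Images of canonical maps -/

section ImageH0

variable {C : Type w} [Category.{v} C] [Preadditive C] [HasZeroObject C] [HasShift C ℤ]
  [∀ n : ℤ, (shiftFunctor C n).Additive] [Pretriangulated C] [IsTriangulated C] {t : TStructure C}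

theorem exists_H0_factorization {X Y : C} [t.IsLE X 0] [t.IsGE Y 0] {c : X ⟶ Y} {Z : HeartCat t}
    {q : X ⟶ Z.obj} {r : Z.obj ⟶ Y} (hqr : q ≫ r = c) :
    ∃ (q' : (H0 t).obj X ⟶ Z) (r' : Z ⟶ (H0 t).obj Y), toH0 t X ≫ q'.hom = q ∧
      r'.hom ≫ fromH0 t Y = r ∧ q' ≫ r' = (H0 t).map c := by
  obtain ⟨q', hq⟩ := exists_toH0_comp t X q
  obtain ⟨r', hr⟩ := exists_comp_fromH0 t Y r
  refine ⟨ObjectProperty.homMk q', ObjectProperty.homMk r', hq, hr, ?_⟩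
  ext
  refine (isTEpi_toH0 t X).eq_of_comp_eq ((isTMono_fromH0 t Y).eq_of_comp_eq ?_)
  rw [Category.assoc, Category.assoc, toH0_H0_map_fromH0]
  calc toH0 t X ≫ (q' ≫ r') ≫ fromH0 t Y
    _ = (toH0 t X ≫ q') ≫ r' ≫ fromH0 t Y := by simp only [Category.assoc]
    _ = c := by rw [hq, hr, hqr]

theorem nonempty_iso_image_H0 {X Y : C} [t.IsLE X 0] [t.IsGE Y 0] {c : X ⟶ Y} {Z : HeartCat t}
    {q : X ⟶ Z.obj} {r : Z.obj ⟶ Y} (hqr : q ≫ r = c) (hq : IsTEpi t q) (hr : IsTMono t r) :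
    Nonempty (Z ≅ (imageSubobject ((H0 t).map c) : HeartCat t)) := by
  obtain ⟨q', r', rfl, rfl, h⟩ := exists_H0_factorization hqr
  have : Epi q' := hq.of_comp.epi
  have : Mono r' := hr.of_comp.mono
  have : StrongEpi q' := strongEpi_of_epi q'
  exact ⟨image.isoStrongEpiMono q' r' h ≪≫ (imageSubobjectIso _).symm⟩

end ImageH0

section FieldCoefficients

variable {C : Type w} [Category.{v} C] [Preadditive C] [HasZeroObject C] [HasShift C ℤ]
  [∀ n : ℤ, (shiftFunctor C n).Additive] [Pretriangulated C]
variable {Λ : Type x} {lev : Λ → ℕ} {N D : Λ → C} {E : Type u} [Field E] [Linear E C]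

namespace IsExceptionalFamily

variable (hN : IsExceptionalFamily lev N E)
include hN

theorem eq_of_del_hom_ne_zero (hD : IsDualFamily lev N D) {l p : Λ} {f : D p ⟶ N l} (hf : f ≠ 0) :
    p = l := by
  by_contra hpl
  refine hf ?_
  rw [← cancel_mono (shiftZero ℤ (N l)).inv, zero_comp]
  exact hN.del_hom_eq_zero hD hpl 0 _

theorem exists_smul_eq_canonical {l : Λ} {c f : D l ⟶ N l} (hc : (levelLT lev N (lev l)).trW c)
    (hf : f ≠ 0) : ∃ a : E, a • f = c := by
  obtain ⟨a, rfl⟩ := (hN.bijective_smul_canonical hc).2 f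
  have ha : a ≠ 0 := fun ha => hf (by simp [ha])
  exact ⟨a⁻¹, by simp [smul_smul, ha]⟩

theorem canonical_ne_zero {l : Λ} {c : D l ⟶ N l} (hc : (levelLT lev N (lev l)).trW c) : c ≠ 0 := by
  rintro rfl
  exact one_ne_zero ((hN.bijective_smul_canonical hc).1
    (show (1 : E) • (0 : D l ⟶ N l) = (0 : E) • (0 : D l ⟶ N l) by simp))

end IsExceptionalFamily

namespace IsFamilyTStructure

variable [IsTriangulated C] {t : TStructure C} (ht : IsFamilyTStructure E N D t)
  (hN : IsExceptionalFamily lev N E)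
include ht hN

theorem H0_map_canonical_ne_zero {l : Λ} {c : D l ⟶ N l}
    (hc : (levelLT lev N (lev l)).trW c) : (H0 t).map c ≠ 0 := by
  intro h
  have := ht.del_isLE l
  have := ht.nab_isGE l
  refine hN.canonical_ne_zero hc ?_
  have hzero : ((H0 t).map c).hom = 0 := congrArg (·.hom) h
  rw [← toH0_H0_map_fromH0 t c, hzero, zero_comp, comp_zero]

variable (hD : IsDualFamily lev N D) [∀ n : ℤ, (shiftFunctor C n).Linear E]
include hD

theorem exists_del_hom_ne_zero {l : Λ} {S : HeartCat t} (hS : levelLT lev N (lev l + 1) S.obj)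
    {s : S.obj ⟶ N l} (hs : s ≠ 0) : ∃ p, lev p = lev l ∧ ∃ φ : D p ⟶ S.obj, φ ≠ 0 := by
  by_contra! h
  exact hs (hN.levelLT_hom_levelEq (ht.levelLT_of_del_hom_eq_zero hN hD hS h)
    (mem_levelEq lev N l) s)

variable {l : Λ} {c : D l ⟶ N l} (hc : (levelLT lev N (lev l)).trW c)
include hc

theorem exists_comp_eq_H0_map_canonical {S : HeartCat t} (s : S ⟶ (H0 t).obj (N l)) [Mono s]
    (hs : s ≠ 0) : ∃ ψ : (H0 t).obj (D l) ⟶ S, ψ ≫ s = (H0 t).map c := by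
  have := ht.del_isLE l
  have := ht.nab_isGE l
  let s' : S.obj ⟶ N l := s.hom ≫ fromH0 t (N l)
  have hs' : IsTMono t s' := (isTMono_of_mono s).comp (isTMono_fromH0 t _)
  have hs'0 : s' ≠ 0 := fun h => hs (ObjectProperty.hom_ext _
    (isTMono_fromH0 t (N l) inferInstance _ h))
  have hS : levelLT lev N (lev l + 1) S.obj := ht.levelLT_of_isTMono hN hD (isTMono_of_mono s)
    (ht.levelLT_H0_of_isGE hN hD (mem_levelLT lev N (Nat.lt_succ_self _)))
  obtain ⟨p, -, φ, hφ⟩ := ht.exists_del_hom_ne_zero hN hD hS hs'0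
  have hφs : φ ≫ s' ≠ 0 := fun h => hφ (hs' (ht.del_isLE p) _ h)
  obtain rfl := hN.eq_of_del_hom_ne_zero hD hφs
  obtain ⟨a, ha⟩ := hN.exists_smul_eq_canonical hc hφs
  obtain ⟨ψ, r, -, hr, hψ⟩ := exists_H0_factorization (t := t) (q := a • φ) (r := s')
    (by rw [Linear.smul_comp, ha])
  obtain rfl : r = s := ObjectProperty.hom_ext _ ((isTMono_fromH0 t (N p)).eq_of_comp_eq hr)
  exact ⟨ψ, hψ⟩

theorem epi_of_comp_H0_map_canonical_ne_zero {M : HeartCat t} (m : M ⟶ (H0 t).obj (D l)) [Mono m]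
    (hm : m ≫ (H0 t).map c ≠ 0) : Epi m := by
  have := ht.del_isLE l
  have := ht.nab_isGE l
  have hm' : m.hom ≫ ((H0 t).map c).hom ≫ fromH0 t (N l) ≠ 0 := fun h =>
    hm (ObjectProperty.hom_ext _ (isTMono_fromH0 t (N l) inferInstance _ (by simpa using h)))
  have hM : levelLT lev N (lev l + 1) M.obj := ht.levelLT_of_isTMono hN hD (isTMono_of_mono m)
    (ht.levelLT_H0_of_isLE hN hD (hD.del_mem l))
  obtain ⟨p, hp, φ, hφ⟩ := ht.exists_del_hom_ne_zero hN hD hM hm'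
  have := ht.del_isLE p
  obtain ⟨A, hA, f, h, hT⟩ := exists_distTriang_toH0 t (D l)
  have hAl : levelLT lev N (lev p + 1) A := by
    have : t.IsGE ((H0 t).obj (D l)).obj (-1 + 1) := heart_isGE t _
    rw [hp]
    exact (ht.levelLT_of_distTriang hN hD hT (hD.del_mem l) (-1)).1
  have := t.isLE_of_le A (-1) 0
  obtain ⟨b, hb⟩ : ∃ b : D p ⟶ D l, φ ≫ m.hom = b ≫ toH0 t (D l) :=
    Triangle.coyoneda_exact₃ _ hT _ (ht.del_hom_shift_eq_zero hN hD hAl le_rfl _)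
  have hb0 : b ≠ 0 := by
    rintro rfl
    exact hφ (isTMono_of_mono m inferInstance _ (by rw [hb, zero_comp]))
  have hinj := (hD.bijective_comp_of_trW hp.ge hc).1
  have hbc : b ≫ c ≠ 0 := fun h => hb0 (hinj (h.trans zero_comp.symm))
  obtain rfl := hN.eq_of_del_hom_ne_zero hD hbc
  obtain ⟨a, ha⟩ := hN.exists_smul_eq_canonical hc hbc
  have hab : a • b = 𝟙 (D p) := hinj (by simpa using ha)
  refine IsTEpi.epi (IsTEpi.of_comp (f := a • φ) ?_)
  rw [Linear.smul_comp, hb, ← Linear.smul_comp, hab, Category.id_comp]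
  exact isTEpi_toH0 t _

theorem hasSimpleSocle_image_H0 {Z : HeartCat t} {q : D l ⟶ Z.obj} {r : Z.obj ⟶ N l}
    (hqr : q ≫ r = c) (hr : IsTMono t r) :
    HasSimpleSocle Z (imageSubobject ((H0 t).map c) : HeartCat t) := by
  have := ht.del_isLE l
  have := ht.nab_isGE l
  have hc0 := ht.H0_map_canonical_ne_zero hN hc
  obtain ⟨q', r', -, rfl, h⟩ := exists_H0_factorization hqr
  have : Mono r' := hr.of_comp.mono
  refine hasSimpleSocle_of_least_subobject (i := (imageSubobject ((H0 t).map c)).arrow)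
    (fun hi => hc0 (by rw [← imageSubobject_arrow_comp ((H0 t).map c), hi, comp_zero]))
    (fun S s hs hs0 => ?_) (r := r') (fun hr => hc0 (by rw [← h, hr, comp_zero]))
  obtain ⟨ψ, hψ⟩ := ht.exists_comp_eq_H0_map_canonical hN hD hc s hs0
  exact ⟨_, Subobject.ofLEMk_comp (imageSubobject_le_mk s _ ψ hψ)⟩

theorem hasSimpleHead_image_H0 {Z : HeartCat t} {q : D l ⟶ Z.obj} {r : Z.obj ⟶ N l}
    (hqr : q ≫ r = c) (hq : IsTEpi t q) :
    HasSimpleHead Z (imageSubobject ((H0 t).map c) : HeartCat t) := by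
  have := ht.del_isLE l
  have := ht.nab_isGE l
  have hc0 := ht.H0_map_canonical_ne_zero hN hc
  obtain ⟨q', r', rfl, -, h⟩ := exists_H0_factorization hqr
  have : Epi q' := hq.of_comp.epi
  refine hasSimpleHead_of_least_quotient (e := factorThruImageSubobject ((H0 t).map c))
    (fun he => hc0 (by rw [← imageSubobject_arrow_comp ((H0 t).map c), he, zero_comp]))
    (fun Q p hp hp0 => ?_) (q := q') (fun hq => hc0 (by rw [← h, hq, zero_comp]))
  have hker : kernel.ι p ≫ (H0 t).map c = 0 := by
    by_contra hne
    have := ht.epi_of_comp_H0_map_canonical_ne_zero hN hD hc _ hne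
    exact hp0 (zero_of_epi_comp _ (kernel.condition p))
  exact ⟨_, Abelian.comp_epiDesc p _ (by
    rw [← cancel_mono (imageSubobject ((H0 t).map c)).arrow, Category.assoc,
      imageSubobject_arrow_comp, hker, zero_comp])⟩

end IsFamilyTStructure

end FieldCoefficients

/-! ### Torsion and saturation -/

theorem pow_smul_eq_zero_of_irreducible {E : Type u} [CommRing E] [IsDomain E]
    [IsDiscreteValuationRing E] {M : Type v} [AddCommGroup M] [Module E M] {ϖ ϖ' : E}
    (h : Irreducible ϖ) (h' : Irreducible ϖ') {n : ℕ} {x : M} (hx : ϖ' ^ n • x = 0) :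
    ϖ ^ n • x = 0 := by
  obtain ⟨a, ha⟩ := ((IsDiscreteValuationRing.associated_of_irreducible E h' h).pow_pow
    (n := n)).dvd
  rw [ha, mul_comm, mul_smul, hx, smul_zero]

section Saturation

variable {A : Type w} [Category.{v} A] [Abelian A] {E : Type u} [CommRing E] [Linear E A]

theorem smul_id_cokernel_ofLE_eq_zero_iff {Y : A} {L M : Subobject Y} (h : L ≤ M) (a : E) :
    a • 𝟙 (cokernel (Subobject.ofLE L M h)) = 0 ↔ a • (M.arrow ≫ cokernel.π L.arrow) = 0 := by
  constructor
  · intro ha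
    have hd : Subobject.ofLE L M h ≫ M.arrow ≫ cokernel.π L.arrow = 0 := by
      rw [Subobject.ofLE_arrow_assoc, cokernel.condition]
    rw [← cokernel.π_desc _ _ hd, ← Category.id_comp (cokernel.desc _ _ hd), ← Linear.comp_smul,
      ← Linear.smul_comp, ha, zero_comp, comp_zero]
  · intro ha
    have hy : (a • M.arrow) ≫ cokernel.π L.arrow = 0 := by rw [Linear.smul_comp, ha]
    have hlift : Abelian.monoLift L.arrow _ hy ≫ Subobject.ofLE L M h = a • 𝟙 _ := by
      rw [← cancel_mono M.arrow, Category.assoc, Subobject.ofLE_arrow, Abelian.monoLift_comp,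
        Linear.smul_comp, Category.id_comp]
    rw [← cancel_epi (cokernel.π (Subobject.ofLE L M h)), comp_zero, Linear.comp_smul,
      Category.comp_id, ← Category.id_comp (cokernel.π _), ← Linear.smul_comp, ← hlift,
      Category.assoc, cokernel.condition, comp_zero]

/-- The subobjects containing `L` whose quotient by `L` is torsion. For `L = L_i` its greatest
element is the object written `L_i^+` in the paper. -/
def torsionOver (E : Type u) [CommRing E] [Linear E A] {Y : A} (L : Subobject Y) :
    Set (Subobject Y) :=
  {M | ∃ h : L ≤ M, IsTorsionObj E (cokernel (Subobject.ofLE L M h))}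

variable [IsDomain E] [IsDiscreteValuationRing E]

theorem mem_torsionOver_iff {Y : A} {L M : Subobject Y} {ϖ : E} (hϖ : Irreducible ϖ) :
    M ∈ torsionOver E L ↔ L ≤ M ∧ ∃ n : ℕ, ϖ ^ n • (M.arrow ≫ cokernel.π L.arrow) = 0 := by
  constructor
  · rintro ⟨h, ϖ', hϖ', n, -, hn⟩
    exact ⟨h, n, pow_smul_eq_zero_of_irreducible hϖ hϖ'
      ((smul_id_cokernel_ofLE_eq_zero_iff h _).1 hn)⟩
  · rintro ⟨h, n, hn⟩
    refine ⟨h, ϖ, hϖ, n + 1, by lia, (smul_id_cokernel_ofLE_eq_zero_iff h _).2 ?_⟩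
    rw [pow_succ', mul_smul, hn, smul_zero]

variable {Y : A} {L : Subobject Y} {ϖ : E} (hϖ : Irreducible ϖ) {n : ℕ}
  (hn : ∀ (S : A) (f : S ⟶ cokernel L.arrow) (m : ℕ), ϖ ^ m • f = 0 → ϖ ^ n • f = 0)
include hϖ hn

theorem isGreatest_torsionOver :
    IsGreatest (torsionOver E L) (kernelSubobject (ϖ ^ n • cokernel.π L.arrow)) := by
  constructor
  · rw [mem_torsionOver_iff hϖ]
    refine ⟨le_kernelSubobject _ _ (by rw [Linear.comp_smul, cokernel.condition, smul_zero]), n, ?_⟩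
    rw [← Linear.comp_smul, kernelSubobject_arrow_comp]
  · intro M hM
    obtain ⟨-, m, hm⟩ := (mem_torsionOver_iff hϖ).1 hM
    refine le_kernelSubobject _ _ ?_
    rw [Linear.comp_smul]
    exact hn _ _ m hm

theorem eq_zero_of_smul_eq_zero_of_isGreatest {M : Subobject Y}
    (hM : IsGreatest (torsionOver E L) M) {S : A} {f : S ⟶ cokernel M.arrow} (hf : ϖ • f = 0) :
    f = 0 := by
  obtain ⟨S', p, _, x, hx⟩ := surjective_up_to_refinements_of_epi (cokernel.π M.arrow) f
  obtain ⟨-, m, hm⟩ := (mem_torsionOver_iff hϖ).1 hM.1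
  have hxM : (ϖ • x) ≫ cokernel.π M.arrow = 0 := by
    rw [Linear.smul_comp, ← hx, ← Linear.comp_smul, hf, comp_zero]
  have hxL : ϖ ^ (m + 1) • (x ≫ cokernel.π L.arrow) = 0 := by
    rw [pow_succ, mul_smul, ← Linear.smul_comp, ← Abelian.monoLift_comp M.arrow _ hxM,
      Category.assoc, ← Linear.comp_smul, hm, comp_zero]
  have hxn : x ≫ (ϖ ^ n • cokernel.π L.arrow) = 0 := by
    rw [Linear.comp_smul, hn _ _ _ hxL]
  obtain ⟨y, rfl⟩ : ∃ y : S' ⟶ (M : A), y ≫ M.arrow = x :=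
    ⟨factorThruKernelSubobject _ x hxn ≫
      Subobject.ofLE _ M (hM.2 (isGreatest_torsionOver hϖ hn).1), by simp⟩
  rw [← cancel_epi p, hx, Category.assoc, cokernel.condition, comp_zero, comp_zero]

end Saturation

namespace IsFamilyTStructure

variable {C : Type w} [Category.{v} C] [Preadditive C] [HasZeroObject C] [HasShift C ℤ]
  [∀ n : ℤ, (shiftFunctor C n).Additive] [Pretriangulated C] [IsTriangulated C]
variable {Λ : Type x} {N D : Λ → C} {E : Type u} [CommRing E] [IsDomain E] [Linear E C]
  {t : TStructure C}
variable (ht : IsFamilyTStructure E N D t)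
include ht

theorem hom_nab_eq_zero_of_smul_eq_zero [IsPrincipalIdealRing E] {S : C} [hS : t.IsLE S 0] {l : Λ}
    {a : E} (ha : a ≠ 0) {f : S ⟶ N l} (hf : a • f = 0) : f = 0 := by
  obtain ⟨Z, g, h, hT⟩ := distinguished_cocone_triangle (a • 𝟙 (N l))
  have : t.IsGE Z 0 := by
    rw [ht.isGE_iff]
    refine extensionHull_mono (fun X hX => ?_) Z (extensionHull_irreducibleCone ha hT)
    exact ⟨l, trivial, X, 0, Or.inr hX, le_rfl, ⟨(shiftZero ℤ X).symm⟩⟩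
  exact IsTMono.of_distTriang (t := t) hT hS f (by simpa using hf)

theorem hom_subobject_eq_zero_of_smul_eq_zero [IsPrincipalIdealRing E] {l : Λ} [t.IsGE (N l) 0]
    (M : Subobject ((H0 t).obj (N l))) {a : E} (ha : a ≠ 0) {S : C} [hS : t.IsLE S 0]
    {f : S ⟶ (M : HeartCat t).obj} (hf : a • f = 0) : f = 0 := by
  refine ((isTMono_of_mono M.arrow).comp (isTMono_fromH0 t (N l))) hS _ ?_
  exact ht.hom_nab_eq_zero_of_smul_eq_zero ha (by rw [← Linear.smul_comp, hf, zero_comp])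

variable [∀ n : ℤ, (shiftFunctor C n).Linear E]

theorem hom_nab_shift_eq_zero_of_smul_eq_zero [IsPrincipalIdealRing E] {S : C} [t.IsLE S 0]
    {l : Λ} {a : E} (ha : a ≠ 0) {k : ℤ} (hk : k ≤ 0) {f : S ⟶ (N l)⟦k⟧} (hf : a • f = 0) :
    f = 0 := by
  have : t.IsLE (S⟦-k⟧) 0 := by
    have := t.isLE_shift S 0 (-k) k
    exact t.isLE_of_le _ k 0
  let e : ((N l)⟦k⟧)⟦-k⟧ ≅ N l := shiftShiftNeg (N l) k
  have h : f⟦-k⟧' ≫ e.hom = 0 := by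
    refine ht.hom_nab_eq_zero_of_smul_eq_zero ha ?_
    rw [← Linear.smul_comp, ← Functor.map_smul, hf, Functor.map_zero, zero_comp]
  refine (shiftFunctor C (-k)).map_injective ?_
  rw [← cancel_mono e.hom, h, Functor.map_zero, zero_comp]

variable [IsDiscreteValuationRing E]

theorem exists_torsion_bound {ϖ : E} (hϖ : Irreducible ϖ) (Q : C) [hQ : t.IsGE Q 0] :
    ∃ n : ℕ, ∀ S : C, t.IsLE S 0 → ∀ (f : S ⟶ Q) (m : ℕ), ϖ ^ m • f = 0 → ϖ ^ n • f = 0 := by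
  rw [ht.isGE_iff] at hQ
  induction hQ with
  | of_mem X hX =>
    obtain ⟨l, -, Z, k, rfl | ⟨ϖ', g, h, hϖ', hT⟩, hk, ⟨e⟩⟩ := hX
    · refine ⟨0, fun S _ f m hf => ?_⟩
      have hfe : f ≫ e.hom = 0 :=
        ht.hom_nab_shift_eq_zero_of_smul_eq_zero (pow_ne_zero m hϖ.ne_zero) hk
          (by rw [← Linear.smul_comp, hf, zero_comp])
      rw [← cancel_mono e.hom, Linear.smul_comp, hfe, smul_zero, zero_comp]
    · refine ⟨2, fun S _ f m _ => ?_⟩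
      have hZ : ϖ ^ 2 • 𝟙 Z = 0 := pow_smul_eq_zero_of_irreducible hϖ hϖ' (sq_smul_id_cone_smul hT)
      have hZk : ϖ ^ 2 • 𝟙 (Z⟦k⟧) = 0 := by
        rw [← CategoryTheory.Functor.map_id, ← Functor.map_smul, hZ, Functor.map_zero]
      rw [← cancel_mono e.hom, zero_comp, Linear.smul_comp, ← Category.comp_id (f ≫ e.hom),
        ← Linear.comp_smul, hZk, comp_zero]
  | of_isZero X hX => exact ⟨0, fun _ _ _ _ _ => hX.eq_of_tgt _ _⟩
  | ext T hT _ h₃ ih₁ ih₃ =>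
    obtain ⟨n₁, hn₁⟩ := ih₁
    obtain ⟨n₃, hn₃⟩ := ih₃
    have : t.IsGE T.obj₃ 0 := (ht.isGE_iff _).2 h₃
    refine ⟨n₁ + n₃, fun S hS f m hf => ?_⟩
    have hf₃ : (ϖ ^ n₃ • f) ≫ T.mor₂ = 0 := by
      rw [Linear.smul_comp]
      exact hn₃ S hS _ m (by rw [← Linear.smul_comp, hf, zero_comp])
    obtain ⟨b, hb⟩ := Triangle.coyoneda_exact₂ _ hT _ hf₃
    have hbm : ϖ ^ m • b = 0 := IsTMono.of_distTriang (t := t) hT hS _ (by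
      rw [Linear.smul_comp, ← hb, smul_comm, hf, smul_zero])
    rw [pow_add, mul_smul, hb, ← Linear.smul_comp, hn₁ S hS b m hbm, zero_comp]

theorem exists_heart_torsion_bound {ϖ : E} (hϖ : Irreducible ϖ) (Q : HeartCat t) :
    ∃ n : ℕ, ∀ (S : HeartCat t) (f : S ⟶ Q) (m : ℕ), ϖ ^ m • f = 0 → ϖ ^ n • f = 0 := by
  obtain ⟨n, hn⟩ := ht.exists_torsion_bound hϖ Q.obj
  exact ⟨n, fun S f m hf => ObjectProperty.hom_ext _
    (hn S.obj inferInstance f.hom m (congrArg (·.hom) hf))⟩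

theorem exists_isGreatest_torsionOver {Y : HeartCat t} (L : Subobject Y) :
    ∃ M, IsGreatest (torsionOver E L) M := by
  obtain ⟨ϖ, hϖ⟩ := IsDiscreteValuationRing.exists_irreducible E
  obtain ⟨n, hn⟩ := ht.exists_heart_torsion_bound hϖ (cokernel L.arrow)
  exact ⟨_, isGreatest_torsionOver hϖ hn⟩

theorem hom_cokernel_eq_zero_of_smul_eq_zero {Y : HeartCat t} {L M : Subobject Y}
    (hM : IsGreatest (torsionOver E L) M) {ϖ : E} (hϖ : Irreducible ϖ) {S : C} [t.IsLE S 0]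
    {f : S ⟶ (cokernel M.arrow).obj} (hf : ϖ • f = 0) : f = 0 := by
  obtain ⟨n, hn⟩ := ht.exists_heart_torsion_bound hϖ (cokernel L.arrow)
  obtain ⟨g, rfl⟩ := exists_toH0_comp t S f
  let g' : (H0 t).obj S ⟶ cokernel M.arrow := ObjectProperty.homMk g
  have hg : ϖ • g' = 0 := ObjectProperty.hom_ext _
    (isTEpi_toH0 t S inferInstance (ϖ • g) (by rw [Linear.comp_smul, hf]))
  have hg0 : g = 0 :=
    congrArg (·.hom) (eq_zero_of_smul_eq_zero_of_isGreatest hϖ hn hM hg)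
  rw [hg0, comp_zero]

end IsFamilyTStructure

/-! ### Triangulated functors -/

section TriangulatedFunctor

variable {C : Type w} [Category.{v} C] [Preadditive C] [HasZeroObject C] [HasShift C ℤ]
  [∀ n : ℤ, (shiftFunctor C n).Additive] [Pretriangulated C]
variable {C' : Type w'} [Category.{v'} C'] [Preadditive C'] [HasZeroObject C'] [HasShift C' ℤ]
  [∀ n : ℤ, (shiftFunctor C' n).Additive] [Pretriangulated C']
variable (G : C ⥤ C') [G.CommShift ℤ] [G.IsTriangulated]
variable {Λ : Type x} {lev : Λ → ℕ} {N D : Λ → C} {N' D' : Λ → C'}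

theorem exists_map_distTriang {X Y Z : C} {f : X ⟶ Y} {g : Y ⟶ Z} {h : Z ⟶ X⟦(1 : ℤ)⟧}
    (hT : Triangle.mk f g h ∈ distTriang C) :
    ∃ δ, Triangle.mk (G.map f) (G.map g) δ ∈ distTriang C' :=
  ⟨_, G.map_distinguished _ hT⟩

theorem triangulatedHull_map {P : ObjectProperty C} {Q : ObjectProperty C'} [Q.IsTriangulated]
    [Q.IsClosedUnderIsomorphisms] (h : ∀ X, P X → Q (G.obj X)) {X : C}
    (hX : triangulatedHull P X) : Q (G.obj X) := by
  have : (Q.inverseImage G).IsTriangulated :=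
    { exists_zero := ⟨0, isZero_zero C, Q.prop_of_isZero (Functor.map_isZero _ (isZero_zero C))⟩
      isStableUnderShiftBy := fun a => ⟨fun X hX =>
        Q.prop_of_iso ((G.commShiftIso a).app X).symm (Q.le_shift a _ hX)⟩
      toIsTriangulatedClosed₂ := .mk' fun T hT h₁ h₃ =>
        Q.ext_of_isTriangulatedClosed₂ _ (G.map_distinguished T hT) h₁ h₃ }
  exact triangulatedHull_le (Q := Q.inverseImage G) h X hX

variable (eN : ∀ l, G.obj (N l) ≅ N' l) (eD : ∀ l, G.obj (D l) ≅ D' l)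

include eN in
theorem levelLT_map {m : ℕ} {X : C} (hX : levelLT lev N m X) : levelLT lev N' m (G.obj X) := by
  refine triangulatedHull_map G ?_ hX
  rintro _ ⟨l, hl, rfl⟩
  exact (levelLT lev N' m).prop_of_iso (eN l).symm (mem_levelLT lev N' hl)

theorem trW_homCongr_map {l : Λ} {c : D l ⟶ N l} (hc : (levelLT lev N (lev l)).trW c) :
    (levelLT lev N' (lev l)).trW ((eD l).homCongr (eN l) (G.map c)) := by
  obtain ⟨Z, g, h, hT, hZ⟩ := hc
  obtain ⟨δ, hT'⟩ := exists_map_distTriang G hT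
  refine ⟨G.obj Z, (eN l).inv ≫ G.map g, δ ≫ (eD l).hom⟦(1 : ℤ)⟧',
    distinguished_of_isos hT' (eD l).symm (eN l).symm (Iso.refl _) (by simp) (by simp) ?_,
    levelLT_map G eN hZ⟩
  rw [Category.assoc, ← Functor.map_comp]
  simp

include eN eD in
theorem isDualFamily_map (hD : IsDualFamily lev N D)
    (h : ∀ X Y : C, (∀ (n : ℤ) (f : X ⟶ Y⟦n⟧), f = 0) → ∀ f : G.obj X ⟶ G.obj Y, f = 0) :
    IsDualFamily lev N' D' where
  hom_lt l m hlm n f := by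
    let e : G.obj ((N m)⟦n⟧) ≅ (N' m)⟦n⟧ :=
      (G.commShiftIso n).app (N m) ≪≫ (shiftFunctor C' n).mapIso (eN m)
    rw [← cancel_epi (eD l).hom, ← cancel_mono e.inv, comp_zero, zero_comp]
    refine h _ _ (fun k g => ?_) _
    rw [← cancel_mono (shiftAdd (N m) n k).inv, zero_comp]
    exact hD.hom_lt l m hlm _ _
  exists_canonical l := by
    obtain ⟨c, hc⟩ := hD.exists_canonical l
    exact ⟨_, trW_homCongr_map G eN eD hc⟩

variable {O : Type u} [CommRing O] [Linear O C] {k : Type u'} [Field k] [Linear k C']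
  {t : TStructure C} {t' : TStructure C'}
variable (ht : IsFamilyTStructure O N D t) (ht' : IsFamilyTStructure k N' D' t')

section RightExact

include ht ht' eD

theorem isLE_map (X : C) [hX : t.IsLE X 0] : t'.IsLE (G.obj X) 0 := by
  rw [ht.isLE_iff] at hX
  rw [ht'.isLE_iff]
  refine extensionHull_map G ?_ hX
  rintro X ⟨l, -, n, hn, ⟨e⟩⟩
  exact .of_mem _ ⟨l, trivial, n, hn, ⟨G.mapIso e ≪≫ (G.commShiftIso n).app (D l) ≪≫
    (shiftFunctor C' n).mapIso (eD l)⟩⟩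

variable [IsTriangulated C]

theorem isTEpi_map_toH0 (X : C) [t.IsLE X 0] : IsTEpi t' (G.map (toH0 t X)) := by
  obtain ⟨A, hA, f, h, hT⟩ := exists_distTriang_toH0 t X
  obtain ⟨δ, hT'⟩ := exists_map_distTriang G hT
  have := t.isLE_of_le A (-1) 0
  have := isLE_map G eD ht ht' A
  exact .of_distTriang hT'

theorem isTEpi_map_of_epi {X Y : HeartCat t} (f : X ⟶ Y) [Epi f] : IsTEpi t' (G.map f.hom) := by
  obtain ⟨K, i, δ, hT⟩ := exists_distTriang_of_epi f
  obtain ⟨δ', hT'⟩ := exists_map_distTriang G hT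
  have := isLE_map G eD ht ht' K.obj
  exact .of_distTriang hT'

end RightExact

include ht ht' eN in
theorem isGE_map {b : ℤ} (hb : 0 ≤ b)
    (h : ∀ l Z, IsIrreducibleCone O (N l) Z → t'.IsGE (G.obj Z) (-b)) (X : C) [hX : t.IsGE X 0] :
    t'.IsGE (G.obj X) (-b) := by
  rw [ht.isGE_iff] at hX
  induction hX with
  | of_mem X hX =>
    obtain ⟨l, -, Z, n, hZ, hn, ⟨e⟩⟩ := hX
    have hGZ : t'.IsGE (G.obj Z) (-b) := by
      rcases hZ with rfl | hZ
      · have := ht'.nab_isGE l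
        have := t'.isGE_of_iso (eN l).symm 0
        exact t'.isGE_of_ge _ (-b) 0
      · exact h l Z hZ
    have : t'.IsGE ((G ⋙ shiftFunctor C' n).obj Z) (-b - n) :=
      t'.isGE_shift (G.obj Z) (-b) n (-b - n)
    have := t'.isGE_of_iso (G.mapIso e ≪≫ (G.commShiftIso n).app Z).symm (-b - n)
    exact t'.isGE_of_ge _ (-b) (-b - n)
  | of_isZero X hX =>
    exact t'.isGE_of_iso (Functor.map_isZero G hX).isoZero.symm (-b)
  | ext T hT _ _ h₁ h₃ => exact t'.isGE₂ _ (G.map_distinguished T hT) _ h₁ h₃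

theorem isTMono_map_of_mono [IsTriangulated C] {X Y : HeartCat t} (f : X ⟶ Y) [Mono f]
    [t'.IsGE (G.obj (cokernel f).obj) 0] : IsTMono t' (G.map f.hom) := by
  obtain ⟨δ, hT⟩ := exists_distTriang_of_mono f
  obtain ⟨δ', hT'⟩ := exists_map_distTriang G hT
  exact .of_distTriang hT'

theorem isTMono_map_fromH0 [IsTriangulated C] (X : C) [t.IsGE X 0]
    (h : ∀ Y : C, t.IsGE Y 1 → t'.IsGE (G.obj Y) 0) : IsTMono t' (G.map (fromH0 t X)) := by
  obtain ⟨B, hB, g, δ, hT⟩ := exists_distTriang_fromH0 t X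
  obtain ⟨δ', hT'⟩ := exists_map_distTriang G hT
  have := h B hB
  exact .of_distTriang hT'

include eN eD in
theorem exists_map_factorization (hN' : IsExceptionalFamily lev N' k) {l : Λ}
    {c : D l ⟶ N l} (hc : (levelLT lev N (lev l)).trW c) {c' : D' l ⟶ N' l}
    (hc' : (levelLT lev N' (lev l)).trW c') {Z : C} {q : D l ⟶ Z} {r : Z ⟶ N l} (hqr : q ≫ r = c) :
    ∃ (q' : D' l ⟶ G.obj Z) (r' : G.obj Z ⟶ N' l), q' ≫ r' = c' ∧
      (IsTEpi t' (G.map q) → IsTEpi t' q') ∧ (IsTMono t' (G.map r) → IsTMono t' r') := by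
  obtain ⟨a, rfl⟩ := hN'.exists_smul_eq_canonical hc'
    (hN'.canonical_ne_zero (trW_homCongr_map G eN eD hc))
  have ha : a ≠ 0 := fun ha => hN'.canonical_ne_zero hc' (by rw [ha, zero_smul])
  have : IsIso (a • 𝟙 (N' l)) := ⟨a⁻¹ • 𝟙 _, by simp [smul_smul, ha], by simp [smul_smul, ha]⟩
  refine ⟨(eD l).inv ≫ G.map q, G.map r ≫ (eN l).hom ≫ (a • 𝟙 _), ?_,
    fun h => (IsTEpi.of_epi _).comp h, fun h => h.comp (IsTMono.of_mono _)⟩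
  rw [← hqr]
  simp

end TriangulatedFunctor

section GenericFunctor

variable {C : Type w} [Category.{v} C] [Preadditive C] [HasZeroObject C] [HasShift C ℤ]
  [∀ n : ℤ, (shiftFunctor C n).Additive] [Pretriangulated C]
variable {C' : Type w'} [Category.{v'} C'] [Preadditive C'] [HasZeroObject C'] [HasShift C' ℤ]
  [∀ n : ℤ, (shiftFunctor C' n).Additive] [Pretriangulated C']
variable (G : C ⥤ C') [G.CommShift ℤ] [G.IsTriangulated]
variable {O : Type u} [CommRing O] [Linear O C] {k : Type u'} [Field k] [Algebra O k] [Linear k C']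

theorem IsGenericFunctor.hom_eq_zero {C : Type w} [Category.{v} C] [Preadditive C] [Linear O C]
    {C' : Type w'} [Category.{v'} C'] [Preadditive C'] [Linear k C'] {G : C ⥤ C'} [G.Additive]
    (hG : IsGenericFunctor O k G) {X Y : C} (h : ∀ f : X ⟶ Y, f = 0)
    (f : G.obj X ⟶ G.obj Y) : f = 0 := by
  have : Subsingleton (X ⟶ Y) := ⟨fun a b => (h a).trans (h b).symm⟩
  obtain ⟨x, rfl⟩ := (hG.bijective X Y).2 f
  rw [Subsingleton.elim x 0, map_zero]

theorem isZero_map_of_smul_id_eq_zero (hG : IsSemilinear O k G) {X : C} {a : O}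
    (ha : algebraMap O k a ≠ 0) (h : a • 𝟙 X = 0) : IsZero (G.obj X) := by
  rw [IsZero.iff_id_eq_zero]
  have := hG X X a (𝟙 X)
  rw [h, Functor.map_zero, CategoryTheory.Functor.map_id] at this
  exact (smul_eq_zero_iff_right ha).1 this.symm

theorem nonempty_iso_map_of_smul_cokernel_ofLE_eq_zero [IsTriangulated C] {t : TStructure C}
    (hG : IsSemilinear O k G) {Y : HeartCat t} {L M : Subobject Y} (h : L ≤ M) {a : O}
    (ha : algebraMap O k a ≠ 0) (h' : a • 𝟙 (cokernel (Subobject.ofLE L M h)) = 0) :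
    Nonempty (G.obj (L : HeartCat t).obj ≅ G.obj (M : HeartCat t).obj) := by
  obtain ⟨δ, hT⟩ := exists_distTriang_of_mono (Subobject.ofLE L M h)
  obtain ⟨δ', hT'⟩ := exists_map_distTriang G hT
  have : IsIso (G.map (Subobject.ofLE L M h).hom) := (Triangle.isZero₃_iff_isIso₁ _ hT').1
    (isZero_map_of_smul_id_eq_zero G hG ha (congrArg (·.hom) h'))
  exact ⟨asIso (G.map (Subobject.ofLE L M h).hom)⟩

variable {t' : TStructure C'} {X Z : C} (hZ : IsIrreducibleCone O X Z)
include hZ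

theorem isZero_map_irreducibleCone [FaithfulSMul O k]
    [∀ n : ℤ, (shiftFunctor C n).Linear O] (hG : IsSemilinear O k G) : IsZero (G.obj Z) := by
  obtain ⟨ϖ, g, h, hϖ, hT⟩ := hZ
  exact isZero_map_of_smul_id_eq_zero G hG (a := ϖ ^ 2) (by simpa using hϖ.ne_zero)
    (sq_smul_id_cone_smul hT)

theorem isGE_map_irreducibleCone [t'.IsGE (G.obj X) 0] : t'.IsGE (G.obj Z) (-1) := by
  obtain ⟨ϖ, g, h, -, hT⟩ := hZ
  have := t'.isGE_of_ge (G.obj X) (-1) 0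
  have h₁ : t'.IsGE ((G ⋙ shiftFunctor C' (1 : ℤ)).obj X) (-1) :=
    t'.isGE_shift (G.obj X) 0 1 (-1)
  have h₂ := t'.isGE_of_iso ((G.commShiftIso (1 : ℤ)).app X).symm (-1)
  exact t'.isGE₂ _ (G.map_distinguished _ (rot_of_distTriang _ hT)) (-1) this h₂

end GenericFunctor

section ResidueFunctor

theorem isTorsionFree_of_irreducible {O : Type u} [CommRing O] [IsDomain O]
    [IsDiscreteValuationRing O] {M : Type v} [AddCommGroup M] [Module O M] {ϖ : O}
    (hϖ : Irreducible ϖ) (h : ∀ x : M, ϖ • x = 0 → x = 0) : Module.IsTorsionFree O M := by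
  have hpow (n : ℕ) (x : M) (hx : ϖ ^ n • x = 0) : x = 0 := by
    induction n generalizing x with
    | zero => simpa using hx
    | succ n ih =>
      rw [pow_succ, mul_smul] at hx
      exact h x (ih _ hx)
  refine .of_smul_eq_zero fun a x hax => or_iff_not_imp_left.2 fun ha => ?_
  obtain ⟨n, hn⟩ := IsDiscreteValuationRing.associated_pow_irreducible ha hϖ
  obtain ⟨b, hb⟩ := hn.dvd
  exact hpow n x (by rw [hb, mul_comm, mul_smul, hax, smul_zero])

variable {O : Type u} [CommRing O] [IsDomain O] [IsPrincipalIdealRing O]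

theorem subsingleton_Tor1 (k : Type u) [CommRing k] [Algebra O k] (M : Type u) [AddCommGroup M]
    [Module O M] [Module.Finite O M] [Module.IsTorsionFree O M] :
    Subsingleton ((Tor1 O k).obj (ModuleCat.of O M)) :=
  ModuleCat.subsingleton_of_isZero (isZero_Tor_succ_of_projective _ _ _ 0)

namespace ResidueFunctorData

variable {C : Type w} [Category.{u} C] [Preadditive C] [HasShift C ℤ] [Linear O C]
variable {C' : Type w'} [Category.{v'} C'] [Preadditive C']

theorem hom_eq_zero {k : Type u} [CommRing k] [Algebra O k] [Linear k C'] {G : C ⥤ C'} [G.Additive]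
    (R : ResidueFunctorData O k G) {X Y : C} (h : ∀ f : X ⟶ Y, f = 0)
    [Module.Finite O (X ⟶ Y⟦(1 : ℤ)⟧)] [Module.IsTorsionFree O (X ⟶ Y⟦(1 : ℤ)⟧)]
    (f : G.obj X ⟶ G.obj Y) : f = 0 := by
  have : Subsingleton (X ⟶ Y) := ⟨fun a b => (h a).trans (h b).symm⟩
  have := subsingleton_Tor1 (O := O) k (X ⟶ Y⟦(1 : ℤ)⟧)
  obtain ⟨x, rfl⟩ := (R.exact X Y f).1 (Subsingleton.elim _ _)
  rw [Subsingleton.elim x 0, map_zero]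

variable [HasZeroObject C] [∀ n : ℤ, (shiftFunctor C n).Additive] [Pretriangulated C]
variable [HasZeroObject C'] [HasShift C' ℤ] [∀ n : ℤ, (shiftFunctor C' n).Additive]
  [Pretriangulated C']
variable {k : Type u} [Field k] [Algebra O k] [Linear k C'] {G : C ⥤ C'} [G.CommShift ℤ]
  [G.IsTriangulated] {Λ : Type x} {N D : Λ → C} {N' D' : Λ → C'}
  {t : TStructure C} {t' : TStructure C'} [∀ n : ℤ, (shiftFunctor C n).Linear O]

/- `G` is only right exact in general. The vanishing of `Tor_1` on `Hom(S, X)`, for `S` in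
`T^{≤ 0}`, is what prevents the cohomology of `G(X)` from spreading to degree `-1`. -/
theorem isGE_map (R : ResidueFunctorData O k G) (eD : ∀ l, G.obj (D l) ≅ D' l)
    (ht : IsFamilyTStructure O N D t) (ht' : IsFamilyTStructure k N' D' t')
    (hfin : ∀ X Y : C, Module.Finite O (X ⟶ Y)) {X : C} [t.IsGE X 0]
    (hX : ∀ S : C, t.IsLE S 0 → Module.IsTorsionFree O (S ⟶ X)) : t'.IsGE (G.obj X) 0 := by
  rw [ht'.isGE_iff_del_hom_eq_zero]
  intro l n hn f
  let e : G.obj ((D l)⟦n⟧) ≅ (D' l)⟦n⟧ :=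
    (G.commShiftIso n).app (D l) ≪≫ (shiftFunctor C' n).mapIso (eD l)
  rw [← cancel_epi e.hom, comp_zero]
  have := ht.del_isLE l
  have := t.isLE_shift (D l) 0 n (-n)
  have hS : t.IsLE ((D l)⟦n - 1⟧) 0 := by
    have := t.isLE_shift (D l) 0 (n - 1) (1 - n)
    exact t.isLE_of_le _ (1 - n) 0
  have := hX _ hS
  let e' : (D l)⟦n⟧ ≅ ((D l)⟦n - 1⟧)⟦(1 : ℤ)⟧ :=
    (shiftFunctorAdd' C (n - 1) 1 n (by lia)).app (D l)
  have : Module.IsTorsionFree O ((D l)⟦n⟧ ⟶ X⟦(1 : ℤ)⟧) :=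
    .of_smul_eq_zero fun a g hag => or_iff_not_imp_left.2 fun ha => by
      obtain ⟨g', hg'⟩ := (shiftFunctor C (1 : ℤ)).map_surjective (e'.inv ≫ g)
      have : a • g' = 0 := (shiftFunctor C (1 : ℤ)).map_injective (by
        rw [Functor.map_smul, hg', ← Linear.comp_smul, hag, comp_zero, Functor.map_zero])
      rw [← cancel_epi e'.inv, ← hg', (smul_eq_zero_iff_right ha).1 this, Functor.map_zero,
        comp_zero]
  have := hfin ((D l)⟦n⟧) (X⟦(1 : ℤ)⟧)
  exact R.hom_eq_zero (fun f => t.zero f (-n) 0) _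

end ResidueFunctorData

end ResidueFunctor

/-! ### Tate twists -/

/-- An `E`-linear endofunctor that is triangulated for a suitable choice of compatibilities with the
shifts. The choice is existential so that the notion passes to quasi-inverses and to powers. -/
def IsLinearTriangulated {C : Type w} [Category.{v} C] [Preadditive C] [HasZeroObject C]
    [HasShift C ℤ] [∀ n : ℤ, (shiftFunctor C n).Additive] [Pretriangulated C] (E : Type u)
    [CommRing E] [Linear E C] (F : C ⥤ C) : Prop :=
  (∃ _ : F.CommShift ℤ, F.IsTriangulated) ∧ F.Linear E

section Twist

variable {E : Type u} [CommRing E]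
variable {C : Type w} [Category.{v} C] [Preadditive C] [Linear E C] [HasZeroObject C]
  [HasShift C ℤ] [∀ n : ℤ, (shiftFunctor C n).Additive] [Pretriangulated C]

namespace IsLinearTriangulated

theorem id : IsLinearTriangulated E (𝟭 C) :=
  ⟨⟨inferInstance, inferInstance⟩, inferInstance⟩

theorem comp {F F' : C ⥤ C} (h : IsLinearTriangulated E F) (h' : IsLinearTriangulated E F') :
    IsLinearTriangulated E (F ⋙ F') := by
  obtain ⟨⟨_, _⟩, _⟩ := h
  obtain ⟨⟨_, _⟩, _⟩ := h'
  exact ⟨⟨inferInstance, inferInstance⟩, inferInstance⟩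

theorem inverse {e : C ≌ C} (h : IsLinearTriangulated E e.functor) :
    IsLinearTriangulated E e.inverse := by
  obtain ⟨⟨_, _⟩, _⟩ := h
  let := e.commShiftInverse ℤ
  have := e.commShift_of_functor ℤ
  have := Equivalence.IsTriangulated.mk' e inferInstance
  exact ⟨⟨inferInstance, this.rightAdjoint_isTriangulated⟩, inferInstance⟩

theorem powNat {e : C ≌ C} (h : IsLinearTriangulated E e.functor) :
    ∀ n : ℕ, IsLinearTriangulated E (e.powNat n).functor
  | 0 => .id
  | 1 => h
  | n + 2 => h.comp (powNat h (n + 1))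

end IsLinearTriangulated

namespace TateTwist

variable (τ : TateTwist E C)

theorem isLinearTriangulated_twist (k : ℤ) : IsLinearTriangulated E (τ.twist k) := by
  have h : IsLinearTriangulated E τ.equiv.functor := ⟨⟨τ.commShift, τ.isTriangulated⟩, τ.linear⟩
  cases k with
  | ofNat n => exact h.powNat n
  | negSucc n => exact IsLinearTriangulated.powNat (e := τ.equiv.symm) h.inverse (n + 1)

/-- A choice of the compatibility of the Tate twists with the shifts. -/
noncomputable instance twistCommShift (k : ℤ) : (τ.twist k).CommShift ℤ :=
  (τ.isLinearTriangulated_twist k).1.choose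

instance twist_isTriangulated (k : ℤ) : (τ.twist k).IsTriangulated :=
  (τ.isLinearTriangulated_twist k).1.choose_spec

instance twist_linear (k : ℤ) : (τ.twist k).Linear E := (τ.isLinearTriangulated_twist k).2

instance twist_isEquivalence (k : ℤ) : (τ.twist k).IsEquivalence :=
  inferInstanceAs (τ.equiv ^ k).functor.IsEquivalence

theorem nonempty_twist_succ (k : ℤ) (X : C) :
    Nonempty ((τ.twist k).obj (τ.equiv.functor.obj X) ≅ (τ.twist (k + 1)).obj X) := by
  match k with
  | Int.ofNat 0 => exact ⟨Iso.refl _⟩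
  | Int.ofNat (n + 1) => exact ⟨Iso.refl _⟩
  | Int.negSucc 0 => exact ⟨(τ.equiv.unitIso.app X).symm⟩
  | Int.negSucc (n + 1) =>
    exact ⟨(τ.equiv.symm.powNat (n + 1)).functor.mapIso (τ.equiv.unitIso.app X).symm⟩

theorem nonempty_twist_pred (k : ℤ) (X : C) :
    Nonempty ((τ.twist k).obj (τ.equiv.inverse.obj X) ≅ (τ.twist (k - 1)).obj X) := by
  obtain ⟨e⟩ := τ.nonempty_twist_succ (k - 1) (τ.equiv.inverse.obj X)
  rw [sub_add_cancel] at e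
  exact ⟨e.symm ≪≫ (τ.twist (k - 1)).mapIso (τ.equiv.counitIso.app X)⟩

theorem nonempty_twist_twist (a b c : ℤ) (h : a + b = c) (X : C) :
    Nonempty ((τ.twist a).obj ((τ.twist b).obj X) ≅ (τ.twist c).obj X) := by
  subst h
  induction b using Int.induction_on generalizing X with
  | zero =>
    rw [add_zero]
    exact ⟨Iso.refl _⟩
  | succ b ih =>
    obtain ⟨e₁⟩ := τ.nonempty_twist_succ b X
    obtain ⟨e₂⟩ := ih (τ.equiv.functor.obj X)
    obtain ⟨e₃⟩ := τ.nonempty_twist_succ (a + b) X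
    rw [add_assoc] at e₃
    exact ⟨(τ.twist a).mapIso e₁.symm ≪≫ e₂ ≪≫ e₃⟩
  | pred b ih =>
    obtain ⟨e₁⟩ := τ.nonempty_twist_pred (-b) X
    obtain ⟨e₂⟩ := ih (τ.equiv.inverse.obj X)
    obtain ⟨e₃⟩ := τ.nonempty_twist_pred (a + -b) X
    rw [add_sub_assoc] at e₃
    exact ⟨(τ.twist a).mapIso e₁.symm ≪≫ e₂ ≪≫ e₃⟩

theorem nonempty_map_twist {E' : Type u'} [CommRing E'] {C' : Type w'} [Category.{v'} C']
    [Preadditive C'] [Linear E' C'] [HasZeroObject C'] [HasShift C' ℤ]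
    [∀ n : ℤ, (shiftFunctor C' n).Additive] [Pretriangulated C'] (τ' : TateTwist E' C')
    {G : C ⥤ C'} (h : τ.equiv.functor ⋙ G ≅ G ⋙ τ'.equiv.functor) (k : ℤ) (X : C) :
    Nonempty (G.obj ((τ.twist k).obj X) ≅ (τ'.twist k).obj (G.obj X)) := by
  induction k using Int.induction_on generalizing X with
  | zero => exact ⟨Iso.refl _⟩
  | succ k ih =>
    obtain ⟨e₁⟩ := τ.nonempty_twist_succ k X
    obtain ⟨e₂⟩ := ih (τ.equiv.functor.obj X)
    obtain ⟨e₃⟩ := τ'.nonempty_twist_succ k (G.obj X)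
    exact ⟨G.mapIso e₁.symm ≪≫ e₂ ≪≫ (τ'.twist k).mapIso (h.app X) ≪≫ e₃⟩
  | pred k ih =>
    obtain ⟨e₁⟩ := τ.nonempty_twist_pred (-k) X
    obtain ⟨e₂⟩ := ih (τ.equiv.inverse.obj X)
    obtain ⟨e₃⟩ := τ'.nonempty_twist_pred (-k) (G.obj X)
    let e : G.obj (τ.equiv.inverse.obj X) ≅ τ'.equiv.inverse.obj (G.obj X) :=
      τ'.equiv.unitIso.app _ ≪≫ τ'.equiv.inverse.mapIso
        ((h.app _).symm ≪≫ G.mapIso (τ.equiv.counitIso.app X))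
    exact ⟨G.mapIso e₁.symm ≪≫ e₂ ≪≫ (τ'.twist (-k)).mapIso e ≪≫ e₃⟩

theorem twist_hom_shift_eq_zero {X Y : C} {n : ℤ} {a b : ℤ}
    (h : ∀ f : X ⟶ (τ.twist (b - a)).obj (Y⟦n⟧), f = 0)
    (f : (τ.twist a).obj X ⟶ ((τ.twist b).obj Y)⟦n⟧) : f = 0 := by
  obtain ⟨e⟩ := τ.nonempty_twist_twist a (b - a) b (by lia) (Y⟦n⟧)
  let e' : ((τ.twist b).obj Y)⟦n⟧ ≅ (τ.twist a).obj ((τ.twist (b - a)).obj (Y⟦n⟧)) :=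
    (((τ.twist b).commShiftIso n).app Y).symm ≪≫ e.symm
  obtain ⟨g, hg⟩ := (τ.twist a).map_surjective (f ≫ e'.hom)
  rw [← cancel_mono e'.hom, ← hg, h g, Functor.map_zero, zero_comp]

theorem hom_twist_shift_eq_zero {X Y : C} {n k : ℤ}
    (h : ∀ f : (τ.twist 0).obj X ⟶ ((τ.twist k).obj Y)⟦n⟧, f = 0)
    (f : X ⟶ (τ.twist k).obj (Y⟦n⟧)) : f = 0 := by
  rw [← cancel_mono (((τ.twist k).commShiftIso n).app Y).hom, zero_comp]
  exact h _

end TateTwist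

theorem IsGradedHomFinite.finite_hom {τ : TateTwist E C} (hfin : IsGradedHomFinite τ) (X Y : C) :
    Module.Finite E (X ⟶ Y) := by
  have := hfin X Y
  exact Module.Finite.of_surjective
    (DirectSum.component E ℤ (fun k => X ⟶ (τ.twist k).obj Y) 0)
    (fun f => ⟨DirectSum.lof E ℤ (fun k => X ⟶ (τ.twist k).obj Y) 0 f,
      DirectSum.component.lof_self _ _ _⟩)

end Twist

/-! ### The family of Tate twists of an exceptional sequence -/

section TwistFamily

variable {E : Type u} [CommRing E]
variable {C : Type w} [Category.{v} C] [Preadditive C] [Linear E C] [HasZeroObject C]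
  [HasShift C ℤ] [∀ n : ℤ, (shiftFunctor C n).Additive] [Pretriangulated C]
variable {I : Type x} (τ : TateTwist E C) (nab del : I → C)

/-- The family of all Tate twists of the objects of a family. Passing to it makes the twists
disappear from all the orthogonality conditions. -/
def twistFamily (p : I × ℤ) : C := (τ.twist p.2).obj (nab p.1)

variable [LinearOrder I] (f : I ↪o ℕ)

/-- The level of a twisted object: the position of its index in `ℕ`. -/
def twistLevel (p : I × ℤ) : ℕ := f p.1

theorem Tlt_eq_levelLT (i : I) :
    Tlt τ nab i = levelLT (twistLevel f) (twistFamily τ nab) (f i) := by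
  refine le_antisymm (triangulatedHull_mono ?_) (triangulatedHull_mono ?_)
  · rintro X ⟨j, hj, k, rfl⟩
    exact ⟨(j, k), f.lt_iff_lt.2 hj, rfl⟩
  · rintro X ⟨⟨j, k⟩, hj, rfl⟩
    exact ⟨j, f.lt_iff_lt.1 hj, k, rfl⟩

theorem Tle_eq_levelLT (i : I) :
    Tle τ nab i = levelLT (twistLevel f) (twistFamily τ nab) (f i + 1) := by
  refine le_antisymm (triangulatedHull_mono ?_) (triangulatedHull_mono ?_)
  · rintro X ⟨j, hj, k, rfl⟩
    exact ⟨(j, k), Nat.lt_succ_of_le (f.le_iff_le.2 hj), rfl⟩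
  · rintro X ⟨⟨j, k⟩, hj, rfl⟩
    exact ⟨j, f.le_iff_le.1 (Nat.le_of_lt_succ hj), k, rfl⟩

variable {τ nab del}

theorem IsGradedExceptional.isExceptionalFamily (h : IsGradedExceptional τ nab) :
    IsExceptionalFamily (twistLevel f) (twistFamily τ nab) E where
  hom_ne := by
    rintro ⟨i, a⟩ ⟨j, b⟩ hij hne n φ
    refine τ.twist_hom_shift_eq_zero (fun g => ?_) φ
    rcases (f.le_iff_le.1 hij).lt_or_eq with hlt | heq
    · exact h.hom_lt i j hlt _ _ g
    · obtain rfl : i = j := heq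
      refine h.hom_self i _ _ (fun h' => hne ?_) g
      rw [show a = b by have := h'.2; lia]
  hom_self := by
    rintro ⟨i, a⟩ n hn φ
    exact τ.twist_hom_shift_eq_zero (fun g => h.hom_self i _ _ (fun h' => hn h'.1) g) φ
  bijective_smul_id := by
    rintro ⟨i, a⟩
    have h₁ : Function.Bijective fun r : E => r • 𝟙 (nab i) := by
      have bij := bijective_algebraMap_of_linearEquiv (E := End (nab i)) (h.end_self i).some.symm
      rwa [funext (Algebra.algebraMap_eq_smul_one (R := E) (A := End (nab i)))] at bij
    have h₂ : Function.Bijective ((τ.twist a).map : (nab i ⟶ nab i) → _) :=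
      ⟨(τ.twist a).map_injective, (τ.twist a).map_surjective⟩
    have h₃ : (fun r : E => r • 𝟙 ((τ.twist a).obj (nab i))) =
        (τ.twist a).map ∘ fun r : E => r • 𝟙 (nab i) := by
      funext r
      simp
    exact h₃ ▸ h₂.comp h₁
  generates X := triangulatedHull_mono
    (by rintro X ⟨j, -, k, rfl⟩; exact ⟨(j, k), rfl⟩) X (h.generates X)

omit [LinearOrder I] in
theorem extensionHull_genLE : extensionHull (genLE τ del) =
    extensionHull (nonnegShifts (twistFamily τ del) Set.univ) := by
  refine le_antisymm (a := (extensionHull (genLE τ del) : ObjectProperty C))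
    (extensionHull_le ?_) (extensionHull_le ?_)
  · rintro X ⟨j, n, k, hn, rfl⟩
    exact .of_mem _ ⟨(j, k), trivial, n, hn, ⟨((τ.twist k).commShiftIso n).app _⟩⟩
  · rintro X ⟨⟨j, k⟩, -, n, hn, ⟨e⟩⟩
    exact extensionHull_of_iso ((((τ.twist k).commShiftIso n).app (del j)) ≪≫ e.symm)
      (.of_mem _ ⟨j, n, k, hn, rfl⟩)

theorem IsIrreducibleCone.twist {X Z : C} (k : ℤ) (hZ : IsIrreducibleCone E X Z) :
    IsIrreducibleCone E ((τ.twist k).obj X) ((τ.twist k).obj Z) := by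
  obtain ⟨ϖ, g, h, hϖ, hT⟩ := hZ
  obtain ⟨δ, hT'⟩ := exists_map_distTriang (τ.twist k) hT
  rw [Functor.map_smul, CategoryTheory.Functor.map_id] at hT'
  exact ⟨ϖ, _, δ, hϖ, hT'⟩

omit [LinearOrder I] in
theorem extensionHull_genGE : extensionHull (genGE τ nab) =
    extensionHull (coneShifts E (twistFamily τ nab) Set.univ 0) := by
  refine le_antisymm (a := (extensionHull (genGE τ nab) : ObjectProperty C))
    (extensionHull_le ?_) (extensionHull_le ?_)
  · rintro X (⟨j, n, k, hn, rfl⟩ | ⟨j, ϖ, Z, g, h, hϖ, hT, n, k, hn, rfl⟩)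
    · exact .of_mem _ ⟨(j, k), trivial, _, n, Or.inl rfl, hn,
        ⟨((τ.twist k).commShiftIso n).app _⟩⟩
    · exact .of_mem _ ⟨(j, k), trivial, _, n, Or.inr (.twist k ⟨ϖ, g, h, hϖ, hT⟩), hn,
        ⟨((τ.twist k).commShiftIso n).app _⟩⟩
  · rintro X ⟨⟨j, k⟩, -, Z, n, rfl | ⟨ϖ, g, h, hϖ, hT⟩, hn, ⟨e⟩⟩
    · exact extensionHull_of_iso ((((τ.twist k).commShiftIso n).app (nab j)) ≪≫ e.symm)
        (.of_mem _ (Or.inl ⟨j, n, k, hn, rfl⟩))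
    · obtain ⟨Z', g', h', hT'⟩ := distinguished_cocone_triangle (ϖ • 𝟙 (nab j))
      obtain ⟨δ, hT''⟩ := exists_map_distTriang (τ.twist k) hT'
      rw [Functor.map_smul, CategoryTheory.Functor.map_id] at hT''
      obtain ⟨ε, -⟩ := exists_iso_of_arrow_iso _ _ hT'' hT (Iso.refl _)
      exact extensionHull_of_iso ((((τ.twist k).commShiftIso n).app Z') ≪≫
        (shiftFunctor C n).mapIso (Triangle.π₃.mapIso ε) ≪≫ e.symm)
        (.of_mem _ (Or.inr ⟨j, ϖ, Z', g', h', hϖ, hT', n, k, hn, rfl⟩))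

omit [LinearOrder I] in
theorem isExcTStructure_iff (t : TStructure C) : IsExcTStructure τ nab del t ↔
    IsFamilyTStructure E (twistFamily τ nab) (twistFamily τ del) t :=
  ⟨fun h => ⟨h.le_zero.trans extensionHull_genLE, h.ge_zero.trans extensionHull_genGE⟩,
    fun h => ⟨h.le_zero.trans extensionHull_genLE.symm, h.ge_zero.trans extensionHull_genGE.symm⟩⟩

end TwistFamily

/-! ### Canonical maps -/

theorem eq_zero_of_isIso_map_mor₁ {C : Type w} [Category.{v} C] [Preadditive C] [HasZeroObject C]
    [HasShift C ℤ] [∀ n : ℤ, (shiftFunctor C n).Additive] [Pretriangulated C] [IsTriangulated C]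
    (B : ObjectProperty C) [B.IsTriangulated] {T : Triangle C} (hT : T ∈ distTriang C)
    (h : IsIso (B.trW.Q.map T.mor₁)) {Y : C} (hY : B.rightOrthogonal Y) (a : T.obj₃ ⟶ Y) :
    a = 0 := by
  have hZ := (Triangle.isZero₃_iff_isIso₁ _ (B.trW.Q.map_distinguished T hT)).2 h
  exact (rightOrthogonal.map_bijective_of_isTriangulated hY B.trW.Q _).1 (hZ.eq_of_src _ _)

section CanonicalMaps

variable {E : Type u} [CommRing E]
variable {C : Type w} [Category.{v} C] [Preadditive C] [Linear E C] [HasZeroObject C]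
  [HasShift C ℤ] [∀ n : ℤ, (shiftFunctor C n).Additive] [Pretriangulated C]
variable {I : Type x} [LinearOrder I] {τ : TateTwist E C} {nab del : I → C} {i : I}
  {c : del i ⟶ nab i}

instance Tlt_isTriangulated (i : I) : (Tlt τ nab i).IsTriangulated :=
  triangulatedHull_isTriangulated _

instance Tlt_closedUnderIso (i : I) : (Tlt τ nab i).IsClosedUnderIsomorphisms :=
  triangulatedHull_closedUnderIso _

instance Tle_closedUnderIso (i : I) : (Tle τ nab i).IsClosedUnderIsomorphisms :=
  triangulatedHull_closedUnderIso _

theorem Tlt_le_Tle (i : I) : Tlt τ nab i ≤ Tle τ nab i :=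
  triangulatedHull_mono fun _ ⟨j, hj, k, e⟩ => ⟨j, le_of_lt hj, k, e⟩

theorem isCanonicalMap_of_trW (hc : (Tlt τ nab i).trW c) : IsCanonicalMap τ nab del c := by
  obtain ⟨Z, g, h, hT, hZ⟩ := hc
  have hdel : Tle τ nab i (del i) := (Tle τ nab i).ext_of_isTriangulatedClosed₁ _ hT
    (nab_mem_Tle τ nab i) (Tlt_le_Tle i Z hZ)
  obtain ⟨Z', g', h', hT'⟩ := distinguished_cocone_triangle
    (ObjectProperty.homMk c : (⟨del i, hdel⟩ : (Tle τ nab i).FullSubcategory) ⟶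
      ⟨nab i, nab_mem_Tle τ nab i⟩)
  obtain ⟨δ, hT''⟩ := exists_map_distTriang (Tle τ nab i).ι hT'
  obtain ⟨ε, -⟩ := exists_iso_of_arrow_iso _ _ hT hT'' (Iso.refl _)
  exact ⟨hdel, (verdierW τ nab i).Q_inverts _
    ⟨Z', g', h', hT', (Tlt τ nab i).prop_of_iso (Triangle.π₃.mapIso ε) hZ⟩⟩

variable (f : I ↪o ℕ)

theorem levelLT_twist (k : ℤ) {m : ℕ} {X : C}
    (hX : levelLT (twistLevel f) (twistFamily τ nab) m X) :
    levelLT (twistLevel f) (twistFamily τ nab) m ((τ.twist k).obj X) := by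
  refine triangulatedHull_map (τ.twist k) ?_ hX
  rintro _ ⟨⟨j, a⟩, hj, rfl⟩
  obtain ⟨e⟩ := τ.nonempty_twist_twist k a _ rfl (nab j)
  exact prop_of_iso _ e.symm
    (mem_levelLT (twistLevel f) (twistFamily τ nab) (l := (j, k + a)) hj)

section Exceptional

variable (hN : IsExceptionalFamily (twistLevel f) (twistFamily τ nab) E)
include hN

theorem rightOrthogonal_of_levelEq {Y : (Tle τ nab i).FullSubcategory}
    (hY : levelEq (twistLevel f) (twistFamily τ nab) (f i) Y.obj) :
    ((Tlt τ nab i).inverseImage (Tle τ nab i).ι).rightOrthogonal Y := fun _ g hZ =>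
  ObjectProperty.hom_ext _
    (hN.levelLT_hom_levelEq (Tlt_eq_levelLT τ nab f i ▸ hZ) hY g.hom)

variable [IsTriangulated C]

theorem IsDualSequence.exists_isCanonicalMap (h : IsDualSequence τ nab del) (i : I) :
    ∃ c : del i ⟶ nab i, IsCanonicalMap τ nab del c := by
  obtain ⟨hdel, ⟨e⟩⟩ := h.quotient i
  have hnab := rightOrthogonal_of_levelEq f hN (Y := ⟨nab i, nab_mem_Tle τ nab i⟩)
    (mem_levelEq (twistLevel f) (twistFamily τ nab) (i, 0))
  have : (Pi τ nab i).IsLocalization ((Tlt τ nab i).inverseImage (Tle τ nab i).ι).trW :=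
    inferInstanceAs ((verdierW τ nab i).Q.IsLocalization (verdierW τ nab i))
  obtain ⟨c, hc⟩ := (rightOrthogonal.map_bijective_of_isTriangulated hnab
    (Pi τ nab i) ⟨del i, hdel⟩).2 e.hom
  refine ⟨c.hom, hdel, ?_⟩
  change IsIso ((Pi τ nab i).map c)
  exact hc ▸ inferInstance

theorem IsCanonicalMap.trW (hc : IsCanonicalMap τ nab del c) :
    (levelLT (twistLevel f) (twistFamily τ nab) (f i)).trW c := by
  obtain ⟨hdel, hiso⟩ := hc
  obtain ⟨Z, g, h, hT⟩ := distinguished_cocone_triangle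
    (ObjectProperty.homMk c : (⟨del i, hdel⟩ : (Tle τ nab i).FullSubcategory) ⟶
      ⟨nab i, nab_mem_Tle τ nab i⟩)
  obtain ⟨δ, hT'⟩ := exists_map_distTriang (Tle τ nab i).ι hT
  refine ⟨Z.obj, g.hom, δ, hT', hN.mem_levelLT_of_hom_nab_eq_zero ?_ ?_⟩
  · rw [← Tle_eq_levelLT]
    exact Z.property
  · intro p hp n a
    have hY : Tle τ nab i ((twistFamily τ nab p)⟦n⟧) := (Tle τ nab i).le_shift n _
      (le_triangulatedHull _ _ ⟨p.1, f.le_iff_le.1 hp.le, p.2, rfl⟩)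
    have hY' : levelEq (twistLevel f) (twistFamily τ nab) (f i) ((twistFamily τ nab p)⟦n⟧) :=
      hp ▸ ObjectProperty.le_shift _ n _ (mem_levelEq _ _ p)
    exact congrArg (·.hom) (eq_zero_of_isIso_map_mor₁ _ hT hiso
      (rightOrthogonal_of_levelEq f hN (Y := ⟨_, hY⟩) hY') (ObjectProperty.homMk a))

theorem isCanonicalMap_iff : IsCanonicalMap τ nab del c ↔
    (levelLT (twistLevel f) (twistFamily τ nab) (f i)).trW c :=
  ⟨fun h => h.trW f hN, fun h => isCanonicalMap_of_trW (by rwa [Tlt_eq_levelLT τ nab f])⟩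

theorem isDualSequence_iff : IsDualSequence τ nab del ↔
      IsDualFamily (twistLevel f) (twistFamily τ nab) (twistFamily τ del) where
  mp h :=
    { hom_lt := fun _ _ hlm _ => τ.twist_hom_shift_eq_zero (h.hom_lt _ _ (f.lt_iff_lt.1 hlm) _ _)
      exists_canonical := by
        rintro ⟨i, k⟩
        obtain ⟨c, hc⟩ := h.exists_isCanonicalMap f hN i
        obtain ⟨Z, g, δ, hT, hZ⟩ := hc.trW f hN
        obtain ⟨δ', hT'⟩ := exists_map_distTriang (τ.twist k) hT
        exact ⟨(τ.twist k).map c, _, _, δ', hT', levelLT_twist f k hZ⟩ }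
  mpr h :=
    { hom_lt := fun i j hij n k => τ.hom_twist_shift_eq_zero
        (h.hom_lt (j, 0) (i, k) (f.lt_iff_lt.2 hij) n)
      quotient := fun i => by
        obtain ⟨c, hc⟩ := h.exists_canonical (i, 0)
        obtain ⟨hdel, hiso⟩ := (isCanonicalMap_iff (del := del) f hN).2 hc
        exact ⟨hdel, ⟨asIso ((Pi τ nab i).map (ObjectProperty.homMk c))⟩⟩ }

end Exceptional

end CanonicalMaps

/-! ### Change of coefficients for images of canonical maps -/

theorem toH0_comp_comp_fromH0 {C : Type w} [Category.{v} C] [Preadditive C] [HasZeroObject C]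
    [HasShift C ℤ] [∀ n : ℤ, (shiftFunctor C n).Additive] [Pretriangulated C] [IsTriangulated C]
    (t : TStructure C) {X Y : C} [t.IsLE X 0] [t.IsGE Y 0] {c : X ⟶ Y} {Z : HeartCat t}
    {q : (H0 t).obj X ⟶ Z} {r : Z ⟶ (H0 t).obj Y} (h : q ≫ r = (H0 t).map c) :
    (toH0 t X ≫ q.hom) ≫ r.hom ≫ fromH0 t Y = c := by
  have h' : q.hom ≫ r.hom = ((H0 t).map c).hom := congrArg (·.hom) h
  rw [Category.assoc, reassoc_of% h', toH0_H0_map_fromH0]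

section ImageCanonical

variable {C : Type w} [Category.{v} C] [Preadditive C] [HasZeroObject C] [HasShift C ℤ]
  [∀ n : ℤ, (shiftFunctor C n).Additive] [Pretriangulated C]
variable {C' : Type w'} [Category.{v'} C'] [Preadditive C'] [HasZeroObject C'] [HasShift C' ℤ]
  [∀ n : ℤ, (shiftFunctor C' n).Additive] [Pretriangulated C']
variable {G : C ⥤ C'} [G.CommShift ℤ] [G.IsTriangulated]
variable {O : Type u} [CommRing O] [Linear O C] {k : Type u'} [Field k] [Linear k C']
variable {Λ : Type x} {lev : Λ → ℕ} {N D : Λ → C} {N' D' : Λ → C'}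
  (eN : ∀ l, G.obj (N l) ≅ N' l) (eD : ∀ l, G.obj (D l) ≅ D' l)
variable {t : TStructure C} {t' : TStructure C'}
  (ht : IsFamilyTStructure O N D t) (ht' : IsFamilyTStructure k N' D' t')
include ht ht'

include eN in
theorem isGE_map_of_isGE_one (Y : C) (hY : t.IsGE Y 1) : t'.IsGE (G.obj Y) 0 := by
  have := t.isGE_shift Y 1 1 0
  have hY₁ : t'.IsGE ((shiftFunctor C (1 : ℤ) ⋙ G).obj Y) (-1) :=
    isGE_map G eN ht ht' (b := 1) zero_le_one (fun l Z hZ => by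
      have := ht'.nab_isGE l
      have := t'.isGE_of_iso (eN l).symm 0
      exact isGE_map_irreducibleCone G hZ) (Y⟦(1 : ℤ)⟧)
  have : t'.IsGE ((G.obj Y)⟦(1 : ℤ)⟧) (-1) :=
    t'.isGE_of_iso ((G.commShiftIso (1 : ℤ)).app Y) (-1)
  exact t'.isGE_of_shift (G.obj Y) 0 1 (-1)

variable [IsTriangulated C]

include eD in
theorem isTEpi_map_toH0_comp {X : C} [t.IsLE X 0] {Z : HeartCat t} (q : (H0 t).obj X ⟶ Z)
    [Epi q] : IsTEpi t' (G.map (toH0 t X ≫ q.hom)) := by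
  rw [G.map_comp]
  exact (isTEpi_map_toH0 G eD ht ht' X).comp (isTEpi_map_of_epi G eD ht ht' q)

include eN

theorem isTMono_map_comp_fromH0 {Y : C} [t.IsGE Y 0] {Z : HeartCat t} (r : Z ⟶ (H0 t).obj Y)
    [Mono r] [t'.IsGE (G.obj (cokernel r).obj) 0] :
    IsTMono t' (G.map (r.hom ≫ fromH0 t Y)) := by
  rw [G.map_comp]
  exact (isTMono_map_of_mono G r).comp
    (isTMono_map_fromH0 G Y (isGE_map_of_isGE_one eN ht ht'))

variable [IsTriangulated C'] (hN' : IsExceptionalFamily lev N' k)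
variable {l : Λ} {c : D l ⟶ N l} (hc : (levelLT lev N (lev l)).trW c)
  {c' : D' l ⟶ N' l} (hc' : (levelLT lev N' (lev l)).trW c')
include eD hN' hc hc'

theorem nonempty_iso_map_image_H0 [Algebra O k] [FaithfulSMul O k]
    [∀ n : ℤ, (shiftFunctor C n).Linear O] (hG : IsSemilinear O k G) :
    Nonempty (G.obj (imageSubobject ((H0 t).map c) : HeartCat t).obj ≅
      (imageSubobject ((H0 t').map c') : HeartCat t').obj) := by
  have := ht.del_isLE l
  have := ht.nab_isGE l
  have := ht'.del_isLE l
  have := ht'.nab_isGE l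
  have isGE_map_zero (X : C) [t.IsGE X 0] : t'.IsGE (G.obj X) 0 :=
    isGE_map G eN ht ht' (b := 0) le_rfl
      (fun _ _ hZ => t'.isGE_of_iso (isZero_map_irreducibleCone G hZ hG).isoZero.symm 0) X
  let L := imageSubobject ((H0 t).map c)
  have hL : t'.heart (G.obj (L : HeartCat t).obj) :=
    (t'.mem_heart_iff _).2 ⟨isLE_map G eD ht ht' _, isGE_map_zero _⟩
  have := isGE_map_zero (cokernel L.arrow).obj
  obtain ⟨q, r, hqr, hq, hr⟩ := exists_map_factorization (t' := t') G eN eD hN' hc hc'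
    (toH0_comp_comp_fromH0 t (imageSubobject_arrow_comp _))
  obtain ⟨e⟩ := nonempty_iso_image_H0 (Z := ⟨_, hL⟩) hqr (hq (isTEpi_map_toH0_comp eD ht ht' _))
    (hr (isTMono_map_comp_fromH0 eN ht ht' L.arrow))
  exact ⟨t'.heart.ι.mapIso e⟩

variable (hD' : IsDualFamily lev N' D') [∀ n : ℤ, (shiftFunctor C' n).Linear k]
include hD'

theorem hasSimpleHead_map_image_H0
    (h : t'.heart (G.obj (imageSubobject ((H0 t).map c) : HeartCat t).obj)) :
    HasSimpleHead (⟨_, h⟩ : HeartCat t') (imageSubobject ((H0 t').map c') : HeartCat t') := by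
  have := ht.del_isLE l
  have := ht.nab_isGE l
  obtain ⟨q, r, hqr, hq, -⟩ := exists_map_factorization (t' := t') G eN eD hN' hc hc'
    (toH0_comp_comp_fromH0 t (imageSubobject_arrow_comp _))
  exact ht'.hasSimpleHead_image_H0 hN' hD' hc' (Z := ⟨_, h⟩) hqr
    (hq (isTEpi_map_toH0_comp eD ht ht' _))

theorem hasSimpleSocle_map_of_image_H0_le {M : Subobject ((H0 t).obj (N l))}
    (hM : imageSubobject ((H0 t).map c) ≤ M)
    (hcoker : t'.IsGE (G.obj (cokernel M.arrow).obj) 0)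
    (h : t'.heart (G.obj (M : HeartCat t).obj)) :
    HasSimpleSocle (⟨_, h⟩ : HeartCat t') (imageSubobject ((H0 t').map c') : HeartCat t') := by
  have := ht.del_isLE l
  have := ht.nab_isGE l
  have hfac : (factorThruImageSubobject ((H0 t).map c) ≫ Subobject.ofLE _ M hM) ≫ M.arrow =
      (H0 t).map c := by
    rw [Category.assoc, Subobject.ofLE_arrow, imageSubobject_arrow_comp]
  obtain ⟨q, r, hqr, -, hr⟩ := exists_map_factorization (t' := t') G eN eD hN' hc hc'
    (toH0_comp_comp_fromH0 t hfac)
  exact ht'.hasSimpleSocle_image_H0 hN' hD' hc' (Z := ⟨_, h⟩) hqr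
    (hr (isTMono_map_comp_fromH0 eN ht ht' M.arrow))

end ImageCanonical

theorem nonempty_iso_map_of_mem_torsionOver {C : Type w} [Category.{v} C] [Preadditive C]
    [HasZeroObject C] [HasShift C ℤ] [∀ n : ℤ, (shiftFunctor C n).Additive] [Pretriangulated C]
    [IsTriangulated C] {C' : Type w'} [Category.{v'} C'] [Preadditive C'] [HasZeroObject C']
    [HasShift C' ℤ] [∀ n : ℤ, (shiftFunctor C' n).Additive] [Pretriangulated C']
    (G : C ⥤ C') [G.CommShift ℤ] [G.IsTriangulated] {O : Type u} [CommRing O] [Linear O C]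
    {k : Type u'} [Field k] [Algebra O k] [FaithfulSMul O k] [Linear k C']
    (hG : IsSemilinear O k G) {t : TStructure C} {Y : HeartCat t} {L M : Subobject Y}
    (hM : M ∈ torsionOver O L) :
    Nonempty (G.obj (L : HeartCat t).obj ≅ G.obj (M : HeartCat t).obj) := by
  obtain ⟨h, ϖ, hϖ, n, -, hn⟩ := hM
  exact nonempty_iso_map_of_smul_cokernel_ofLE_eq_zero G hG h
    (by simpa using fun h => (hϖ.ne_zero h).elim) hn

namespace ResidueFunctorData

variable {C : Type w} [Category.{u} C] [Preadditive C] [HasZeroObject C] [HasShift C ℤ]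
  [∀ n : ℤ, (shiftFunctor C n).Additive] [Pretriangulated C] [IsTriangulated C]
variable {C' : Type w'} [Category.{v'} C'] [Preadditive C'] [HasZeroObject C'] [HasShift C' ℤ]
  [∀ n : ℤ, (shiftFunctor C' n).Additive] [Pretriangulated C']
variable {G : C ⥤ C'} [G.CommShift ℤ] [G.IsTriangulated]
variable {O : Type u} [CommRing O] [IsDomain O] [Linear O C]
  [∀ n : ℤ, (shiftFunctor C n).Linear O] {k : Type u} [Field k] [Algebra O k] [Linear k C']
variable {Λ : Type x} {N D : Λ → C} {N' D' : Λ → C'} {t : TStructure C} {t' : TStructure C'}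
  (R : ResidueFunctorData O k G) (eD : ∀ l, G.obj (D l) ≅ D' l)
  (ht : IsFamilyTStructure O N D t) (ht' : IsFamilyTStructure k N' D' t')
  (hfin : ∀ X Y : C, Module.Finite O (X ⟶ Y))
include R eD ht ht' hfin

theorem heart_map_subobject_H0 [IsPrincipalIdealRing O] {l : Λ}
    (M : Subobject ((H0 t).obj (N l))) : t'.heart (G.obj (M : HeartCat t).obj) := by
  have := ht.nab_isGE l
  refine (t'.mem_heart_iff _).2 ⟨isLE_map G eD ht ht' _, R.isGE_map eD ht ht' hfin fun S hS => ?_⟩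
  exact .of_smul_eq_zero fun a f hf => or_iff_not_imp_left.2 fun ha =>
    ht.hom_subobject_eq_zero_of_smul_eq_zero M ha hf

theorem isGE_map_cokernel_torsionOver [IsDiscreteValuationRing O] {Y : HeartCat t}
    {L M : Subobject Y} (hM : IsGreatest (torsionOver O L) M) :
    t'.IsGE (G.obj (cokernel M.arrow).obj) 0 := by
  obtain ⟨ϖ, hϖ⟩ := IsDiscreteValuationRing.exists_irreducible O
  exact R.isGE_map eD ht ht' hfin fun S _ => isTorsionFree_of_irreducible hϖ fun f hf =>
    ht.hom_cokernel_eq_zero_of_smul_eq_zero hM hϖ hf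

end ResidueFunctorData

/-! ### Exceptional sequences and change of coefficients -/

section Sequence

variable {E : Type u} [CommRing E]
variable {C : Type w} [Category.{v} C] [Preadditive C] [Linear E C] [HasZeroObject C]
  [HasShift C ℤ] [∀ n : ℤ, (shiftFunctor C n).Additive] [Pretriangulated C] [IsTriangulated C]
variable {I : Type x} {τ : TateTwist E C} {nab del : I → C}

theorem IsGradedExceptional.exists_isCanonicalMap [LinearOrder I]
    (hN : IsGradedExceptional τ nab) (hD : IsDualSequence τ nab del) (i : I) :
    ∃ c : del i ⟶ nab i, IsCanonicalMap τ nab del c := by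
  obtain ⟨f⟩ := hN.order
  exact hD.exists_isCanonicalMap f (hN.isExceptionalFamily f) i

variable [IsDomain E] [∀ n : ℤ, (shiftFunctor C n).Linear E]

theorem IsGradedExceptional.exists_isExcTStructure [LinearOrder I] [IsPrincipalIdealRing E]
    (hN : IsGradedExceptional τ nab) (hD : IsDualSequence τ nab del) :
    ∃ t : TStructure C, IsExcTStructure τ nab del t := by
  obtain ⟨f⟩ := hN.order
  have hNf := hN.isExceptionalFamily f
  obtain ⟨t, ht⟩ := hNf.exists_isFamilyTStructure ((isDualSequence_iff f hNf).1 hD)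
  exact ⟨t, (isExcTStructure_iff t).2 ht⟩

theorem IsExcTStructure.exists_isLplus [IsDiscreteValuationRing E] {t : TStructure C}
    (ht : IsExcTStructure τ nab del t) {i : I} (c : del i ⟶ nab i) :
    ∃ M : Subobject ((H0 t).obj (nab i)), IsLplus E t c M :=
  ((isExcTStructure_iff t).1 ht).exists_isGreatest_torsionOver (Lsub t c)

end Sequence

section ChangeOfCoefficients

theorem eq_zero_of_shift_eq_zero {C : Type w} [Category.{v} C] [Preadditive C] [HasShift C ℤ]
    {X Y : C} (h : ∀ (n : ℤ) (f : X ⟶ Y⟦n⟧), f = 0) (f : X ⟶ Y) : f = 0 := by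
  rw [← cancel_mono (shiftZero ℤ Y).inv, zero_comp]
  exact h 0 _

variable {O : Type u} [CommRing O]
variable {C : Type w} [Category.{v} C] [Preadditive C] [Linear O C] [HasZeroObject C]
  [HasShift C ℤ] [∀ n : ℤ, (shiftFunctor C n).Additive] [Pretriangulated C]
variable {k : Type u'} [Field k]
variable {C' : Type w'} [Category.{v'} C'] [Preadditive C'] [Linear k C'] [HasZeroObject C']
  [HasShift C' ℤ] [∀ n : ℤ, (shiftFunctor C' n).Additive] [Pretriangulated C']
variable {I : Type x} {τ : TateTwist O C} {τ' : TateTwist k C'} {nab del : I → C} {G : C ⥤ C'}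
  (e : τ.equiv.functor ⋙ G ≅ G ⋙ τ'.equiv.functor)
include e

theorem nonempty_map_twistFamily (X : I → C) :
    Nonempty (∀ p, G.obj (twistFamily τ X p) ≅ twistFamily τ' (fun i => G.obj (X i)) p) :=
  ⟨fun p => (τ.nonempty_map_twist τ' e p.2 (X p.1)).some⟩

variable [IsTriangulated C] [IsTriangulated C'] [G.CommShift ℤ] [G.IsTriangulated] [LinearOrder I]
  (hN : IsGradedExceptional τ nab) (hN' : IsGradedExceptional τ' fun i => G.obj (nab i))
include hN hN'

theorem IsDualSequence.map (hD : IsDualSequence τ nab del)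
    (h : ∀ X Y : C, (∀ (n : ℤ) (f : X ⟶ Y⟦n⟧), f = 0) → ∀ f : G.obj X ⟶ G.obj Y, f = 0) :
    IsDualSequence τ' (fun i => G.obj (nab i)) (fun i => G.obj (del i)) := by
  obtain ⟨f⟩ := hN.order
  obtain ⟨eN⟩ := nonempty_map_twistFamily e nab
  obtain ⟨eD⟩ := nonempty_map_twistFamily e del
  exact (isDualSequence_iff f (hN'.isExceptionalFamily f)).2 (isDualFamily_map G eN eD
    ((isDualSequence_iff f (hN.isExceptionalFamily f)).1 hD) h)

theorem IsGenericFunctor.isDualSequence_map [Algebra O k] (hG : IsGenericFunctor O k G)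
    (hD : IsDualSequence τ nab del) :
    IsDualSequence τ' (fun i => G.obj (nab i)) (fun i => G.obj (del i)) :=
  hD.map e hN hN' fun _ _ h => hG.hom_eq_zero (eq_zero_of_shift_eq_zero h)

variable {t : TStructure C} {t' : TStructure C'} (ht : IsExcTStructure τ nab del t)
  (ht' : IsExcTStructure τ' (fun i => G.obj (nab i)) (fun i => G.obj (del i)) t')
  {i : I} {c : del i ⟶ nab i} (hc : IsCanonicalMap τ nab del c)
  {c' : G.obj (del i) ⟶ G.obj (nab i)}
  (hc' : IsCanonicalMap τ' (fun i => G.obj (nab i)) (fun i => G.obj (del i)) (i := i) c')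
include ht ht' hc hc'

theorem nonempty_iso_map_Lobj [Algebra O k] [FaithfulSMul O k]
    [∀ n : ℤ, (shiftFunctor C n).Linear O] (hG : IsSemilinear O k G) :
    Nonempty (G.obj (Lobj t c).obj ≅ (Lobj (nab := fun i => G.obj (nab i))
      (del := fun i => G.obj (del i)) (i := i) t' c').obj) := by
  obtain ⟨f⟩ := hN.order
  obtain ⟨eN⟩ := nonempty_map_twistFamily e nab
  obtain ⟨eD⟩ := nonempty_map_twistFamily e del
  have hNf := hN.isExceptionalFamily f
  have hNf' := hN'.isExceptionalFamily f
  exact nonempty_iso_map_image_H0 (l := (i, 0)) eN eD ((isExcTStructure_iff t).1 ht)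
    ((isExcTStructure_iff t').1 ht') hNf' ((isCanonicalMap_iff f hNf).1 hc)
    ((isCanonicalMap_iff f hNf').1 hc') hG

variable (hD' : IsDualSequence τ' (fun i => G.obj (nab i)) (fun i => G.obj (del i)))
  [∀ n : ℤ, (shiftFunctor C' n).Linear k]
include hD'

theorem hasSimpleHead_map_Lobj (h : t'.heart (G.obj (Lobj t c).obj)) :
    HasSimpleHead (⟨_, h⟩ : HeartCat t') (Lobj (nab := fun i => G.obj (nab i))
      (del := fun i => G.obj (del i)) (i := i) t' c') := by
  obtain ⟨f⟩ := hN.order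
  obtain ⟨eN⟩ := nonempty_map_twistFamily e nab
  obtain ⟨eD⟩ := nonempty_map_twistFamily e del
  have hNf := hN.isExceptionalFamily f
  have hNf' := hN'.isExceptionalFamily f
  exact hasSimpleHead_map_image_H0 (l := (i, 0)) eN eD ((isExcTStructure_iff t).1 ht)
    ((isExcTStructure_iff t').1 ht') hNf' ((isCanonicalMap_iff f hNf).1 hc)
    ((isCanonicalMap_iff f hNf').1 hc') ((isDualSequence_iff f hNf').1 hD') h

theorem hasSimpleSocle_map_of_Lsub_le {M : Subobject ((H0 t).obj (nab i))} (hM : Lsub t c ≤ M)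
    (hcoker : t'.IsGE (G.obj (cokernel M.arrow).obj) 0)
    (h : t'.heart (G.obj (M : HeartCat t).obj)) :
    HasSimpleSocle (⟨_, h⟩ : HeartCat t') (Lobj (nab := fun i => G.obj (nab i))
      (del := fun i => G.obj (del i)) (i := i) t' c') := by
  obtain ⟨f⟩ := hN.order
  obtain ⟨eN⟩ := nonempty_map_twistFamily e nab
  obtain ⟨eD⟩ := nonempty_map_twistFamily e del
  have hNf := hN.isExceptionalFamily f
  have hNf' := hN'.isExceptionalFamily f
  exact hasSimpleSocle_map_of_image_H0_le (l := (i, 0)) eN eD ((isExcTStructure_iff t).1 ht)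
    ((isExcTStructure_iff t').1 ht') hNf' ((isCanonicalMap_iff f hNf).1 hc)
    ((isCanonicalMap_iff f hNf').1 hc') ((isDualSequence_iff f hNf').1 hD') hM hcoker h

end ChangeOfCoefficients

namespace ResidueFunctorData

variable {O : Type u} [CommRing O] [IsDomain O]
variable {C : Type w} [Category.{u} C] [Preadditive C] [Linear O C] [HasZeroObject C]
  [HasShift C ℤ] [∀ n : ℤ, (shiftFunctor C n).Additive] [Pretriangulated C] [IsTriangulated C]
variable {k : Type u} [Field k] [Algebra O k]
variable {C' : Type w'} [Category.{v'} C'] [Preadditive C'] [Linear k C'] [HasZeroObject C']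
  [HasShift C' ℤ] [∀ n : ℤ, (shiftFunctor C' n).Additive] [Pretriangulated C']
variable {I : Type x} {τ : TateTwist O C} {τ' : TateTwist k C'} {nab del : I → C}
  {G : C ⥤ C'} [G.CommShift ℤ] [G.IsTriangulated] (R : ResidueFunctorData O k G)
  (e : τ.equiv.functor ⋙ G ≅ G ⋙ τ'.equiv.functor) (hfin : IsGradedHomFinite τ)
include R e hfin

theorem isDualSequence_map [IsPrincipalIdealRing O] [IsTriangulated C'] [LinearOrder I]
    (hN : IsGradedExceptional τ nab) (hN' : IsGradedExceptional τ' fun i => G.obj (nab i))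
    (hD : IsDualSequence τ nab del) :
    IsDualSequence τ' (fun i => G.obj (nab i)) (fun i => G.obj (del i)) :=
  hD.map e hN hN' fun X Y h => by
    have := hfin.finite_hom X (Y⟦(1 : ℤ)⟧)
    have : Module.IsTorsionFree O (X ⟶ Y⟦(1 : ℤ)⟧) :=
      .of_smul_eq_zero fun _ f _ => Or.inr (h 1 f)
    exact R.hom_eq_zero (eq_zero_of_shift_eq_zero h)

variable [∀ n : ℤ, (shiftFunctor C n).Linear O]
variable {t : TStructure C} {t' : TStructure C'} (ht : IsExcTStructure τ nab del t)
  (ht' : IsExcTStructure τ' (fun i => G.obj (nab i)) (fun i => G.obj (del i)) t')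
include ht ht'

theorem heart_map_subobject_H0_nab [IsPrincipalIdealRing O] {i : I}
    (M : Subobject ((H0 t).obj (nab i))) : t'.heart (G.obj (M : HeartCat t).obj) := by
  obtain ⟨eD⟩ := nonempty_map_twistFamily e del
  exact R.heart_map_subobject_H0 (l := (i, 0)) eD ((isExcTStructure_iff t).1 ht)
    ((isExcTStructure_iff t').1 ht') hfin.finite_hom M

theorem isGE_map_cokernel_of_isLplus [IsDiscreteValuationRing O] {i : I} {c : del i ⟶ nab i}
    {M : Subobject ((H0 t).obj (nab i))} (hM : IsLplus O t c M) :
    t'.IsGE (G.obj (cokernel M.arrow).obj) 0 := by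
  obtain ⟨eD⟩ := nonempty_map_twistFamily e del
  exact R.isGE_map_cokernel_torsionOver eD ((isExcTStructure_iff t).1 ht)
    ((isExcTStructure_iff t').1 ht') hfin.finite_hom hM

end ResidueFunctorData

end ExcSeq

open ExcSeq in
theorem mainTheorem10_general
    {O : Type u} [CommRing O] [IsDomain O] [IsDiscreteValuationRing O]
    {K : Type u'} [Field K] [Algebra O K] [FaithfulSMul O K]
    {k : Type u} [Field k] [Algebra O k]
    {TO : Type w} [Category.{u} TO] [Preadditive TO] [Linear O TO] [HasZeroObject TO]
    [HasShift TO ℤ] [∀ n : ℤ, (shiftFunctor TO n).Additive]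
    [∀ n : ℤ, (shiftFunctor TO n).Linear O] [Pretriangulated TO] [IsTriangulated TO]
    {TK : Type w'} [Category.{v'} TK] [Preadditive TK] [Linear K TK] [HasZeroObject TK]
    [HasShift TK ℤ] [∀ n : ℤ, (shiftFunctor TK n).Additive]
    [∀ n : ℤ, (shiftFunctor TK n).Linear K] [Pretriangulated TK] [IsTriangulated TK]
    {TF : Type w''} [Category.{v''} TF] [Preadditive TF] [Linear k TF] [HasZeroObject TF]
    [HasShift TF ℤ] [∀ n : ℤ, (shiftFunctor TF n).Additive]
    [∀ n : ℤ, (shiftFunctor TF n).Linear k] [Pretriangulated TF] [IsTriangulated TF]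
    (τO : TateTwist O TO) (τK : TateTwist K TK) (τF : TateTwist k TF)
    (finO : IsGradedHomFinite τO)
    {I : Type x} [LinearOrder I] (nab del : I → TO)
    (excO : IsGradedExceptional τO nab) (dualO : IsDualSequence τO nab del)
    (FK : TO ⥤ TK) [FK.CommShift ℤ] [FK.IsTriangulated]
    (twistK : τO.equiv.functor ⋙ FK ≅ FK ⋙ τK.equiv.functor)
    (genericK : IsGenericFunctor O K FK)
    (FF : TO ⥤ TF) [FF.CommShift ℤ] [FF.IsTriangulated]
    (twistF : τO.equiv.functor ⋙ FF ≅ FF ⋙ τF.equiv.functor)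
    (residueF : ResidueFunctorData O k FF)
    (excK : IsGradedExceptional τK fun i => FK.obj (nab i))
    (excF : IsGradedExceptional τF fun i => FF.obj (nab i)) :
    (∃ tO : TStructure TO, IsExcTStructure τO nab del tO) ∧
    (∃ tK : TStructure TK,
      IsExcTStructure τK (fun i => FK.obj (nab i)) (fun i => FK.obj (del i)) tK) ∧
    (∃ tF : TStructure TF,
      IsExcTStructure τF (fun i => FF.obj (nab i)) (fun i => FF.obj (del i)) tF) ∧
    ∀ (tO : TStructure TO) (tK : TStructure TK) (tF : TStructure TF),
      IsExcTStructure τO nab del tO →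
      IsExcTStructure τK (fun i => FK.obj (nab i)) (fun i => FK.obj (del i)) tK →
      IsExcTStructure τF (fun i => FF.obj (nab i)) (fun i => FF.obj (del i)) tF →
      ∀ i : I,
        (∃ cO : del i ⟶ nab i, IsCanonicalMap τO nab del cO) ∧
        (∃ cK : FK.obj (del i) ⟶ FK.obj (nab i),
          IsCanonicalMap τK (fun i => FK.obj (nab i)) (fun i => FK.obj (del i)) (i := i) cK) ∧
        (∃ cF : FF.obj (del i) ⟶ FF.obj (nab i),
          IsCanonicalMap τF (fun i => FF.obj (nab i)) (fun i => FF.obj (del i)) (i := i) cF) ∧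
        ∀ (cO : del i ⟶ nab i) (cK : FK.obj (del i) ⟶ FK.obj (nab i))
          (cF : FF.obj (del i) ⟶ FF.obj (nab i)),
          IsCanonicalMap τO nab del cO →
          IsCanonicalMap τK (fun i => FK.obj (nab i)) (fun i => FK.obj (del i)) (i := i) cK →
          IsCanonicalMap τF (fun i => FF.obj (nab i)) (fun i => FF.obj (del i)) (i := i) cF →
          (∃ Lp : Subobject ((H0 tO).obj (nab i)), IsLplus O tO cO Lp) ∧
          ∀ Lp : Subobject ((H0 tO).obj (nab i)), IsLplus O tO cO Lp →
            Nonempty (FK.obj (Lobj tO cO).obj ≅ FK.obj (Lp : HeartCat tO).obj) ∧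
            Nonempty (FK.obj (Lp : HeartCat tO).obj ≅
              (Lobj (nab := fun i => FK.obj (nab i)) (del := fun i => FK.obj (del i))
                (i := i) tK cK).obj) ∧
            (∃ h : tF.heart (FF.obj (Lobj tO cO).obj),
              HasSimpleHead (⟨FF.obj (Lobj tO cO).obj, h⟩ : HeartCat tF)
                (Lobj (nab := fun i => FF.obj (nab i)) (del := fun i => FF.obj (del i))
                  (i := i) tF cF)) ∧
            (∃ h : tF.heart (FF.obj (Lp : HeartCat tO).obj),
              HasSimpleSocle (⟨FF.obj (Lp : HeartCat tO).obj, h⟩ : HeartCat tF)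
                (Lobj (nab := fun i => FF.obj (nab i)) (del := fun i => FF.obj (del i))
                  (i := i) tF cF)) := by
  have dualK := genericK.isDualSequence_map twistK excO excK dualO
  have dualF := residueF.isDualSequence_map twistF finO excO excF dualO
  refine ⟨excO.exists_isExcTStructure dualO, excK.exists_isExcTStructure dualK,
    excF.exists_isExcTStructure dualF, fun tO tK tF htO htK htF i => ?_⟩
  refine ⟨excO.exists_isCanonicalMap dualO i, excK.exists_isCanonicalMap dualK i,
    excF.exists_isCanonicalMap dualF i, fun cO cK cF hcO hcK hcF => ?_⟩
  refine ⟨htO.exists_isLplus cO, fun Lp hLp => ?_⟩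
  obtain ⟨isoLp⟩ := nonempty_iso_map_of_mem_torsionOver FK genericK.semilinear hLp.1
  obtain ⟨isoL⟩ := nonempty_iso_map_Lobj twistK excO excK htO htK hcO hcK genericK.semilinear
  have heart_map := residueF.heart_map_subobject_H0_nab twistF finO htO htF (i := i)
  have isGE_coker := residueF.isGE_map_cokernel_of_isLplus twistF finO htO htF hLp
  exact ⟨⟨isoLp⟩, ⟨isoLp.symm ≪≫ isoL⟩,
    ⟨heart_map _, hasSimpleHead_map_Lobj twistF excO excF htO htF hcO hcF dualF _⟩,
    ⟨heart_map _, hasSimpleSocle_map_of_Lsub_le twistF excO excF htO htF hcO hcF dualF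
      hLp.1.choose isGE_coker _⟩⟩

open ExcSeq in
theorem mainTheorem10
    -- a complete discrete valuation ring, its fraction field and its residue field
    {O : Type u} [CommRing O] [IsDomain O] [IsDiscreteValuationRing O]
    [IsAdicComplete (IsLocalRing.maximalIdeal O) O]
    {K : Type u'} [Field K] [Algebra O K] [IsFractionRing O K]
    -- the `O`-linear triangulated category `TO`
    {TO : Type w} [Category.{u} TO] [Preadditive TO] [Linear O TO] [HasZeroObject TO]
    [HasShift TO ℤ] [∀ n : ℤ, (shiftFunctor TO n).Additive]
    [∀ n : ℤ, (shiftFunctor TO n).Linear O] [Pretriangulated TO] [IsTriangulated TO]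
    -- the `K`-linear triangulated category `TK`
    {TK : Type w'} [Category.{v'} TK] [Preadditive TK] [Linear K TK] [HasZeroObject TK]
    [HasShift TK ℤ] [∀ n : ℤ, (shiftFunctor TK n).Additive]
    [∀ n : ℤ, (shiftFunctor TK n).Linear K] [Pretriangulated TK] [IsTriangulated TK]
    -- the triangulated category `TF`, linear over the residue field
    {TF : Type w''} [Category.{v''} TF] [Preadditive TF]
    [Linear (IsLocalRing.ResidueField O) TF] [HasZeroObject TF]
    [HasShift TF ℤ] [∀ n : ℤ, (shiftFunctor TF n).Additive]
    [∀ n : ℤ, (shiftFunctor TF n).Linear (IsLocalRing.ResidueField O)]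
    [Pretriangulated TF] [IsTriangulated TF]
    -- Tate twists, and graded Hom-finiteness
    (τO : TateTwist O TO) (τK : TateTwist K TK) (τF : TateTwist (IsLocalRing.ResidueField O) TF)
    (finO : IsGradedHomFinite τO) (finK : IsGradedHomFinite τK) (finF : IsGradedHomFinite τF)
    -- the graded exceptional sequence over `O` and its dual sequence
    {I : Type x} [LinearOrder I] (nab del : I → TO)
    (excO : IsGradedExceptional τO nab) (dualO : IsDualSequence τO nab del)
    -- the functor `K(-)`
    (FK : TO ⥤ TK) [FK.CommShift ℤ] [FK.IsTriangulated]
    (twistK : τO.equiv.functor ⋙ FK ≅ FK ⋙ τK.equiv.functor)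
    (genericK : IsGenericFunctor O K FK)
    -- the functor `F(-)`
    (FF : TO ⥤ TF) [FF.CommShift ℤ] [FF.IsTriangulated]
    (twistF : τO.equiv.functor ⋙ FF ≅ FF ⋙ τF.equiv.functor)
    (residueF : ResidueFunctorData O (IsLocalRing.ResidueField O) FF)
    -- the images of the exceptional sequence are exceptional sequences
    (excK : IsGradedExceptional τK fun i => FK.obj (nab i))
    (excF : IsGradedExceptional τF fun i => FF.obj (nab i)) :
    -- the three t-structures exist
    (∃ tO : TStructure TO, IsExcTStructure τO nab del tO) ∧
    (∃ tK : TStructure TK,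
      IsExcTStructure τK (fun i => FK.obj (nab i)) (fun i => FK.obj (del i)) tK) ∧
    (∃ tF : TStructure TF,
      IsExcTStructure τF (fun i => FF.obj (nab i)) (fun i => FF.obj (del i)) tF) ∧
    ∀ (tO : TStructure TO) (tK : TStructure TK) (tF : TStructure TF),
      IsExcTStructure τO nab del tO →
      IsExcTStructure τK (fun i => FK.obj (nab i)) (fun i => FK.obj (del i)) tK →
      IsExcTStructure τF (fun i => FF.obj (nab i)) (fun i => FF.obj (del i)) tF →
      ∀ i : I,
        -- the canonical maps exist
        (∃ cO : del i ⟶ nab i, IsCanonicalMap τO nab del cO) ∧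
        (∃ cK : FK.obj (del i) ⟶ FK.obj (nab i),
          IsCanonicalMap τK (fun i => FK.obj (nab i)) (fun i => FK.obj (del i)) (i := i) cK) ∧
        (∃ cF : FF.obj (del i) ⟶ FF.obj (nab i),
          IsCanonicalMap τF (fun i => FF.obj (nab i)) (fun i => FF.obj (del i)) (i := i) cF) ∧
        ∀ (cO : del i ⟶ nab i) (cK : FK.obj (del i) ⟶ FK.obj (nab i))
          (cF : FF.obj (del i) ⟶ FF.obj (nab i)),
          IsCanonicalMap τO nab del cO →
          IsCanonicalMap τK (fun i => FK.obj (nab i)) (fun i => FK.obj (del i)) (i := i) cK →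
          IsCanonicalMap τF (fun i => FF.obj (nab i)) (fun i => FF.obj (del i)) (i := i) cF →
          -- the subobject `L_i⁺(O)` exists
          (∃ Lp : Subobject ((H0 tO).obj (nab i)), IsLplus O tO cO Lp) ∧
          ∀ Lp : Subobject ((H0 tO).obj (nab i)), IsLplus O tO cO Lp →
            -- `K(L_i(O)) ≅ K(L_i⁺(O)) ≅ L_i(K)`
            Nonempty (FK.obj (Lobj tO cO).obj ≅ FK.obj (Lp : HeartCat tO).obj) ∧
            Nonempty (FK.obj (Lp : HeartCat tO).obj ≅
              (Lobj (nab := fun i => FK.obj (nab i)) (del := fun i => FK.obj (del i))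
                (i := i) tK cK).obj) ∧
            -- `F(L_i(O))` lies in the heart, with simple head `L_i(F)`
            (∃ h : tF.heart (FF.obj (Lobj tO cO).obj),
              HasSimpleHead (⟨FF.obj (Lobj tO cO).obj, h⟩ : HeartCat tF)
                (Lobj (nab := fun i => FF.obj (nab i)) (del := fun i => FF.obj (del i))
                  (i := i) tF cF)) ∧
            -- `F(L_i⁺(O))` lies in the heart, with simple socle `L_i(F)`
            (∃ h : tF.heart (FF.obj (Lp : HeartCat tO).obj),
              HasSimpleSocle (⟨FF.obj (Lp : HeartCat tO).obj, h⟩ : HeartCat tF)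
                (Lobj (nab := fun i => FF.obj (nab i)) (del := fun i => FF.obj (del i))
                  (i := i) tF cF)) := by
  have : FaithfulSMul O K :=
    (faithfulSMul_iff_algebraMap_injective O K).2 (IsFractionRing.injective O K)
  exact mainTheorem10_general τO τK τF finO nab del excO dualO FK twistK genericK FF twistF residueF
    excK excF
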